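/- Let $q_1,q_2>0$ with $q_1<q_2$, let $Q:=\frac1{q_1}+\frac1{q_2}\in(1,2)$, and put $\widetilde Q_i:=Q-\frac1{2q_i}$, $H_i:=\frac12+q_i(Q-1)$, $\widetilde H_i:=1-\frac{q_i}2(2-Q)$. Let $\rho(u)=|u_1|^{q_1}+|u_2|^{q_2}$, $L(u)=L_+(u_1/\rho(u)^{1/q_1})\mathbf 1(u_2\ge0)+L_-(u_1/\rho(u)^{1/q_1})\mathbf 1(u_2<0)$ with $L_\pm$ continuous on $[-1,1]$, $L_+(\pm1)=L_-(\pm1)$, and $a_\infty(u)=\rho(u)^{-1}L(u)$ for $u\in\mathbb R^2\setminus\{0\}$. Let $B=(b_{ij})$ be a real nondegenerate $2\times2$ matrix and let $b:\mathbb Z^2\to\mathbb R$ satisfy $b(t)=\rho(Bt)^{-1}(L(Bt)+o(1))$ as $|t|\to\infty$. Let $\varepsilon(s)$, $s\in\mathbb Z^2$, be i.i.d. with mean $0$ and variance $1$, let $X(t)=\sum_{s\in\mathbb Z^2}b(t-s)\varepsilon(s)$ (convergence in mean square), and for $\gamma>0$ let $S_{\lambda,\gamma}(x)=\sum_{t\in(0,\lambda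 x_1]\times(0,\lambda^\gamma x_2]\cap\mathbb Z^2}X(t)$, $x\in\mathbb R_+^2=(0,\infty)^2$. With $W$ a Gaussian white noise on $\mathbb R^2$ whose variance is Lebesgue measure, and $(0,x]=(0,x_1]\times(0,x_2]$, put $$V_D(x)=|\det B|^{-1}\int_{\mathbb R^2}\Big\{\int_{\mathbb R^2}a_\infty(t)\mathbf 1(Dt+u\in(0,x])\,dt\Big\}W(du),\qquad \widetilde V_D(x)=|\det B|^{-1/2}\int_{\mathbb R^2}\Big\{\int_{(0,x]}a_\infty(Dt-u)\,dt\Big\}W(du),$$ and let $V_{11},V_{21},V_{01}$ be $V_D$ for $D=\frac1{\det B}\begin{bmatrix}b_{22}&0\\0&0\end{bmatrix},\ \frac1{\det B}\begin{bmatrix}0&0\\-b_{21}&0\end{bmatrix},\ \frac1{\det B}\begin{bmatrix}b_{22}&0\\-b_{21}&0\end{bmatrix}$, and $\widetilde V_{11},\widetilde V_{00}$ be $\widetilde V_D$ for $D=\begin{bmatrix}b_{11}&0\\0&0\end{bmatrix},\ \begin{bmatrix}b_{11}&0\\0&b_{22}\end{bmatrix}$. Let $B_{\mathcal H_1,\mathcal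 H_2}$ be the fractional Brownian sheet, i.e. the centred Gaussian field on $\mathbb R^2_+$ with covariance $\frac14\prod_{i=1}^2(x_i^{2\mathcal H_i}+y_i^{2\mathcal H_i}-|x_i-y_i|^{2\mathcal H_i})$. Assume $\widetilde Q_1<1<\widetilde Q_2$. Then, as $\lambda\to\infty$, in the sense of finite-dimensional distributions on $\mathbb R_+^2$: (i) (incongruous scaling) If $b_{21}b_{22}\ne0$, then $V_{11},V_{21},V_{01}$ are well defined, $V_{11}\overset{fdd}=\sigma_{11}B_{H_1,1/2}$ and $V_{21}\overset{fdd}=\sigma_{21}B_{1/2,H_1}$ with $\sigma_{ij}^2=\mathrm E V_{ij}(1,1)^2$, and the critical point is $\gamma_0=1$: $\lambda^{-(H_1+\gamma/2)}S_{\lambda,\gamma}\to V_{11}$ for every $\gamma>1$; $\lambda^{-(1/2+\gamma H_1)}S_{\lambda,\gamma}\to V_{21}$ for every $0<\gamma<1$; $\lambda^{-(H_1+1/2)}S_{\lambda,1}\to V_{01}$. Moreover, unless $\sigma_{11}=\sigma_{21}=0$, there is no $c>0$ with $V_{11}\overset{fdd}=cV_{21}$. (ii) (congruous scaling) If $b_{21}=0$,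 then $V_{11},\widetilde V_{11},\widetilde V_{00}$ are well defined, $V_{11}\overset{fdd}=\sigma_{11}B_{H_1,1/2}$ and $\widetilde V_{11}\overset{fdd}=\widetilde\sigma_{11}B_{\widetilde H_1,1}$ with $\widetilde\sigma_{11}^2=\mathrm E\widetilde V_{11}(1,1)^2$, and the critical point is $\gamma_0=q_1/q_2$: $\lambda^{-(H_1+\gamma/2)}S_{\lambda,\gamma}\to V_{11}$ for every $\gamma>q_1/q_2$; $\lambda^{-(\widetilde H_1+\gamma)}S_{\lambda,\gamma}\to\widetilde V_{11}$ for every $0<\gamma<q_1/q_2$; $\lambda^{-(H_1+\gamma/2)}S_{\lambda,\gamma}\to\widetilde V_{00}$ for $\gamma=q_1/q_2$. Moreover, unless $\sigma_{11}=\widetilde\sigma_{11}=0$, there is no $c>0$ with $V_{11}\overset{fdd}=c\widetilde V_{11}$. -/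

import Mathlib

open MeasureTheory ProbabilityTheory Filter Topology Asymptotics
open scoped Matrix

noncomputable section

namespace PlanarScaling

/-! ### Exponents -/

/-- `Q = 1/q₁ + 1/q₂`. -/
def expQ (q₁ q₂ : ℝ) : ℝ := 1 / q₁ + 1 / q₂

/-- `Q̃ᵢ = Q - 1/(2 qᵢ)`, where `q` is `q₁` or `q₂`. -/
def expQtilde (q₁ q₂ q : ℝ) : ℝ := expQ q₁ q₂ - 1 / (2 * q)

/-- `H̃ᵢ = 1 - (qᵢ/2) (2 - Q)`, where `q` is `q₁` or `q₂`. -/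
def hurstTilde (q₁ q₂ q : ℝ) : ℝ := 1 - q / 2 * (2 - expQ q₁ q₂)

/-- `Hᵢ = 1/2 + qᵢ (Q - 1)`, where `q` is `q₁` or `q₂`. -/
def hurst (q₁ q₂ q : ℝ) : ℝ := 1 / 2 + q * (expQ q₁ q₂ - 1)

/-! ### Moving-average coefficients -/

/-- `ρ(u) = |u₁|^{q₁} + |u₂|^{q₂}`. -/
def rho (q₁ q₂ : ℝ) (u : Fin 2 → ℝ) : ℝ := |u 0| ^ q₁ + |u 1| ^ q₂

/-- `L(u) = L₊(u₁/ρ(u)^{1/q₁}) 1(u₂ ≥ 0) + L₋(u₁/ρ(u)^{1/q₁}) 1(u₂ < 0)`. -/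
def angular (q₁ q₂ : ℝ) (Lpos Lneg : ℝ → ℝ) (u : Fin 2 → ℝ) : ℝ :=
  if 0 ≤ u 1 then Lpos (u 0 / rho q₁ q₂ u ^ (1 / q₁))
  else Lneg (u 0 / rho q₁ q₂ u ^ (1 / q₁))

/-- `a_∞(u) = ρ(u)⁻¹ L(u)`. -/
def aInf (q₁ q₂ : ℝ) (Lpos Lneg : ℝ → ℝ) (u : Fin 2 → ℝ) : ℝ :=
  (rho q₁ q₂ u)⁻¹ * angular q₁ q₂ Lpos Lneg u

/-- The image `B t` in the plane of a lattice point `t`. -/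
def latticeImage (B : Matrix (Fin 2) (Fin 2) ℝ) (t : Fin 2 → ℤ) : Fin 2 → ℝ :=
  B *ᵥ fun i => (t i : ℝ)

/-- `b(t) = ρ(B t)⁻¹ (L(B t) + o(1))` as `|t| → ∞` in the lattice, that is, along the filter of
complements of finite sets. -/
def HasCoeffAsymptotics (q₁ q₂ : ℝ) (Lpos Lneg : ℝ → ℝ) (B : Matrix (Fin 2) (Fin 2) ℝ)
    (b : (Fin 2 → ℤ) → ℝ) : Prop :=
  (fun t => b t - (rho q₁ q₂ (latticeImage B t))⁻¹ *
      angular q₁ q₂ Lpos Lneg (latticeImage B t))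
    =o[cofinite] fun t => (rho q₁ q₂ (latticeImage B t))⁻¹

/-! ### The linear random field and its partial sums -/

/-- Independent identically distributed innovations with mean `0` and variance `1`. -/
structure IsInnovationField {Ω : Type*} [MeasurableSpace Ω] (ε : (Fin 2 → ℤ) → Ω → ℝ)
    (P : Measure Ω) : Prop where
  indep : iIndepFun ε P
  identDistrib : ∀ s, IdentDistrib (ε s) (ε 0) P P
  memLp : MemLp (ε 0) 2 P
  mean_zero : ∫ ω, ε 0 ω ∂P = 0
  second_moment : ∫ ω, ε 0 ω ^ 2 ∂P = 1

/-- `X(t) = ∑ₛ b(t - s) ε(s)`, the series being (unconditionally) convergent in mean square.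
This determines each `X(t)` almost surely. -/
def IsLinearField {Ω : Type*} [MeasurableSpace Ω] (b : (Fin 2 → ℤ) → ℝ)
    (ε : (Fin 2 → ℤ) → Ω → ℝ) (X : (Fin 2 → ℤ) → Ω → ℝ) (P : Measure Ω) : Prop :=
  ∀ t, MemLp (X t) 2 P ∧
    Tendsto (fun F : Finset (Fin 2 → ℤ) =>
      eLpNorm (fun ω => X t ω - ∑ s ∈ F, b (t - s) * ε s ω) 2 P) atTop (𝓝 0)

/-- The open quadrant `ℝ²₊`. -/
abbrev Quadrant : Type := {x : Fin 2 → ℝ // ∀ i, 0 < x i}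

/-- The point `(1, 1)`. -/
def onePt : Quadrant := ⟨fun _ => 1, fun _ => one_pos⟩

/-- `S_{l,γ}(x)`, the sum of `X(t)` over lattice points `t` in `(0, l x₁] × (0, l^γ x₂]`. -/
def partialSum {Ω : Type*} (X : (Fin 2 → ℤ) → Ω → ℝ) (γ l : ℝ) (x : Quadrant) (ω : Ω) : ℝ :=
  ∑ t ∈ Fintype.piFinset ![Finset.Ioc (0 : ℤ) ⌊l * x.1 0⌋, Finset.Ioc (0 : ℤ) ⌊l ^ γ * x.1 1⌋],
    X t ω

/-! ### White noise, stochastic integrals and limit fields -/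

/-- Gaussian white noise on `ℝ²` with variance the Lebesgue measure, as a centred Gaussian family
indexed by `L²(ℝ²)` with `E W(h) W(k) = ∫ h k`. The noise of a Borel set `A` of finite
measure is `W(1_A)`, and `W(h)` is the stochastic integral of `h`. -/
structure IsWhiteNoise {Ω : Type*} [MeasurableSpace Ω]
    (W : Lp ℝ 2 (volume : Measure (Fin 2 → ℝ)) → Ω → ℝ) (P : Measure Ω) : Prop where
  gaussian : IsGaussianProcess W P
  mean_zero : ∀ h, ∫ ω, W h ω ∂P = 0
  covariance : ∀ h k, ∫ ω, W h ω * W k ω ∂P = inner ℝ h k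

open Classical in
/-- `I(h) = ∫ h(u) W(du)` for a square integrable function `h` (and `0` for other `h`). -/
def stochIntegral {Ω : Type*} (W : Lp ℝ 2 (volume : Measure (Fin 2 → ℝ)) → Ω → ℝ)
    (h : (Fin 2 → ℝ) → ℝ) : Ω → ℝ :=
  if hh : MemLp h 2 (volume : Measure (Fin 2 → ℝ)) then W (hh.toLp h) else 0

/-- The rectangle `(0, x] = (0, x₁] × (0, x₂]`. -/
def rect (x : Quadrant) : Set (Fin 2 → ℝ) := Set.univ.pi fun i => Set.Ioc 0 (x.1 i)

/-- `u ↦ |det B|^{-1/2} ∫_{(0,x]} a(D t - u) dt`. -/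
def kernelTilde (B : Matrix (Fin 2) (Fin 2) ℝ) (a : (Fin 2 → ℝ) → ℝ)
    (D : Matrix (Fin 2) (Fin 2) ℝ) (x : Quadrant) (u : Fin 2 → ℝ) : ℝ :=
  |B.det| ^ (-(1 / 2) : ℝ) * ∫ t in rect x, a (D *ᵥ t - u)

/-- `u ↦ |det B|^{-1} ∫ a(t) 1(D t + u ∈ (0,x]) dt`. -/
def kernelV (B : Matrix (Fin 2) (Fin 2) ℝ) (a : (Fin 2 → ℝ) → ℝ)
    (D : Matrix (Fin 2) (Fin 2) ℝ) (x : Quadrant) (u : Fin 2 → ℝ) : ℝ :=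
  |B.det|⁻¹ * ∫ t in {t : Fin 2 → ℝ | D *ᵥ t + u ∈ rect x}, a t

/-- The field `Ṽ_D(x) = ∫ kernelTilde(x, u) W(du)`. -/
def fieldTilde {Ω : Type*} (W : Lp ℝ 2 (volume : Measure (Fin 2 → ℝ)) → Ω → ℝ)
    (B : Matrix (Fin 2) (Fin 2) ℝ) (a : (Fin 2 → ℝ) → ℝ) (D : Matrix (Fin 2) (Fin 2) ℝ)
    (x : Quadrant) : Ω → ℝ :=
  stochIntegral W (kernelTilde B a D x)

/-- The field `V_D(x) = ∫ kernelV(x, u) W(du)`. -/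
def fieldV {Ω : Type*} (W : Lp ℝ 2 (volume : Measure (Fin 2 → ℝ)) → Ω → ℝ)
    (B : Matrix (Fin 2) (Fin 2) ℝ) (a : (Fin 2 → ℝ) → ℝ) (D : Matrix (Fin 2) (Fin 2) ℝ)
    (x : Quadrant) : Ω → ℝ :=
  stochIntegral W (kernelV B a D x)

/-- `Ṽ_D` is well defined: the inner integrals converge absolutely for almost every `u`, and the
resulting kernels are square integrable. -/
def TildeWellDefined (B : Matrix (Fin 2) (Fin 2) ℝ) (a : (Fin 2 → ℝ) → ℝ)
    (D : Matrix (Fin 2) (Fin 2) ℝ) : Prop :=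
  ∀ x : Quadrant,
    (∀ᵐ u : Fin 2 → ℝ, IntegrableOn (fun t => a (D *ᵥ t - u)) (rect x)) ∧
      MemLp (kernelTilde B a D x) 2 (volume : Measure (Fin 2 → ℝ))

/-- `V_D` is well defined: the inner integrals converge absolutely for almost every `u`, and the
resulting kernels are square integrable. -/
def VWellDefined (B : Matrix (Fin 2) (Fin 2) ℝ) (a : (Fin 2 → ℝ) → ℝ)
    (D : Matrix (Fin 2) (Fin 2) ℝ) : Prop :=
  ∀ x : Quadrant,
    (∀ᵐ u : Fin 2 → ℝ, IntegrableOn a {t : Fin 2 → ℝ | D *ᵥ t + u ∈ rect x}) ∧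
      MemLp (kernelV B a D x) 2 (volume : Measure (Fin 2 → ℝ))

/-- `B̃₀₀`. -/
def matTilde00 (B : Matrix (Fin 2) (Fin 2) ℝ) : Matrix (Fin 2) (Fin 2) ℝ :=
  !![B 0 0, 0; 0, B 1 1]

/-- `B̃₁₁`. -/
def matTilde11 (B : Matrix (Fin 2) (Fin 2) ℝ) : Matrix (Fin 2) (Fin 2) ℝ :=
  !![B 0 0, 0; 0, 0]

/-- `B₀₁`. -/
def mat01 (B : Matrix (Fin 2) (Fin 2) ℝ) : Matrix (Fin 2) (Fin 2) ℝ :=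
  (B.det)⁻¹ • !![B 1 1, 0; -B 1 0, 0]

/-- `B₁₁`. -/
def mat11 (B : Matrix (Fin 2) (Fin 2) ℝ) : Matrix (Fin 2) (Fin 2) ℝ :=
  (B.det)⁻¹ • !![B 1 1, 0; 0, 0]

/-- `B₂₁`. -/
def mat21 (B : Matrix (Fin 2) (Fin 2) ℝ) : Matrix (Fin 2) (Fin 2) ℝ :=
  (B.det)⁻¹ • !![0, 0; -B 1 0, 0]

/-! ### Laws of fields indexed by the quadrant -/

/-- The standard deviation `(E |V(1,1)|²)^{1/2}`. -/
def sigmaOne {Ω : Type*} [MeasurableSpace Ω] (V : Quadrant → Ω → ℝ) (P : Measure Ω) : ℝ :=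
  Real.sqrt (∫ ω, V onePt ω ^ 2 ∂P)

/-- `V` has the law of `σ B_{h₁,h₂}`, where `B_{h₁,h₂}` is the fractional Brownian sheet
with Hurst parameters `h₁`, `h₂`: it is a centred Gaussian field with covariance
`σ² (1/4) ∏ᵢ (xᵢ^{2hᵢ} + yᵢ^{2hᵢ} - |xᵢ - yᵢ|^{2hᵢ})`. -/
structure IsFractionalBrownianSheet {Ω : Type*} [MeasurableSpace Ω] (σ h₁ h₂ : ℝ)
    (V : Quadrant → Ω → ℝ) (P : Measure Ω) : Prop where
  gaussian : IsGaussianProcess V P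
  mean_zero : ∀ x, ∫ ω, V x ω ∂P = 0
  covariance : ∀ x y : Quadrant, ∫ ω, V x ω * V y ω ∂P = σ ^ 2 * ((1 / 4) *
    ((x.1 0 ^ (2 * h₁) + y.1 0 ^ (2 * h₁) - |x.1 0 - y.1 0| ^ (2 * h₁)) *
     (x.1 1 ^ (2 * h₂) + y.1 1 ^ (2 * h₂) - |x.1 1 - y.1 1| ^ (2 * h₂))))

/-- Equality of finite-dimensional distributions. -/
def EqFdd {Ω : Type*} [MeasurableSpace Ω] (V V' : Quadrant → Ω → ℝ) (P : Measure Ω) : Prop :=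
  ∀ (n : ℕ) (x : Fin n → Quadrant),
    P.map (fun ω i => V (x i) ω) = P.map (fun ω i => V' (x i) ω)

/-- `l^{-H} S_{l,γ}(x)`, `x ∈ ℝ²₊`, converges to `V(x)`, `x ∈ ℝ²₊`, in the sense of
finite-dimensional distributions as `l → ∞`. -/
def HasScalingLimit {Ω Ω' : Type*} [MeasurableSpace Ω] [MeasurableSpace Ω']
    (X : (Fin 2 → ℤ) → Ω → ℝ) (P : Measure Ω) [IsProbabilityMeasure P] (γ H : ℝ)
    (V : Quadrant → Ω' → ℝ) (P' : Measure Ω') [IsProbabilityMeasure P'] : Prop :=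
  ∀ (n : ℕ) (x : Fin n → Quadrant),
    TendstoInDistribution (fun (l : ℝ) ω i => (l ^ H)⁻¹ * partialSum X γ l (x i) ω) atTop
      (fun ω i => V (x i) ω) (fun _ => P) P'

end PlanarScaling

end

/-!
The coefficients of `λ⁻ᴴ S_{λ,γ}(x)` in the innovations are normalized sums of `b` over a translated
rectangle. If, as step functions on cells of size `n₁⁻¹ × n₂⁻¹` with `n₁ n₂ → ∞`, they converge in
`L²(ℝ²)` to some `h x`, then each coefficient tends to zero uniformly, a Lindeberg-type comparison of
characteristic functions (`IsInnovationField.charFun_linearForm`) makes every linear combination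
asymptotically Gaussian, and the limit variance is given by the Gram matrix of the `h x`. So it is
enough that the kernel of the limit field has the same Gram matrix as `h`
(`hasScalingLimit_of_tendsto`), and the rest of the argument takes place in `L²(ℝ²)`.

Put `κ = q₁ - q₁ / q₂`. The assumptions `1 < Q` and `Q̃₁ < 1` say precisely that `1 / 2 < κ < 1`.
Along `(M w, -(b₂₁ / b₂₂) M w + M^(q₁/q₂) z)` the rescaled coefficients `M^q₁ b` converge to
`a_∞(det B / b₂₂ · w, b₂₂ z)` and are bounded by a multiple of `(|w|^q₁ + |z|^q₂)⁻¹`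
(`IsLatticeKernel.rescaled_tendsto`, `IsLatticeKernel.rescaled_bound`), because the oblique direction
keeps `(B t)₂` of order `M^(q₁/q₂)`. In these coordinates a normalized rectangle sum is an integral
over `(w, z)`. Integrating the bound over `z` leaves a multiple of `|w|^(-κ)`, which is locally
integrable as `κ < 1`, and whose convolution with the indicator of an interval lies in `L²(ℝ)` as
`1 / 2 < κ`. A Cauchy–Schwarz inequality weighted by the bound, together with dominated convergence,
then yields `tendsto_rescaled_boxSum`. The parameters `e₁ = lim (b₂₁ / b₂₂) m₁ / m₂` and
`e₂ = lim m₁^(q₁/q₂) / m₂`, where `m₁`, `m₂` are the sides of the rectangle, distinguish `V₁₁`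
(`e₁ = e₂ = 0`), `V₀₁` (`e₁ = b₂₁ / b₂₂`, `e₂ = 0`) and `Ṽ₀₀` (`e₁ = 0`, `e₂ = 1`); `V₂₁` is `V₁₁`
with the coordinates exchanged.

When `b₂₁ = 0` and `γ < q₁ / q₂`, the rectangle is shorter than the scale `λ^(q₁/q₂)` on which `b`
varies in the second direction. A rectangle sum is then an average of sums over single rows, shifted
by a vanishing amount. The row sums converge in `L²`, dominated through the interpolations
`(|w|^q₁ + |z|^q₂)⁻¹ ≤ |w|^(-q₁ θ) |z|^(-q₂ (1 - θ))`. One exponent `θ` gives square integrability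
for small `z`, which is possible since `1 < Q̃₂`, and another one for large `z`, which is possible
since `Q < 2`. The shifts disappear by continuity of translations in `L²`
(`tendsto_rescaled_boxSum_row`).

The limit kernels for `V₁₁`, `V₂₁` and `Ṽ₁₁` are products of an indicator function (or a constant) in
one coordinate of `x` and a kernel with self-similar, stationary increments in the other. These two
properties force the covariance of a fractional Brownian motion (`integral_mul_of_selfSimilar`), so
the fields are fractional Brownian sheets. Two sheets are not multiples of each other if their
variances grow differently between `(1, 1)` and `(2, 1)`, or `(1, 1)` and `(1, 2)`
(`not_eqFdd_of_isFractionalBrownianSheet`).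
-/

open scoped ENNReal

namespace PlanarScaling

/-! ### Linear forms in the innovations -/

section LinearForms

variable {Ω : Type*} [MeasurableSpace Ω] {P : Measure Ω}
  {ε : (Fin 2 → ℤ) → Ω → ℝ}

/-- `Y = ∑ₛ g(s) ε(s)`, the series being unconditionally convergent in mean square. -/
def IsLinearForm (ε : (Fin 2 → ℤ) → Ω → ℝ) (P : Measure Ω) (g : (Fin 2 → ℤ) → ℝ)
    (Y : Ω → ℝ) : Prop :=
  MemLp Y 2 P ∧ Tendsto (fun F : Finset (Fin 2 → ℤ) =>
    eLpNorm (fun ω => Y ω - ∑ s ∈ F, g s * ε s ω) 2 P) atTop (𝓝 0)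

lemma IsInnovationField.memLp_eval (hε : IsInnovationField ε P) (s : Fin 2 → ℤ) :
    MemLp (ε s) 2 P :=
  (hε.identDistrib s).memLp_iff.2 hε.memLp

lemma IsInnovationField.memLp_sum (hε : IsInnovationField ε P) (g : (Fin 2 → ℤ) → ℝ)
    (F : Finset (Fin 2 → ℤ)) : MemLp (fun ω => ∑ s ∈ F, g s * ε s ω) 2 P :=
  memLp_finsetSum _ fun s _ => (hε.memLp_eval s).const_mul (g s)

lemma IsLinearForm.zero : IsLinearForm ε P (fun _ => 0) (fun _ => 0) := by
  refine ⟨by simp, ?_⟩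
  simp

lemma IsLinearForm.add (hε : IsInnovationField ε P) {g g' : (Fin 2 → ℤ) → ℝ} {Y Y' : Ω → ℝ}
    (h : IsLinearForm ε P g Y) (h' : IsLinearForm ε P g' Y') :
    IsLinearForm ε P (fun s => g s + g' s) (fun ω => Y ω + Y' ω) := by
  refine ⟨h.1.add h'.1, ?_⟩
  refine tendsto_of_tendsto_of_tendsto_of_le_of_le tendsto_const_nhds
    (by simpa using h.2.add h'.2) (fun _ => zero_le) fun F => ?_
  have key : (fun ω => Y ω + Y' ω - ∑ s ∈ F, (g s + g' s) * ε s ω)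
      = (fun ω => Y ω - ∑ s ∈ F, g s * ε s ω) + fun ω => Y' ω - ∑ s ∈ F, g' s * ε s ω := by
    ext ω
    simp only [Pi.add_apply, add_mul, Finset.sum_add_distrib]
    ring
  simp only [key]
  exact eLpNorm_add_le (h.1.sub (hε.memLp_sum g F)).1 (h'.1.sub (hε.memLp_sum g' F)).1
    (by norm_num)

lemma IsLinearForm.const_mul {g : (Fin 2 → ℤ) → ℝ} {Y : Ω → ℝ}
    (h : IsLinearForm ε P g Y) (c : ℝ) :
    IsLinearForm ε P (fun s => c * g s) (fun ω => c * Y ω) := by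
  refine ⟨h.1.const_mul c, ?_⟩
  have key : ∀ F : Finset (Fin 2 → ℤ), eLpNorm (fun ω => c * Y ω - ∑ s ∈ F, c * g s * ε s ω) 2 P
      = ‖c‖ₑ * eLpNorm (fun ω => Y ω - ∑ s ∈ F, g s * ε s ω) 2 P := by
    intro F
    rw [← eLpNorm_const_smul]
    congr 1
    ext ω
    simp only [Pi.smul_apply, smul_eq_mul, mul_sub, Finset.mul_sum, mul_assoc]
  simp only [key]
  simpa using ENNReal.Tendsto.const_mul h.2 (Or.inr (by simp : ‖c‖ₑ ≠ ⊤))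

lemma IsLinearForm.sum (hε : IsInnovationField ε P) {ι : Type*} (T : Finset ι)
    {g : ι → (Fin 2 → ℤ) → ℝ} {Y : ι → Ω → ℝ} (h : ∀ i ∈ T, IsLinearForm ε P (g i) (Y i)) :
    IsLinearForm ε P (fun s => ∑ i ∈ T, g i s) (fun ω => ∑ i ∈ T, Y i ω) := by
  classical
  induction T using Finset.induction_on with
  | empty => simpa using IsLinearForm.zero
  | insert i T hi ih =>
    simp only [Finset.sum_insert hi]
    exact (h i (Finset.mem_insert_self i T)).add hε
      (ih fun j hj => h j (Finset.mem_insert_of_mem hj))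

lemma IsLinearField.isLinearForm {b : (Fin 2 → ℤ) → ℝ} {X : (Fin 2 → ℤ) → Ω → ℝ}
    (hX : IsLinearField b ε X P) (t : Fin 2 → ℤ) :
    IsLinearForm ε P (fun s => b (t - s)) (X t)   := hX t

lemma IsInnovationField.inner_eval (hε : IsInnovationField ε P) (s s' : Fin 2 → ℤ) :
    ∫ ω, ε s ω * ε s' ω ∂P = if s = s' then 1 else 0 := by
  have hm : ∀ s, ∫ ω, ε s ω ∂P = 0 := fun s => by
    rw [(hε.identDistrib s).integral_eq, hε.mean_zero]
  split_ifs with h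
  · subst h
    have := ((hε.identDistrib s).comp (u := fun x : ℝ => x ^ 2) (by fun_prop)).integral_eq
    simp only [Function.comp_def] at this
    rw [← hε.second_moment, ← this]
    simp [sq]
  · have := (hε.indep.indepFun h).integral_mul_eq_mul_integral (hε.memLp_eval s).1
      (hε.memLp_eval s').1
    simpa [hm] using this

lemma IsInnovationField.orthonormal (hε : IsInnovationField ε P) :
    Orthonormal ℝ fun s => (hε.memLp_eval s).toLp (ε s) := by
  classical
  rw [orthonormal_iff_ite]
  intro s s'
  rw [← hε.inner_eval s s', L2.inner_def]
  refine integral_congr_ae ?_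
  filter_upwards [(hε.memLp_eval s).coeFn_toLp, (hε.memLp_eval s').coeFn_toLp] with ω h h'
  rw [h, h']
  simp [mul_comm]

/-- Parseval's identity for a linear form; in particular its coefficients are square summable. -/
lemma IsLinearForm.hasSum_sq (hε : IsInnovationField ε P) {g : (Fin 2 → ℤ) → ℝ} {Y : Ω → ℝ}
    (h : IsLinearForm ε P g Y) : HasSum (fun s => g s ^ 2) (‖h.1.toLp Y‖ ^ 2) := by
  have h1 : Tendsto (fun F : Finset (Fin 2 → ℤ) => (hε.memLp_sum g F).toLp _) atTop
      (𝓝 (h.1.toLp Y)) := by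
    rw [Lp.tendsto_Lp_iff_tendsto_eLpNorm'']
    refine h.2.congr fun F => ?_
    rw [← eLpNorm_neg]
    congr 1
    ext ω
    simp
  have h2 := (h1.norm).pow 2
  refine h2.congr fun F => ?_
  have h3 : (hε.memLp_sum g F).toLp _ = ∑ s ∈ F, g s • (hε.memLp_eval s).toLp (ε s) := by
    classical
    have : ∀ F : Finset (Fin 2 → ℤ), ∀ h : MemLp (fun ω => ∑ s ∈ F, g s * ε s ω) 2 P,
        h.toLp _ = ∑ s ∈ F, g s • (hε.memLp_eval s).toLp (ε s) := by
      intro F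
      induction F using Finset.induction_on with
      | empty =>
        intro h
        simp only [Finset.sum_empty]
        exact MemLp.toLp_zero _
      | insert s F hs ih =>
        intro h
        rw [Finset.sum_insert hs, ← ih (hε.memLp_sum g F), ← MemLp.toLp_const_smul,
          ← MemLp.toLp_add]
        refine MemLp.toLp_congr _ _ (Eventually.of_forall fun ω => ?_)
        simp [Finset.sum_insert hs]
    exact this F _
  rw [h3, ← real_inner_self_eq_norm_sq, hε.orthonormal.inner_sum]
  exact Finset.sum_congr rfl fun s _ => by simp [sq]

/-! ### A central limit theorem for linear forms -/

lemma norm_prod_sub_prod_le {ι : Type*} (F : Finset ι) (f g : ι → ℂ)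
    (hf : ∀ i ∈ F, ‖f i‖ ≤ 1) (hg : ∀ i ∈ F, ‖g i‖ ≤ 1) :
    ‖∏ i ∈ F, f i - ∏ i ∈ F, g i‖ ≤ ∑ i ∈ F, ‖f i - g i‖ := by
  classical
  induction F using Finset.induction_on with
  | empty => simp
  | insert i F hi ih =>
    rw [Finset.prod_insert hi, Finset.prod_insert hi, Finset.sum_insert hi]
    have h1 := ih (fun j hj => hf j (Finset.mem_insert_of_mem hj))
      (fun j hj => hg j (Finset.mem_insert_of_mem hj))
    have h2 : ‖∏ j ∈ F, f j‖ ≤ 1 := by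
      rw [norm_prod]
      exact Finset.prod_le_one (fun _ _ => norm_nonneg _)
        fun j hj => hf j (Finset.mem_insert_of_mem hj)
    have h3 : f i * ∏ j ∈ F, f j - g i * ∏ j ∈ F, g j
        = (f i - g i) * ∏ j ∈ F, f j + g i * (∏ j ∈ F, f j - ∏ j ∈ F, g j) := by ring
    rw [h3]
    refine (norm_add_le _ _).trans ?_
    rw [norm_mul, norm_mul]
    have h4 := hg i (Finset.mem_insert_self i F)
    refine add_le_add (mul_le_of_le_one_right (norm_nonneg _) h2) ?_
    exact (mul_le_of_le_one_left (norm_nonneg _) h4).trans h1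

variable [IsProbabilityMeasure P]

/-- Near `0` the characteristic function of an innovation is that of the standard normal law up to
`o(t²)`. -/
lemma IsInnovationField.charFun_sub_exp (hε : IsInnovationField ε P) {η : ℝ} (hη : 0 < η) :
    ∃ δ > 0, ∀ t : ℝ, |t| ≤ δ →
      ‖charFun (P.map (ε 0)) t - Complex.exp (-(t ^ 2) / 2)‖ ≤ η * t ^ 2 := by
  have h1 := taylor_charFun_two hε.memLp.1.aemeasurable hε.mean_zero
    (by simpa using hε.second_moment)
  have h2 : (fun t : ℝ => Complex.exp (-((t : ℂ) ^ 2) / 2) - (1 - (t : ℂ) ^ 2 / 2)) =o[𝓝 0]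
      fun t : ℝ => t ^ 2 := by
    have h3 : (fun z : ℂ => Complex.exp z - 1 - z) =o[𝓝 0] fun z => z := by
      have := (Complex.hasDerivAt_exp 0).isLittleO
      simpa using this
    have h4 : Tendsto (fun t : ℝ => -((t : ℂ) ^ 2) / 2) (𝓝 0) (𝓝 0) := by
      have : Continuous fun t : ℝ => -((t : ℂ) ^ 2) / 2 := by fun_prop
      simpa using this.tendsto 0
    have h5 := h3.comp_tendsto h4
    have h6 : (fun t : ℝ => -((t : ℂ) ^ 2) / 2) =O[𝓝 0] fun t : ℝ => t ^ 2 := by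
      refine IsBigO.of_bound 1 (Eventually.of_forall fun t => ?_)
      simp only [norm_div, norm_neg, norm_pow, Complex.norm_real, Real.norm_eq_abs]
      norm_num
      nlinarith [sq_nonneg t]
    refine (h5.trans_isBigO h6).congr_left fun t => ?_
    simp only [Function.comp_apply]
    ring
  have h7 := h1.sub h2
  have h8 := h7.def hη
  rw [Metric.eventually_nhds_iff] at h8
  obtain ⟨δ, hδ, h9⟩ := h8
  refine ⟨δ / 2, by positivity, fun t ht => ?_⟩
  have := @h9 t (by simp; linarith)
  simpa using this

lemma norm_charFun_map_sub_le {Y Z : Ω → ℝ} (hY : MemLp Y 2 P) (hZ : MemLp Z 2 P) :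
    ‖charFun (P.map Y) 1 - charFun (P.map Z) 1‖ ≤ (eLpNorm (fun ω => Y ω - Z ω) 2 P).toReal := by
  have hi : ∀ {V : Ω → ℝ}, MemLp V 2 P →
      Integrable (fun ω => Complex.exp (V ω * Complex.I)) P := by
    intro V hV
    refine Integrable.of_bound (C := 1) ?_ (Eventually.of_forall fun ω => ?_)
    · exact (Continuous.comp_aestronglyMeasurable
        (g := fun x : ℝ => Complex.exp (x * Complex.I)) (by fun_prop) hV.1)
    · rw [Complex.norm_exp_ofReal_mul_I]
  have hc : ∀ {V : Ω → ℝ}, MemLp V 2 P →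
      charFun (P.map V) 1 = ∫ ω, Complex.exp (V ω * Complex.I) ∂P := by
    intro V hV
    rw [charFun_apply_real, integral_map hV.1.aemeasurable (by fun_prop)]
    simp
  rw [hc hY, hc hZ, ← integral_sub (hi hY) (hi hZ)]
  have hd := hY.sub hZ
  have hd1 : MemLp (Y - Z) 1 P := hd.mono_exponent (by norm_num)
  have h1 : ∀ ω, ‖Complex.exp (Y ω * Complex.I) - Complex.exp (Z ω * Complex.I)‖
      ≤ ‖(Y - Z) ω‖ := by
    intro ω
    have : Complex.exp (Y ω * Complex.I) - Complex.exp (Z ω * Complex.I)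
        = Complex.exp (Z ω * Complex.I) *
          (Complex.exp (Complex.I * ((Y ω - Z ω : ℝ) : ℂ)) - 1) := by
      rw [mul_sub, ← Complex.exp_add]
      push_cast
      ring_nf
    rw [this, norm_mul, Complex.norm_exp_ofReal_mul_I, one_mul]
    exact Real.norm_exp_I_mul_ofReal_sub_one_le
  calc _ ≤ ∫ ω, ‖(Y - Z) ω‖ ∂P :=
        norm_integral_le_of_norm_le ((memLp_one_iff_integrable.1 hd1).norm)
          (Eventually.of_forall h1)
    _ = (eLpNorm (Y - Z) 1 P).toReal := by
        rw [eLpNorm_one_eq_lintegral_enorm, integral_norm_eq_lintegral_enorm hd.1]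
    _ ≤ (eLpNorm (Y - Z) 2 P).toReal :=
        ENNReal.toReal_mono hd.2.ne (eLpNorm_le_eLpNorm_of_exponent_le (by norm_num) hd.1)

/-- Lindeberg's estimate for linear forms: if all coefficients are small, the characteristic
function is close to that of a centred normal law with the same variance. -/
lemma IsInnovationField.charFun_linearForm (hε : IsInnovationField ε P) {η : ℝ} (hη : 0 < η) :
    ∃ δ > 0, ∀ (g : (Fin 2 → ℤ) → ℝ) (Y : Ω → ℝ), IsLinearForm ε P g Y → (∀ s, |g s| ≤ δ) →
      ‖charFun (P.map Y) 1 - Complex.exp (-((∑' s, g s ^ 2 : ℝ) : ℂ) / 2)‖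
        ≤ η * ∑' s, g s ^ 2 := by
  obtain ⟨δ, hδ, h0⟩ := hε.charFun_sub_exp hη
  refine ⟨δ, hδ, fun g Y hY hg => ?_⟩
  have hs := (hY.hasSum_sq hε).summable.hasSum
  have hcf : ∀ F : Finset (Fin 2 → ℤ), charFun (P.map fun ω => ∑ s ∈ F, g s * ε s ω) 1
      = ∏ s ∈ F, charFun (P.map (ε 0)) (g s) := by
    intro F
    have hm : ∀ s, AEMeasurable (fun ω => g s * ε s ω) P :=
      fun s => ((hε.memLp_eval s).const_mul (g s)).1.aemeasurable
    have hind : iIndepFun (fun s ω => g s * ε s ω) P :=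
      hε.indep.comp (fun s x => g s * x) fun s => by fun_prop
    rw [(hind.restrict F).charFun_map_fun_finsetSum_eq_prod fun s _ => hm s, Finset.prod_apply]
    refine Finset.prod_congr rfl fun s _ => ?_
    rw [charFun_map_mul_comp (hε.memLp_eval s).1.aemeasurable, mul_one,
      (hε.identDistrib s).map_eq]
  have h1 : Tendsto (fun F : Finset (Fin 2 → ℤ) =>
      charFun (P.map fun ω => ∑ s ∈ F, g s * ε s ω) 1) atTop (𝓝 (charFun (P.map Y) 1)) := by
    rw [tendsto_iff_norm_sub_tendsto_zero]
    have h2 := (ENNReal.tendsto_toReal (by simp : (0 : ENNReal) ≠ ⊤)).comp hY.2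
    refine squeeze_zero (fun _ => norm_nonneg _) (fun F => ?_) h2
    rw [norm_sub_rev]
    exact norm_charFun_map_sub_le hY.1 (hε.memLp_sum g F)
  have h3 : Tendsto (fun F : Finset (Fin 2 → ℤ) =>
      Complex.exp (-((∑ s ∈ F, g s ^ 2 : ℝ) : ℂ) / 2)) atTop
      (𝓝 (Complex.exp (-((∑' s, g s ^ 2 : ℝ) : ℂ) / 2))) := by
    have : Continuous fun x : ℝ => Complex.exp (-(x : ℂ) / 2) := by fun_prop
    exact (this.tendsto _).comp hs
  refine le_of_tendsto_of_tendsto' (h1.sub h3).norm (hs.const_mul η) fun F => ?_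
  have h4 : Complex.exp (-((∑ s ∈ F, g s ^ 2 : ℝ) : ℂ) / 2)
      = ∏ s ∈ F, Complex.exp (-((g s : ℂ) ^ 2) / 2) := by
    rw [← Complex.exp_sum]
    congr 1
    push_cast
    rw [← Finset.sum_div, Finset.sum_neg_distrib]
  have := Measure.isProbabilityMeasure_map (μ := P) hε.memLp.1.aemeasurable
  rw [hcf, h4]
  refine (norm_prod_sub_prod_le F _ _ (fun s _ => norm_charFun_le_one _) fun s _ => ?_).trans ?_
  · rw [Complex.norm_exp]
    have : (-((g s : ℂ) ^ 2) / 2).re = -(g s ^ 2) / 2 := by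
      norm_cast
    rw [this, Real.exp_le_one_iff]
    nlinarith [sq_nonneg (g s)]
  · rw [Finset.mul_sum]
    exact Finset.sum_le_sum fun s _ => h0 (g s) (hg s)

/-- A central limit theorem for linear forms with uniformly vanishing coefficients. -/
lemma IsInnovationField.tendsto_charFun (hε : IsInnovationField ε P) {ι : Type*} {l : Filter ι}
    {g : ι → (Fin 2 → ℤ) → ℝ} {Y : ι → Ω → ℝ} (hY : ∀ i, IsLinearForm ε P (g i) (Y i))
    {v : ℝ} (hv : Tendsto (fun i => ∑' s, g i s ^ 2) l (𝓝 v))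
    (hg : ∀ δ > 0, ∀ᶠ i in l, ∀ s, |g i s| ≤ δ) :
    Tendsto (fun i => charFun (P.map (Y i)) 1) l (𝓝 (Complex.exp (-(v : ℂ) / 2))) := by
  have h1 : Tendsto (fun i => Complex.exp (-((∑' s, g i s ^ 2 : ℝ) : ℂ) / 2)) l
      (𝓝 (Complex.exp (-(v : ℂ) / 2))) := by
    have : Continuous fun x : ℝ => Complex.exp (-(x : ℂ) / 2) := by fun_prop
    exact (this.tendsto _).comp hv
  have h2 : Tendsto (fun i => charFun (P.map (Y i)) 1 -
      Complex.exp (-((∑' s, g i s ^ 2 : ℝ) : ℂ) / 2)) l (𝓝 0) := by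
    rw [Metric.tendsto_nhds]
    intro r hr
    have hpos : 0 < |v| + 1 := by positivity
    obtain ⟨δ, hδ, h3⟩ := hε.charFun_linearForm (η := r / (2 * (|v| + 1))) (by positivity)
    have h4 : ∀ᶠ i in l, ∑' s, g i s ^ 2 < |v| + 1 :=
      hv.eventually_lt_const (by linarith [le_abs_self v])
    filter_upwards [hg δ hδ, h4] with i hi hi'
    rw [dist_zero_right]
    refine (h3 _ _ (hY i) hi).trans_lt ?_
    calc r / (2 * (|v| + 1)) * ∑' s, g i s ^ 2 ≤ r / (2 * (|v| + 1)) * (|v| + 1) := by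
          gcongr
      _ = r / 2 := by field_simp
      _ < r := by linarith
  simpa using h2.add h1

end LinearForms

/-! ### Lattice sums as integrals of step functions -/

lemma map_ceil_affine (e : ℝ) {d : ℝ} (hd : 0 < d) :
    Measure.map (fun y : ℝ => ⌈e + d * y⌉) volume = ENNReal.ofReal d⁻¹ • Measure.count := by
  refine Measure.ext_of_singleton fun r => ?_
  rw [Measure.map_apply (by fun_prop) (measurableSet_singleton r)]
  have : (fun y : ℝ => ⌈e + d * y⌉) ⁻¹' {r} = Set.Ioc ((r - 1 - e) / d) ((r - e) / d) := by
    ext y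
    simp only [Set.mem_preimage, Set.mem_singleton_iff, Int.ceil_eq_iff, Set.mem_Ioc,
      div_lt_iff₀ hd, le_div_iff₀ hd]
    constructor <;> rintro ⟨h1, h2⟩ <;> constructor <;> linarith
  rw [this, Real.volume_Ioc]
  simp only [Measure.smul_apply, Measure.count_singleton, smul_eq_mul, mul_one]
  congr 1
  field_simp
  ring

/-- The map `(w, z) ↦ (⌈c w⌉, ⌈e w + d z⌉)` sends Lebesgue measure to a multiple of the counting
measure on the lattice. -/
lemma map_ceil_prod (e : ℝ) {c d : ℝ} (hc : 0 < c) (hd : 0 < d) :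
    Measure.map (fun p : ℝ × ℝ => (⌈c * p.1⌉, ⌈e * p.1 + d * p.2⌉)) volume
      = ENNReal.ofReal (c * d)⁻¹ • Measure.count := by
  refine Measure.ext_of_singleton fun r => ?_
  have hm : Measurable fun p : ℝ × ℝ => (⌈c * p.1⌉, ⌈e * p.1 + d * p.2⌉) := by fun_prop
  rw [Measure.map_apply hm (measurableSet_singleton r), Measure.volume_eq_prod,
    Measure.prod_apply (hm (measurableSet_singleton r))]
  have h1 : ∀ w : ℝ, volume (Prod.mk w ⁻¹'
      ((fun p : ℝ × ℝ => (⌈c * p.1⌉, ⌈e * p.1 + d * p.2⌉)) ⁻¹' {r}))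
      = ((fun w : ℝ => ⌈0 + c * w⌉) ⁻¹' {r.1}).indicator (fun _ => ENNReal.ofReal d⁻¹) w := by
    intro w
    by_cases hw : ⌈c * w⌉ = r.1
    · rw [Set.indicator_of_mem (by simpa using hw)]
      have : Prod.mk w ⁻¹' ((fun p : ℝ × ℝ => (⌈c * p.1⌉, ⌈e * p.1 + d * p.2⌉)) ⁻¹' {r})
          = (fun y : ℝ => ⌈e * w + d * y⌉) ⁻¹' {r.2} := by
        ext y
        simp [Prod.ext_iff, hw]
      rw [this, ← Measure.map_apply (by fun_prop) (measurableSet_singleton _),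
        map_ceil_affine _ hd]
      simp
    · rw [Set.indicator_of_notMem (by simpa using hw)]
      have : Prod.mk w ⁻¹' ((fun p : ℝ × ℝ => (⌈c * p.1⌉, ⌈e * p.1 + d * p.2⌉)) ⁻¹' {r})
          = ∅ := by
        ext y
        simp [Prod.ext_iff, hw]
      rw [this, measure_empty]
  simp_rw [h1]
  have hm' : Measurable fun w : ℝ => ⌈0 + c * w⌉ := by fun_prop
  rw [lintegral_indicator (hm' (measurableSet_singleton _)), setLIntegral_const,
    ← Measure.map_apply hm' (measurableSet_singleton _), map_ceil_affine _ hc]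
  simp only [Measure.smul_apply, Measure.count_singleton, smul_eq_mul, mul_one]
  rw [← ENNReal.ofReal_mul (by positivity), mul_inv, mul_comm]

lemma lintegral_comp_ceil_prod (e : ℝ) {c d : ℝ} (hc : 0 < c) (hd : 0 < d)
    (F : ℤ × ℤ → ENNReal) :
    ∫⁻ p : ℝ × ℝ, F (⌈c * p.1⌉, ⌈e * p.1 + d * p.2⌉) = ENNReal.ofReal (c * d)⁻¹ * ∑' r, F r := by
  have hm : Measurable fun p : ℝ × ℝ => (⌈c * p.1⌉, ⌈e * p.1 + d * p.2⌉) := by fun_prop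
  rw [← lintegral_map (f := F) (by fun_prop) hm, map_ceil_prod e hc hd, lintegral_smul_measure,
    lintegral_count, smul_eq_mul]

lemma integral_comp_of_map_eq_smul_count {α γ : Type*} [MeasurableSpace α] [MeasurableSpace γ]
    [Countable γ] [MeasurableSingletonClass γ] {μ : Measure α} {T : α → γ} (hT : Measurable T)
    {c : ℝ} (hc : 0 ≤ c) (h : μ.map T = ENNReal.ofReal c • Measure.count)
    (F : γ → ℝ) (A : Finset γ) (hA : ∀ r, r ∉ A → F r = 0) :
    ∫ a, F (T a) ∂μ = c * ∑ r ∈ A, F r := by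
  have hF : Summable F := summable_of_ne_finset_zero (s := A) hA
  have h1 : ∫ r, F r ∂(μ.map T) = ∫ a, F (T a) ∂μ :=
    integral_map hT.aemeasurable (Measurable.of_discrete).aestronglyMeasurable
  have h2 : ∫ r, F r ∂Measure.count = ∑' r, F r := by
    rw [integral_countable (integrable_count_iff.2 hF.norm)]
    simp [measureReal_def]
  rw [← h1, h, integral_smul_measure, ENNReal.toReal_ofReal hc, smul_eq_mul, h2,
    tsum_eq_sum (s := A) fun r hr => hA r hr]

lemma integral_comp_ceil_prod (e : ℝ) {c d : ℝ} (hc : 0 < c) (hd : 0 < d)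
    (F : ℤ × ℤ → ℝ) (A : Finset (ℤ × ℤ)) (hA : ∀ r, r ∉ A → F r = 0) :
    ∫ p : ℝ × ℝ, F (⌈c * p.1⌉, ⌈e * p.1 + d * p.2⌉) = (c * d)⁻¹ * ∑ r ∈ A, F r :=
  integral_comp_of_map_eq_smul_count (by fun_prop) (by positivity) (map_ceil_prod e hc hd) F A hA

lemma integral_comp_ceil (e : ℝ) {d : ℝ} (hd : 0 < d) (F : ℤ → ℝ) (A : Finset ℤ)
    (hA : ∀ r, r ∉ A → F r = 0) :
    ∫ y : ℝ, F ⌈e + d * y⌉ = d⁻¹ * ∑ r ∈ A, F r :=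
  integral_comp_of_map_eq_smul_count (by fun_prop) (by positivity) (map_ceil_affine e hd) F A hA

/-- The sum of `β(t - s)` over lattice points `t` of the rectangle `(0, M₁] × (0, M₂]`. -/
noncomputable def boxSum (β : ℤ → ℤ → ℝ) (M₁ M₂ : ℝ) (s₁ s₂ : ℤ) : ℝ :=
  ∑ t₁ ∈ Finset.Ioc (0 : ℤ) ⌊M₁⌋, ∑ t₂ ∈ Finset.Ioc (0 : ℤ) ⌊M₂⌋, β (t₁ - s₁) (t₂ - s₂)

lemma eLpNorm_two_sq {α : Type*} [MeasurableSpace α] (μ : Measure α) (f : α → ℝ) :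
    eLpNorm f 2 μ ^ 2 = ∫⁻ a, ‖f a‖ₑ ^ 2 ∂μ := by
  rw [eLpNorm_eq_lintegral_rpow_enorm_toReal (by norm_num) (by norm_num), ← ENNReal.rpow_natCast,
    ← ENNReal.rpow_mul]
  simp

lemma tendsto_eLpNorm_two_iff {α ι : Type*} [MeasurableSpace α] {μ : Measure α} {l : Filter ι}
    {f : ι → α → ℝ} :
    Tendsto (fun i => eLpNorm (f i) 2 μ) l (𝓝 0)
      ↔ Tendsto (fun i => ∫⁻ a, ‖f i a‖ₑ ^ 2 ∂μ) l (𝓝 0) := by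
  simp_rw [← eLpNorm_two_sq]
  constructor
  · intro h
    simpa using ENNReal.Tendsto.pow (n := 2) h
  · intro h
    have := (ENNReal.continuous_rpow_const (y := (1 / 2 : ℝ))).tendsto 0 |>.comp h
    simp only [ENNReal.zero_rpow_of_pos (by norm_num : (0 : ℝ) < 1 / 2)] at this
    refine this.congr fun i => ?_
    simp only [Function.comp_apply]
    rw [← ENNReal.rpow_natCast, ← ENNReal.rpow_mul]
    simp

/-- The step function on the plane, constant on cells of size `n₁⁻¹ × n₂⁻¹`, whose `L²` norm is
the `ℓ²` norm of `g`. -/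
noncomputable def stepFun (n₁ n₂ : ℝ) (g : ℤ → ℤ → ℝ) (u : ℝ × ℝ) : ℝ :=
  √(n₁ * n₂) * g ⌈n₁ * u.1⌉ ⌈n₂ * u.2⌉

lemma measurable_stepFun (n₁ n₂ : ℝ) (g : ℤ → ℤ → ℝ) : Measurable (stepFun n₁ n₂ g) := by
  have h1 : Measurable fun u : ℝ × ℝ => (⌈n₁ * u.1⌉, ⌈n₂ * u.2⌉) := by fun_prop
  have h2 : Measurable fun r : ℤ × ℤ => g r.1 r.2 := by fun_prop
  exact (h2.comp h1).const_mul _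

lemma lintegral_stepFun {n₁ n₂ : ℝ} (h₁ : 0 < n₁) (h₂ : 0 < n₂) (g : ℤ → ℤ → ℝ) :
    ∫⁻ u, ‖stepFun n₁ n₂ g u‖ₑ ^ 2 = ∑' r : ℤ × ℤ, ‖g r.1 r.2‖ₑ ^ 2 := by
  have h3 := lintegral_comp_ceil_prod 0 h₁ h₂ fun r => ‖√(n₁ * n₂)‖ₑ ^ 2 * ‖g r.1 r.2‖ₑ ^ 2
  simp only [zero_mul, zero_add] at h3
  simp only [stepFun, enorm_mul, mul_pow]
  rw [h3, ENNReal.tsum_mul_left, ← mul_assoc]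
  have : ENNReal.ofReal (n₁ * n₂)⁻¹ * ‖√(n₁ * n₂)‖ₑ ^ 2 = 1 := by
    rw [← enorm_pow, Real.sq_sqrt (by positivity), Real.enorm_of_nonneg (by positivity),
      ← ENNReal.ofReal_mul (by positivity), inv_mul_cancel₀ (by positivity), ENNReal.ofReal_one]
  rw [this, one_mul]

lemma enorm_le_of_stepFun {n₁ n₂ : ℝ} (h₁ : 0 < n₁) (h₂ : 0 < n₂) (g : ℤ → ℤ → ℝ) (r : ℤ × ℤ) :
    ∃ A : Set (ℝ × ℝ), MeasurableSet A ∧ volume A = ENNReal.ofReal (n₁ * n₂)⁻¹ ∧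
      eLpNorm (stepFun n₁ n₂ g) 2 (volume.restrict A) = ‖g r.1 r.2‖ₑ := by
  have hm : Measurable fun p : ℝ × ℝ => (⌈n₁ * p.1⌉, ⌈0 * p.1 + n₂ * p.2⌉) := by fun_prop
  have hv : volume ((fun p : ℝ × ℝ => (⌈n₁ * p.1⌉, ⌈0 * p.1 + n₂ * p.2⌉)) ⁻¹' {r})
      = ENNReal.ofReal (n₁ * n₂)⁻¹ := by
    rw [← Measure.map_apply hm (measurableSet_singleton _), map_ceil_prod 0 h₁ h₂]
    simp
  refine ⟨_, hm (measurableSet_singleton r), hv, ?_⟩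
  have h3 : eLpNorm (stepFun n₁ n₂ g) 2 (volume.restrict
      ((fun p : ℝ × ℝ => (⌈n₁ * p.1⌉, ⌈0 * p.1 + n₂ * p.2⌉)) ⁻¹' {r})) ^ 2
      = ‖g r.1 r.2‖ₑ ^ 2 := by
    rw [eLpNorm_two_sq, setLIntegral_congr_fun (g := fun _ => ‖√(n₁ * n₂) * g r.1 r.2‖ₑ ^ 2)
      (hm (measurableSet_singleton r)), setLIntegral_const, hv, enorm_mul, mul_pow, mul_comm,
      ← mul_assoc]
    · have : ENNReal.ofReal (n₁ * n₂)⁻¹ * ‖√(n₁ * n₂)‖ₑ ^ 2 = 1 := by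
        rw [← enorm_pow, Real.sq_sqrt (by positivity), Real.enorm_of_nonneg (by positivity),
          ← ENNReal.ofReal_mul (by positivity), inv_mul_cancel₀ (by positivity),
          ENNReal.ofReal_one]
      rw [this, one_mul]
    · intro p hp
      simp only [Set.mem_preimage, Set.mem_singleton_iff, Prod.ext_iff, zero_mul, zero_add] at hp
      simp only [stepFun, hp.1, hp.2]
  exact (ENNReal.pow_right_strictMono two_ne_zero).injective h3

lemma tendsto_eLpNorm_of_tendsto_sub {α ι : Type*} [MeasurableSpace α] {μ : Measure α}
    {l : Filter ι} {f : ι → α → ℝ} {h : α → ℝ} (hf : ∀ i, AEStronglyMeasurable (f i) μ)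
    (hh : MemLp h 2 μ) (hc : Tendsto (fun i => eLpNorm (fun a => f i a - h a) 2 μ) l (𝓝 0)) :
    Tendsto (fun i => eLpNorm (f i) 2 μ) l (𝓝 (eLpNorm h 2 μ)) := by
  have h1 : Tendsto (fun i => eLpNorm h 2 μ - eLpNorm (fun a => f i a - h a) 2 μ) l
      (𝓝 (eLpNorm h 2 μ)) := by
    simpa using ENNReal.Tendsto.sub tendsto_const_nhds hc (Or.inl hh.2.ne)
  have h2 : Tendsto (fun i => eLpNorm (fun a => f i a - h a) 2 μ + eLpNorm h 2 μ) l
      (𝓝 (eLpNorm h 2 μ)) := by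
    simpa using hc.add (tendsto_const_nhds (x := eLpNorm h 2 μ))
  refine tendsto_of_tendsto_of_tendsto_of_le_of_le h1 h2 (fun i => ?_) fun i => ?_
  · rw [tsub_le_iff_left]
    have : h = (fun a => -(f i a - h a)) + f i := by ext a; simp
    calc eLpNorm h 2 μ = eLpNorm ((fun a => -(f i a - h a)) + f i) 2 μ := by rw [← this]
      _ ≤ _ := eLpNorm_add_le ((hf i).sub hh.1).neg (hf i) (by norm_num)
      _ = _ := by
        congr 1
        exact eLpNorm_neg (fun a => f i a - h a) 2 μ
  · have : f i = (fun a => f i a - h a) + h := by ext a; simp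
    calc eLpNorm (f i) 2 μ = eLpNorm ((fun a => f i a - h a) + h) 2 μ := by rw [← this]
      _ ≤ _ := eLpNorm_add_le ((hf i).sub hh.1) hh.1 (by norm_num)

/-- If the step functions of `g i` converge in `L²` and the cells shrink, then the `ℓ²` norms
converge and the coefficients vanish uniformly. -/
lemma tendsto_tsum_sq_of_stepFun {ι : Type*} {l : Filter ι} {n₁ n₂ : ι → ℝ}
    (h₁ : ∀ i, 0 < n₁ i) (h₂ : ∀ i, 0 < n₂ i) (hn : Tendsto (fun i => n₁ i * n₂ i) l atTop)
    {g : ι → ℤ → ℤ → ℝ} {h : ℝ × ℝ → ℝ} (hh : MemLp h 2 volume)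
    (hc : Tendsto (fun i => eLpNorm (fun u => stepFun (n₁ i) (n₂ i) (g i) u - h u) 2 volume) l
      (𝓝 0)) :
    Tendsto (fun i => ∑' r : ℤ × ℤ, g i r.1 r.2 ^ 2) l (𝓝 (∫ u, h u ^ 2)) ∧
      ∀ δ > 0, ∀ᶠ i in l, ∀ r : ℤ × ℤ, |g i r.1 r.2| ≤ δ := by
  have hm : ∀ i, AEStronglyMeasurable (stepFun (n₁ i) (n₂ i) (g i)) volume :=
    fun i => (measurable_stepFun _ _ _).aestronglyMeasurable
  constructor
  · have h3 := ENNReal.Tendsto.pow (n := 2) (tendsto_eLpNorm_of_tendsto_sub hm hh hc)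
    simp_rw [eLpNorm_two_sq, lintegral_stepFun (h₁ _) (h₂ _)] at h3
    have h4 : ∫⁻ u, ‖h u‖ₑ ^ 2 ≠ ⊤ := by
      rw [← eLpNorm_two_sq]
      exact ENNReal.pow_ne_top hh.2.ne
    have h5 := (ENNReal.tendsto_toReal h4).comp h3
    have h6 : (∫⁻ u, ‖h u‖ₑ ^ 2).toReal = ∫ u, h u ^ 2 := by
      rw [integral_eq_lintegral_of_nonneg_ae (Eventually.of_forall fun u => sq_nonneg _)
        (hh.1.pow 2)]
      congr 2
      ext u
      rw [← enorm_pow, Real.enorm_of_nonneg (sq_nonneg _)]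
    rw [h6] at h5
    refine h5.congr fun i => ?_
    simp only [Function.comp_apply]
    rw [ENNReal.tsum_toReal_eq fun r => by finiteness]
    refine tsum_congr fun r => ?_
    rw [← enorm_pow, Real.enorm_of_nonneg (sq_nonneg _), ENNReal.toReal_ofReal (sq_nonneg _)]
  · intro δ hδ
    have h4 : ∫⁻ u, ‖h u‖ₑ ^ 2 ≠ ⊤ := by
      rw [← eLpNorm_two_sq]
      exact ENNReal.pow_ne_top hh.2.ne
    have hδ' : (ENNReal.ofReal (δ / 2)) ≠ 0 := by simpa using hδ
    obtain ⟨τ, hτ, h5⟩ := exists_pos_setLIntegral_lt_of_measure_lt h4 (pow_ne_zero 2 hδ')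
    have h6 : Tendsto (fun i => ENNReal.ofReal (n₁ i * n₂ i)⁻¹) l (𝓝 0) := by
      simpa using (ENNReal.tendsto_ofReal (tendsto_inv_atTop_zero.comp hn))
    filter_upwards [h6.eventually_lt_const hτ, hc.eventually_lt_const (pos_iff_ne_zero.2 hδ')]
      with i hi hi' r
    obtain ⟨A, -, hA, hA'⟩ := enorm_le_of_stepFun (h₁ i) (h₂ i) (g i) r
    have h7 := h5 A (hA ▸ hi)
    rw [← eLpNorm_two_sq] at h7
    have h8 := (ENNReal.pow_right_strictMono two_ne_zero).lt_iff_lt.1 h7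
    have h9 : ‖g i r.1 r.2‖ₑ ≤ ENNReal.ofReal δ := by
      rw [← hA']
      have : stepFun (n₁ i) (n₂ i) (g i)
          = (fun a => stepFun (n₁ i) (n₂ i) (g i) a - h a) + h := by ext a; simp
      calc _ = eLpNorm ((fun a => stepFun (n₁ i) (n₂ i) (g i) a - h a) + h) 2
              (volume.restrict A) := by rw [← this]
        _ ≤ _ := eLpNorm_add_le ((hm i).sub hh.1).restrict hh.1.restrict (by norm_num)
        _ ≤ ENNReal.ofReal (δ / 2) + ENNReal.ofReal (δ / 2) :=
            add_le_add ((eLpNorm_mono_measure _ Measure.restrict_le_self).trans hi'.le) h8.le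
        _ = ENNReal.ofReal δ := by
            rw [← ENNReal.ofReal_add (by positivity) (by positivity), add_halves]
    rw [← ofReal_norm, ENNReal.ofReal_le_ofReal_iff hδ.le] at h9
    simpa using h9

/-! ### From convergence of kernels to scaling limits -/

section Criterion

variable {Ω Ω' : Type*} [MeasurableSpace Ω] [MeasurableSpace Ω'] {P : Measure Ω}
  {P' : Measure Ω'} {ε : (Fin 2 → ℤ) → Ω → ℝ} {b : (Fin 2 → ℤ) → ℝ}
  {X : (Fin 2 → ℤ) → Ω → ℝ} {W : Lp ℝ 2 (volume : Measure (Fin 2 → ℝ)) → Ω' → ℝ}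

lemma isLinearForm_partialSum (hε : IsInnovationField ε P) (hX : IsLinearField b ε X P)
    (γ l : ℝ) (x : Quadrant) :
    IsLinearForm ε P
      (fun s => boxSum (fun r₁ r₂ => b ![r₁, r₂]) (l * x.1 0) (l ^ γ * x.1 1) (s 0) (s 1))
      (partialSum X γ l x) := by
  have h := IsLinearForm.sum hε
    (Fintype.piFinset ![Finset.Ioc (0 : ℤ) ⌊l * x.1 0⌋, Finset.Ioc (0 : ℤ) ⌊l ^ γ * x.1 1⌋])
    (g := fun t s => b (t - s)) (Y := X) fun t _ => hX.isLinearForm t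
  convert h using 1
  · ext s
    rw [boxSum, ← Finset.sum_product']
    refine Finset.sum_bij' (fun t _ => ![t.1, t.2]) (fun t _ => (t 0, t 1)) ?_ ?_ ?_ ?_ ?_
    · rintro ⟨t₁, t₂⟩ ht
      simpa [Fintype.mem_piFinset, Fin.forall_fin_two] using ht
    · intro t ht
      simpa [Fintype.mem_piFinset, Fin.forall_fin_two] using ht
    · rintro ⟨t₁, t₂⟩ _
      rfl
    · intro t _
      ext i
      fin_cases i <;> rfl
    · rintro ⟨t₁, t₂⟩ _
      congr 1
      ext i
      fin_cases i <;> rfl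
  · rfl

omit [MeasurableSpace Ω'] in
lemma stochIntegral_of_memLp {h : (Fin 2 → ℝ) → ℝ} (hh : MemLp h 2 volume) :
    stochIntegral W h = W (hh.toLp h) := dif_pos hh

lemma isGaussianProcess_stochIntegral (hW : IsWhiteNoise W P') {T : Type*}
    {k : T → (Fin 2 → ℝ) → ℝ} (hk : ∀ x, MemLp (k x) 2 volume) :
    IsGaussianProcess (fun x => stochIntegral W (k x)) P' := by
  have := hW.gaussian.comp_right fun x => (hk x).toLp (k x)
  have e : (fun x => stochIntegral W (k x)) = W ∘ fun x => (hk x).toLp (k x) := by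
    ext1 x
    exact stochIntegral_of_memLp (hk x)
  rwa [e]

lemma integral_stochIntegral (hW : IsWhiteNoise W P') {k : (Fin 2 → ℝ) → ℝ}
    (hk : MemLp k 2 volume) : ∫ ω, stochIntegral W k ω ∂P' = 0 := by
  rw [stochIntegral_of_memLp hk, hW.mean_zero]

/-- The Itô isometry. -/
lemma integral_stochIntegral_mul (hW : IsWhiteNoise W P') {k k' : (Fin 2 → ℝ) → ℝ}
    (hk : MemLp k 2 volume) (hk' : MemLp k' 2 volume) :
    ∫ ω, stochIntegral W k ω * stochIntegral W k' ω ∂P' = ∫ u, k u * k' u := by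
  rw [stochIntegral_of_memLp hk, stochIntegral_of_memLp hk', hW.covariance, L2.inner_def]
  refine integral_congr_ae ?_
  filter_upwards [hk.coeFn_toLp, hk'.coeFn_toLp] with u h h'
  rw [h, h']
  simp [mul_comm]

lemma integral_sq_sum {α : Type*} [MeasurableSpace α] {μ : Measure α} {n : ℕ}
    {f : Fin n → α → ℝ} (hf : ∀ i, MemLp (f i) 2 μ) (θ : Fin n → ℝ) :
    ∫ a, (∑ i, θ i * f i a) ^ 2 ∂μ = ∑ i, ∑ j, θ i * θ j * ∫ a, f i a * f j a ∂μ := by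
  have h1 : ∀ a, (∑ i, θ i * f i a) ^ 2 = ∑ i, ∑ j, θ i * θ j * (f i a * f j a) := by
    intro a
    rw [sq, Finset.sum_mul_sum]
    exact Finset.sum_congr rfl fun i _ => Finset.sum_congr rfl fun j _ => by ring
  have h2 : ∀ i j, Integrable (fun a => θ i * θ j * (f i a * f j a)) μ :=
    fun i j => ((hf i).integrable_mul (hf j)).const_mul _
  simp_rw [h1]
  rw [integral_finsetSum _ fun i _ => integrable_finsetSum _ fun j _ => h2 i j]
  refine Finset.sum_congr rfl fun i _ => ?_
  rw [integral_finsetSum _ fun j _ => h2 i j]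
  exact Finset.sum_congr rfl fun j _ => integral_const_mul _ _

lemma charFun_stochIntegral [IsProbabilityMeasure P'] (hW : IsWhiteNoise W P') {n : ℕ}
    {k : Fin n → (Fin 2 → ℝ) → ℝ}
    (hk : ∀ i, MemLp (k i) 2 volume) (θ : EuclideanSpace ℝ (Fin n)) :
    charFun (P'.map fun ω => WithLp.toLp 2 fun i => stochIntegral W (k i) ω) θ
      = Complex.exp (-((∑ i, ∑ j, θ i * θ j * ∫ u, k i u * k j u : ℝ) : ℂ) / 2) := by
  have hG := isGaussianProcess_stochIntegral hW hk
  have hL : ∀ i, MemLp (stochIntegral W (k i)) 2 P' := fun i =>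
    (hG.hasGaussianLaw_eval i).memLp_two
  have h1 : HasGaussianLaw (fun ω => fun i => stochIntegral W (k i) ω) P' := by
    let e : (↥(Finset.univ : Finset (Fin n)) → ℝ) →L[ℝ] (Fin n → ℝ) :=
      ContinuousLinearMap.pi fun i => ContinuousLinearMap.proj ⟨i, Finset.mem_univ i⟩
    exact (hG.hasGaussianLaw Finset.univ).map e
  have h2 := (h1.toLp_pi 2).charFun_map_eq θ
  rw [h2]
  have h3 : ∀ ω, inner ℝ θ (WithLp.toLp 2 fun i => stochIntegral W (k i) ω)
      = ∑ i, θ i * stochIntegral W (k i) ω := by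
    intro ω
    rw [PiLp.inner_apply]
    exact Finset.sum_congr rfl fun i _ => by simp [mul_comm]
  simp_rw [h3]
  have h4 : ∫ ω, ∑ i, θ i * stochIntegral W (k i) ω ∂P' = 0 := by
    rw [integral_finsetSum _ fun i _ => ((hL i).integrable (by norm_num)).const_mul _]
    refine Finset.sum_eq_zero fun i _ => ?_
    rw [integral_const_mul, integral_stochIntegral hW (hk i), mul_zero]
  rw [h4, variance_eq_integral (memLp_finsetSum _ fun i _ => (hL i).const_mul _).1.aemeasurable,
    h4]
  simp only [sub_zero]
  rw [integral_sq_sum hL]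
  simp only [integral_stochIntegral_mul hW (hk _) (hk _)]
  congr 1
  push_cast
  ring

variable [IsProbabilityMeasure P] [IsProbabilityMeasure P']

/-- Convergence of the normalized coefficients of the partial sums, viewed as step functions on the
plane, implies convergence of the finite-dimensional distributions. Since the limit is Gaussian,
only the inner products of the limits `h x` matter, so that they may be replaced by kernels `k x`
with the same inner products. -/
theorem hasScalingLimit_of_tendsto (hε : IsInnovationField ε P) (hX : IsLinearField b ε X P)
    (hW : IsWhiteNoise W P') {γ H : ℝ} {n₁ n₂ : ℝ → ℝ} (h₁ : ∀ᶠ l in atTop, 0 < n₁ l)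
    (h₂ : ∀ᶠ l in atTop, 0 < n₂ l) (hn : Tendsto (fun l => n₁ l * n₂ l) atTop atTop)
    {k : Quadrant → (Fin 2 → ℝ) → ℝ} (hk : ∀ x, MemLp (k x) 2 volume)
    {h : Quadrant → ℝ × ℝ → ℝ} (hh : ∀ x, MemLp (h x) 2 volume)
    (hgram : ∀ x y, ∫ u, k x u * k y u = ∫ u, h x u * h y u)
    (hconv : ∀ x : Quadrant, Tendsto (fun l => ∫⁻ u : ℝ × ℝ, ‖stepFun (n₁ l) (n₂ l)
      (fun s₁ s₂ => (l ^ H)⁻¹ *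
        boxSum (fun r₁ r₂ => b ![r₁, r₂]) (l * x.1 0) (l ^ γ * x.1 1) s₁ s₂) u - h x u‖ₑ ^ 2)
      atTop (𝓝 0)) :
    HasScalingLimit X P γ H (fun x => stochIntegral W (k x)) P' := by
  intro n x
  have hS : ∀ l i, IsLinearForm ε P
      (fun s => (l ^ H)⁻¹ * boxSum (fun r₁ r₂ => b ![r₁, r₂]) (l * (x i).1 0)
        (l ^ γ * (x i).1 1) (s 0) (s 1))
      (fun ω => (l ^ H)⁻¹ * partialSum X γ l (x i) ω) :=
    fun l i => (isLinearForm_partialSum hε hX γ l (x i)).const_mul _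
  have hSm : ∀ l, AEMeasurable (fun ω i => (l ^ H)⁻¹ * partialSum X γ l (x i) ω) P :=
    fun l => aemeasurable_pi_lambda _ fun i => (hS l i).1.1.aemeasurable
  have hZm : AEMeasurable (fun ω i => stochIntegral W (k (x i)) ω) P' :=
    aemeasurable_pi_lambda _ fun i =>
      (isGaussianProcess_stochIntegral hW hk).aemeasurable (x i)
  have hto : Measurable (WithLp.toLp 2 : (Fin n → ℝ) → EuclideanSpace ℝ (Fin n)) := by fun_prop
  have key : TendstoInDistribution
      (fun (l : ℝ) ω => (WithLp.toLp 2 fun i => (l ^ H)⁻¹ * partialSum X γ l (x i) ω :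
        EuclideanSpace ℝ (Fin n))) atTop
      (fun ω => WithLp.toLp 2 fun i => stochIntegral W (k (x i)) ω) (fun _ => P) P' := by
    refine ⟨fun l => hto.comp_aemeasurable (hSm l), hto.comp_aemeasurable hZm, ?_⟩
    refine tendsto_of_seq_tendsto fun l hl => ?_
    refine ProbabilityMeasure.tendsto_iff_tendsto_charFun.2 fun θ => ?_
    change Tendsto (fun m => charFun (P.map fun ω => (WithLp.toLp 2 fun i =>
      (l m ^ H)⁻¹ * partialSum X γ (l m) (x i) ω : EuclideanSpace ℝ (Fin n))) θ) atTop
      (𝓝 (charFun (P'.map fun ω => (WithLp.toLp 2 fun i => stochIntegral W (k (x i)) ω :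
        EuclideanSpace ℝ (Fin n))) θ))
    rw [charFun_stochIntegral hW fun i => hk (x i)]
    simp only [hgram]
    rw [← integral_sq_sum fun i => hh (x i)]
    -- the linear combination of the coefficients with weights `θ`
    set g : ℝ → ℤ → ℤ → ℝ := fun l s₁ s₂ => ∑ i, θ i * ((l ^ H)⁻¹ *
      boxSum (fun r₁ r₂ => b ![r₁, r₂]) (l * (x i).1 0) (l ^ γ * (x i).1 1) s₁ s₂) with hg
    have hY : ∀ l, IsLinearForm ε P (fun s => g l (s 0) (s 1))
        (fun ω => ∑ i, θ i * ((l ^ H)⁻¹ * partialSum X γ l (x i) ω)) :=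
      fun l => IsLinearForm.sum hε _ fun i _ => (hS l i).const_mul (θ i)
    have hcf : ∀ l, charFun (P.map fun ω => (WithLp.toLp 2 fun i =>
        (l ^ H)⁻¹ * partialSum X γ l (x i) ω : EuclideanSpace ℝ (Fin n))) θ
        = charFun (P.map fun ω => ∑ i, θ i * ((l ^ H)⁻¹ * partialSum X γ l (x i) ω)) 1 := by
      intro l
      have hSl : AEMeasurable (fun ω => (WithLp.toLp 2 fun i =>
        (l ^ H)⁻¹ * partialSum X γ l (x i) ω : EuclideanSpace ℝ (Fin n))) P :=
        hto.comp_aemeasurable (hSm l)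
      rw [charFun_apply_real, charFun_apply, integral_map hSl (by fun_prop),
        integral_map (hY l).1.1.aemeasurable (by fun_prop)]
      refine integral_congr_ae (Eventually.of_forall fun ω => ?_)
      simp only [PiLp.inner_apply]
      congr 1
      push_cast
      simp
    simp only [hcf]
    suffices hmain : Tendsto (fun l => charFun (P.map fun ω =>
        ∑ i, θ i * ((l ^ H)⁻¹ * partialSum X γ l (x i) ω)) 1) atTop
        (𝓝 (Complex.exp (-((∫ u, (∑ i, θ i * h (x i) u) ^ 2 : ℝ) : ℂ) / 2))) from hmain.comp hl
    have hhθ : MemLp (fun u => ∑ i, θ i * h (x i) u) 2 volume :=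
      memLp_finsetSum _ fun i _ => (hh (x i)).const_mul _
    have hcθ : Tendsto (fun l => eLpNorm (fun u => stepFun (n₁ l) (n₂ l) (g l) u -
        ∑ i, θ i * h (x i) u) 2 volume) atTop (𝓝 0) := by
      have h5 : Tendsto (fun l => ∑ i, ‖θ i‖ₑ * eLpNorm (fun u => stepFun (n₁ l) (n₂ l)
          (fun s₁ s₂ => (l ^ H)⁻¹ * boxSum (fun r₁ r₂ => b ![r₁, r₂]) (l * (x i).1 0)
            (l ^ γ * (x i).1 1) s₁ s₂) u - h (x i) u) 2 volume) atTop (𝓝 0) := by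
        have : Tendsto (fun l => ∑ i, ‖θ i‖ₑ * eLpNorm (fun u => stepFun (n₁ l) (n₂ l)
          (fun s₁ s₂ => (l ^ H)⁻¹ * boxSum (fun r₁ r₂ => b ![r₁, r₂]) (l * (x i).1 0)
            (l ^ γ * (x i).1 1) s₁ s₂) u - h (x i) u) 2 volume) atTop
            (𝓝 (∑ i, ‖θ i‖ₑ * 0)) :=
          tendsto_finsetSum _ fun i _ => ENNReal.Tendsto.const_mul
            (tendsto_eLpNorm_two_iff.2 (hconv (x i))) (Or.inr (by simp))
        simpa using this
      refine tendsto_of_tendsto_of_tendsto_of_le_of_le tendsto_const_nhds h5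
        (fun _ => zero_le) fun l => ?_
      have h6 : (fun u => stepFun (n₁ l) (n₂ l) (g l) u - ∑ i, θ i * h (x i) u)
          = ∑ i, θ i • fun u => stepFun (n₁ l) (n₂ l)
          (fun s₁ s₂ => (l ^ H)⁻¹ * boxSum (fun r₁ r₂ => b ![r₁, r₂]) (l * (x i).1 0)
            (l ^ γ * (x i).1 1) s₁ s₂) u - h (x i) u := by
        ext u
        simp only [stepFun, hg, Finset.sum_apply, Pi.smul_apply, smul_eq_mul, mul_sub,
          Finset.sum_sub_distrib, Finset.mul_sum]
        congr 1
        exact Finset.sum_congr rfl fun i _ => by ring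
      simp only [h6]
      refine (eLpNorm_sum_le (fun i _ => ?_) (by norm_num)).trans
        (Finset.sum_le_sum fun i _ => (eLpNorm_const_smul _ _ _ _).le)
      exact ((measurable_stepFun _ _ _).aestronglyMeasurable.sub (hh (x i)).1).const_smul _
    -- cells of nonpositive size are replaced by unit cells for the finitely many small `l`
    obtain ⟨l₀, hl₀⟩ := (h₁.and h₂).exists_forall_of_atTop
    set φ : ℝ → ℝ := fun l => max l l₀
    have hφ : Tendsto φ atTop atTop := tendsto_atTop_mono (fun l => le_max_left _ _) tendsto_id
    have hφe : ∀ᶠ l in atTop, φ l = l :=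
      (eventually_ge_atTop l₀).mono fun l hl => max_eq_left hl
    have h7 := tendsto_tsum_sq_of_stepFun (l := atTop) (n₁ := fun l => n₁ (φ l))
      (n₂ := fun l => n₂ (φ l)) (fun l => (hl₀ _ (le_max_right _ _)).1)
      (fun l => (hl₀ _ (le_max_right _ _)).2) (hn.comp hφ) (g := fun l => g (φ l)) hhθ
      (hcθ.comp hφ)
    have h8 : ∀ l, ∑' s : Fin 2 → ℤ, g (φ l) (s 0) (s 1) ^ 2
        = ∑' r : ℤ × ℤ, g (φ l) r.1 r.2 ^ 2 := fun l =>
      (finTwoArrowEquiv ℤ).tsum_eq (fun r : ℤ × ℤ => g (φ l) r.1 r.2 ^ 2)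
    have h9 := hε.tendsto_charFun (l := atTop) (fun l => hY (φ l)) (v := _)
      (by simpa only [h8] using h7.1)
      (fun δ hδ => (h7.2 δ hδ).mono fun l hl s => hl (s 0, s 1))
    exact h9.congr' (hφe.mono fun l hl => by simp only [hl])
  exact key.continuous_comp (g := fun v : EuclideanSpace ℝ (Fin n) => v.ofLp) (by fun_prop)

/-! ### Fractional Brownian sheets -/

omit [IsProbabilityMeasure P'] in
lemma isFractionalBrownianSheet_of_kernel (hW : IsWhiteNoise W P')
    {k : Quadrant → (Fin 2 → ℝ) → ℝ} (hk : ∀ x, MemLp (k x) 2 volume) {c h₁ h₂ : ℝ}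
    (hh₁ : h₁ ≠ 0) (hh₂ : h₂ ≠ 0)
    (hcov : ∀ x y : Quadrant, ∫ u, k x u * k y u = c * ((1 / 4) *
      ((x.1 0 ^ (2 * h₁) + y.1 0 ^ (2 * h₁) - |x.1 0 - y.1 0| ^ (2 * h₁)) *
       (x.1 1 ^ (2 * h₂) + y.1 1 ^ (2 * h₂) - |x.1 1 - y.1 1| ^ (2 * h₂))))) :
    IsFractionalBrownianSheet (sigmaOne (fun x => stochIntegral W (k x)) P') h₁ h₂
      (fun x => stochIntegral W (k x)) P' := by
  have hσ : sigmaOne (fun x => stochIntegral W (k x)) P' ^ 2 = c := by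
    rw [sigmaOne, Real.sq_sqrt (integral_nonneg fun ω => sq_nonneg _)]
    have := hcov onePt onePt
    rw [← integral_stochIntegral_mul hW (hk _) (hk _)] at this
    simp only [sq]
    rw [this]
    have e1 : (0 : ℝ) ^ (2 * h₁) = 0 := Real.zero_rpow (by simpa using hh₁)
    have e2 : (0 : ℝ) ^ (2 * h₂) = 0 := Real.zero_rpow (by simpa using hh₂)
    simp only [onePt, Real.one_rpow, sub_self, abs_zero, e1, e2]
    ring
  refine ⟨isGaussianProcess_stochIntegral hW hk, fun x => integral_stochIntegral hW (hk x),
    fun x y => ?_⟩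
  rw [integral_stochIntegral_mul hW (hk x) (hk y), hcov, hσ]

omit [MeasurableSpace Ω'] in
lemma IsFractionalBrownianSheet.integral_sq [MeasurableSpace Ω'] {σ h₁ h₂ : ℝ} (hh₁ : h₁ ≠ 0)
    (hh₂ : h₂ ≠ 0) {V : Quadrant → Ω' → ℝ} {P' : Measure Ω'}
    (hV : IsFractionalBrownianSheet σ h₁ h₂ V P') (x : Quadrant) :
    ∫ ω, V x ω ^ 2 ∂P' = σ ^ 2 * (x.1 0 ^ (2 * h₁) * x.1 1 ^ (2 * h₂)) := by
  simp only [sq]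
  rw [hV.covariance]
  have e1 : (0 : ℝ) ^ (2 * h₁) = 0 := Real.zero_rpow (by simpa using hh₁)
  have e2 : (0 : ℝ) ^ (2 * h₂) = 0 := Real.zero_rpow (by simpa using hh₂)
  simp only [sub_self, abs_zero, e1, e2]
  ring

omit [IsProbabilityMeasure P'] in
/-- Two nondegenerate fractional Brownian sheets which scale differently at some point do not agree
up to a constant factor. -/
lemma not_eqFdd_of_isFractionalBrownianSheet {σ σ' h₁ h₂ h₁' h₂' : ℝ} (hh₁ : h₁ ≠ 0)
    (hh₂ : h₂ ≠ 0) (hh₁' : h₁' ≠ 0) (hh₂' : h₂' ≠ 0) {V V' : Quadrant → Ω' → ℝ}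
    (hV : IsFractionalBrownianSheet σ h₁ h₂ V P')
    (hV' : IsFractionalBrownianSheet σ' h₁' h₂' V' P')
    (x : Quadrant)
    (hx : x.1 0 ^ (2 * h₁) * x.1 1 ^ (2 * h₂) ≠ x.1 0 ^ (2 * h₁') * x.1 1 ^ (2 * h₂'))
    (hσ : σ ≠ 0 ∨ σ' ≠ 0) {c : ℝ} (hc : 0 < c) : ¬ EqFdd V (fun x ω => c * V' x ω) P' := by
  intro h
  have hvar : ∀ x, ∫ ω, V x ω ^ 2 ∂P' = c ^ 2 * ∫ ω, V' x ω ^ 2 ∂P' := by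
    intro x
    have h1 := h 1 fun _ => x
    have h2 : ∀ {U : Ω' → ℝ}, AEMeasurable U P' →
        ∫ v, v 0 ^ 2 ∂(P'.map fun ω (_ : Fin 1) => U ω) = ∫ ω, U ω ^ 2 ∂P' := by
      intro U hU
      rw [integral_map (aemeasurable_pi_lambda _ fun _ => hU)
        (by fun_prop : Measurable fun v : Fin 1 → ℝ => v 0 ^ 2).aestronglyMeasurable]
    have h3 := h2 (hV.gaussian.aemeasurable x)
    have h4 := h2 ((hV'.gaussian.aemeasurable x).const_mul c)
    rw [← h3, h1, h4]
    simp only [mul_pow, integral_const_mul]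
  have h5 := hvar onePt
  have h6 := hvar x
  rw [hV.integral_sq hh₁ hh₂, hV'.integral_sq hh₁' hh₂'] at h5 h6
  simp only [onePt, Real.one_rpow, mul_one] at h5
  rw [h5] at h6
  have h7 : c ^ 2 * σ' ^ 2 ≠ 0 := by
    intro h0
    rw [h0] at h5
    have : σ' = 0 := by simpa [hc.ne'] using h0
    rcases hσ with h' | h'
    · exact h' (by simpa using h5)
    · exact h' this
  exact hx (mul_left_cancel₀ h7 (h6.trans (by ring)))

end Criterion

/-! ### Anisotropic kernels on the plane -/

/-- The anisotropic gauge `|w|^{q₁} + |z|^{q₂}` in coordinates. -/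
noncomputable def gauge (q₁ q₂ w z : ℝ) : ℝ := |w| ^ q₁ + |z| ^ q₂

/-- A kernel on the plane which is homogeneous of degree `-q₁` under the dilations
`(w, z) ↦ (c w, c^{q₁/q₂} z)`, bounded by a multiple of the inverse gauge, and continuous away from
the origin. -/
structure IsAnisotropicKernel (q₁ q₂ : ℝ) (a : ℝ → ℝ → ℝ) : Prop where
  measurable : Measurable fun p : ℝ × ℝ => a p.1 p.2
  bound : ∃ C, ∀ w z, |a w z| * gauge q₁ q₂ w z ≤ C
  homog : ∀ c > 0, ∀ w z, a (c * w) (c ^ (q₁ / q₂) * z) = c ^ (-q₁) * a w z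
  continuousAt : ∀ p : ℝ × ℝ, p ≠ 0 → ContinuousAt (fun p : ℝ × ℝ => a p.1 p.2) p

lemma gauge_nonneg (q₁ q₂ w z : ℝ) : 0 ≤ gauge q₁ q₂ w z := by
  unfold gauge; positivity

lemma gauge_pos {q₁ q₂ w z : ℝ} (h : w ≠ 0 ∨ z ≠ 0) : 0 < gauge q₁ q₂ w z := by
  unfold gauge
  rcases h with h | h <;> positivity

lemma continuous_gauge {q₁ q₂ : ℝ} (hq₁ : 0 < q₁) (hq₂ : 0 < q₂) :
    Continuous fun p : ℝ × ℝ => gauge q₁ q₂ p.1 p.2 := by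
  unfold gauge
  exact (continuous_fst.abs.rpow_const fun _ => Or.inr hq₁.le).add
    (continuous_snd.abs.rpow_const fun _ => Or.inr hq₂.le)

lemma rpow_div_rpow {q₁ q₂ : ℝ} (hq₂ : 0 < q₂) {M : ℝ} (hM : 0 < M) :
    (M ^ (q₁ / q₂)) ^ q₂ = M ^ q₁ := by
  rw [← Real.rpow_mul hM.le, div_mul_cancel₀ _ hq₂.ne']

lemma gauge_dilate {q₁ q₂ : ℝ} (hq₂ : 0 < q₂) {c : ℝ} (hc : 0 < c) (w z : ℝ) :
    gauge q₁ q₂ (c * w) (c ^ (q₁ / q₂) * z) = c ^ q₁ * gauge q₁ q₂ w z := by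
  unfold gauge
  have h : 0 < c ^ (q₁ / q₂) := by positivity
  rw [abs_mul, abs_mul, abs_of_pos hc, abs_of_pos h, Real.mul_rpow hc.le (abs_nonneg _),
    Real.mul_rpow h.le (abs_nonneg _), rpow_div_rpow hq₂ hc]
  ring

lemma add_rpow_le_two_rpow_mul {x y q : ℝ} (hx : 0 ≤ x) (hy : 0 ≤ y) (hq : 0 ≤ q) :
    (x + y) ^ q ≤ 2 ^ q * (x ^ q + y ^ q) := by
  calc (x + y) ^ q ≤ (2 * max x y) ^ q := by
        apply Real.rpow_le_rpow (by positivity) _ hq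
        linarith [le_max_left x y, le_max_right x y]
    _ = 2 ^ q * max x y ^ q := Real.mul_rpow (by norm_num) (by positivity)
    _ ≤ 2 ^ q * (x ^ q + y ^ q) := by
        gcongr
        rcases max_cases x y with ⟨h, _⟩ | ⟨h, _⟩ <;> rw [h]
        · linarith [Real.rpow_nonneg hy q]
        · linarith [Real.rpow_nonneg hx q]

/-- Coefficients `β` on the lattice which behave like the kernel `a` along the image of the lattice
under the matrix with rows `(c₁₁, c₁₂)` and `(c₂₁, c₂₂)`. -/
structure IsLatticeKernel (q₁ q₂ : ℝ) (a : ℝ → ℝ → ℝ) (c₁₁ c₁₂ c₂₁ c₂₂ : ℝ)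
    (β : ℤ → ℤ → ℝ) : Prop where
  bound : ∃ C, ∀ r₁ r₂ : ℤ,
    |β r₁ r₂| * (1 + gauge q₁ q₂ (c₁₁ * r₁ + c₁₂ * r₂) (c₂₁ * r₁ + c₂₂ * r₂)) ≤ C
  tendsto : Tendsto (fun r : ℤ × ℤ =>
    (β r.1 r.2 - a (c₁₁ * r.1 + c₁₂ * r.2) (c₂₁ * r.1 + c₂₂ * r.2)) *
      gauge q₁ q₂ (c₁₁ * r.1 + c₁₂ * r.2) (c₂₁ * r.1 + c₂₂ * r.2)) cofinite (𝓝 0)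

section Rescaling

variable {q₁ q₂ : ℝ} {a : ℝ → ℝ → ℝ} {c₁₁ c₁₂ c₂₁ c₂₂ : ℝ} {β : ℤ → ℤ → ℝ}

lemma exists_gauge_le (hq₁ : 0 < q₁) (hq : q₁ < q₂) {B : ℝ} (hB : 0 ≤ B) :
    ∃ A, 0 ≤ A ∧ ∀ x y v₁ v₂ : ℝ, |y| ≤ B * (|v₂| + 1) → |x| ≤ B * (|v₁| + |y| + 1) →
      |x| ^ q₁ + |y| ^ q₂ ≤ A * (1 + gauge q₁ q₂ v₁ v₂) := by
  have hq₂ : 0 < q₂ := hq₁.trans hq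
  obtain ⟨A₂, hA₂⟩ : ∃ A₂ : ℝ, A₂ = B ^ q₂ * 2 ^ q₂ := ⟨_, rfl⟩
  obtain ⟨A₁, hA₁⟩ : ∃ A₁ : ℝ, A₁ = B ^ q₁ * (2 ^ q₁ * 2 ^ q₁) * (1 + (1 + A₂) + 1) := ⟨_, rfl⟩
  have hA₂0 : 0 ≤ A₂ := by rw [hA₂]; positivity
  have hA₁0 : 0 ≤ A₁ := by rw [hA₁]; positivity
  refine ⟨A₁ + A₂, by positivity, fun x y v₁ v₂ h1 h2 => ?_⟩
  have hg0 := gauge_nonneg q₁ q₂ v₁ v₂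
  have hv2g : |v₂| ^ q₂ ≤ gauge q₁ q₂ v₁ v₂ := by
    unfold gauge; linarith [Real.rpow_nonneg (abs_nonneg v₁) q₁]
  have hv1g : |v₁| ^ q₁ ≤ gauge q₁ q₂ v₁ v₂ := by
    unfold gauge; linarith [Real.rpow_nonneg (abs_nonneg v₂) q₂]
  generalize gauge q₁ q₂ v₁ v₂ = G at *
  have hy2 : |y| ^ q₂ ≤ A₂ * (1 + G) := by
    calc |y| ^ q₂ ≤ (B * (|v₂| + 1)) ^ q₂ :=
          Real.rpow_le_rpow (abs_nonneg _) h1 hq₂.le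
      _ = B ^ q₂ * (|v₂| + 1) ^ q₂ := Real.mul_rpow (by positivity) (by positivity)
      _ ≤ B ^ q₂ * (2 ^ q₂ * (|v₂| ^ q₂ + 1 ^ q₂)) := by
          gcongr
          exact add_rpow_le_two_rpow_mul (abs_nonneg _) zero_le_one hq₂.le
      _ ≤ B ^ q₂ * (2 ^ q₂ * (1 + G)) := by
          rw [Real.one_rpow]
          gcongr ?_ * (?_ * ?_)
          linarith
      _ = A₂ * (1 + G) := by rw [hA₂]; ring
  have hy1 : |y| ^ q₁ ≤ (1 + A₂) * (1 + G) := by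
    have e : (1 + A₂) * (1 + G) = 1 + G + A₂ * (1 + G) := by ring
    rw [e]
    rcases le_total |y| 1 with h | h
    · have : |y| ^ q₁ ≤ 1 := Real.rpow_le_one (abs_nonneg _) h hq₁.le
      have : 0 ≤ A₂ * (1 + G) := by positivity
      linarith
    · have : |y| ^ q₁ ≤ |y| ^ q₂ := Real.rpow_le_rpow_of_exponent_le h hq.le
      linarith
  have hx1 : |x| ^ q₁ ≤ A₁ * (1 + G) := by
    calc |x| ^ q₁ ≤ (B * (|v₁| + |y| + 1)) ^ q₁ :=
          Real.rpow_le_rpow (abs_nonneg _) h2 hq₁.le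
      _ = B ^ q₁ * (|v₁| + |y| + 1) ^ q₁ := Real.mul_rpow hB (by positivity)
      _ ≤ B ^ q₁ * (2 ^ q₁ * ((|v₁| + |y|) ^ q₁ + 1 ^ q₁)) := by
          gcongr
          exact add_rpow_le_two_rpow_mul (by positivity) zero_le_one hq₁.le
      _ ≤ B ^ q₁ * (2 ^ q₁ * (2 ^ q₁ * (|v₁| ^ q₁ + |y| ^ q₁) + 2 ^ q₁ * 1)) := by
          gcongr
          · exact add_rpow_le_two_rpow_mul (abs_nonneg _) (abs_nonneg _) hq₁.le
          · rw [Real.one_rpow, mul_one]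
            exact Real.one_le_rpow (by norm_num) hq₁.le
      _ ≤ B ^ q₁ * (2 ^ q₁ * (2 ^ q₁ * ((1 + G) + (1 + A₂) * (1 + G)) + 2 ^ q₁ * (1 + G))) := by
          gcongr B ^ q₁ * (2 ^ q₁ * (2 ^ q₁ * (?_ + ?_) + 2 ^ q₁ * ?_))
          · linarith
          · linarith
      _ = A₁ * (1 + G) := by rw [hA₁]; ring
  linarith

/-- Uniform bound for rescaled lattice coefficients. The point `(M w, e M w + M^{q₁/q₂} z)` with
`e = -c₂₁/c₂₂` is the preimage of a point whose second coordinate is of order `M^{q₁/q₂}`. -/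
lemma IsLatticeKernel.rescaled_bound (hβ : IsLatticeKernel q₁ q₂ a c₁₁ c₁₂ c₂₁ c₂₂ β)
    (hq₁ : 0 < q₁) (hq : q₁ < q₂) (hdet : c₁₁ * c₂₂ - c₁₂ * c₂₁ ≠ 0) (h₂₂ : c₂₂ ≠ 0) :
    ∃ C, 0 < C ∧ ∀ M : ℝ, 0 < M → ∀ w z : ℝ, ∀ r₁ r₂ : ℤ, |r₁ - M * w| ≤ 2 →
      |r₂ - (-(c₂₁ / c₂₂) * (M * w) + M ^ (q₁ / q₂) * z)| ≤ 2 →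
      M ^ q₁ * |β r₁ r₂| * gauge q₁ q₂ w z ≤ C := by
  obtain ⟨C, hC⟩ := hβ.bound
  have hq₂ : 0 < q₂ := hq₁.trans hq
  have h22 : 0 < |c₂₂| := abs_pos.2 h₂₂
  obtain ⟨d, hd⟩ : ∃ d, d = c₁₁ * c₂₂ - c₁₂ * c₂₁ := ⟨_, rfl⟩
  rw [← hd] at hdet
  have hd0 : 0 < |d| := abs_pos.2 hdet
  obtain ⟨K₂, hK₂⟩ : ∃ K, K = 2 * (|c₂₁| + |c₂₂|) := ⟨_, rfl⟩
  obtain ⟨K₁, hK₁⟩ : ∃ K, K = 2 * (|c₁₁| + |c₁₂|) := ⟨_, rfl⟩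
  have hK₁0 : 0 ≤ K₁ := by rw [hK₁]; positivity
  have hK₂0 : 0 ≤ K₂ := by rw [hK₂]; positivity
  obtain ⟨A, hA0, hA⟩ := exists_gauge_le hq₁ hq
    (B := |c₂₂|⁻¹ * (1 + K₂) + |c₂₂| / |d| * (1 + |c₁₂| + K₁)) (by positivity)
  have hC0 : 0 ≤ C := (mul_nonneg (abs_nonneg _) (by
    linarith [gauge_nonneg q₁ q₂ (c₁₁ * (0 : ℤ) + c₁₂ * (0 : ℤ)) (c₂₁ * (0 : ℤ) + c₂₂ * (0 : ℤ))])).trans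
    (hC 0 0)
  refine ⟨C * A + 1, by positivity, fun M hM w z r₁ r₂ h1 h2 => ?_⟩
  have hgd : M ^ q₁ * gauge q₁ q₂ w z = |M * w| ^ q₁ + |M ^ (q₁ / q₂) * z| ^ q₂ := by
    rw [← gauge_dilate hq₂ hM]; rfl
  generalize M * w = x at *
  generalize M ^ (q₁ / q₂) * z = y at *
  have hCr := hC r₁ r₂
  obtain ⟨v₁, hv₁⟩ : ∃ v, v = c₁₁ * (r₁ : ℝ) + c₁₂ * r₂ := ⟨_, rfl⟩
  obtain ⟨v₂, hv₂⟩ : ∃ v, v = c₂₁ * (r₁ : ℝ) + c₂₂ * r₂ := ⟨_, rfl⟩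
  rw [← hv₁, ← hv₂] at hCr
  have hyv : |c₂₂| * |y| ≤ |v₂| + K₂ := by
    have e1 : c₂₂ * y = v₂ - (c₂₁ * (r₁ - x) + c₂₂ * (r₂ - (-(c₂₁ / c₂₂) * x + y))) := by
      rw [hv₂]; field_simp; ring
    rw [← abs_mul, e1]
    refine (abs_sub _ _).trans (add_le_add le_rfl ((abs_add_le _ _).trans ?_))
    rw [abs_mul, abs_mul, hK₂]
    linarith [mul_le_mul_of_nonneg_left h1 (abs_nonneg c₂₁),
      mul_le_mul_of_nonneg_left h2 (abs_nonneg c₂₂)]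
  have hxv : |d| * |x| ≤ |c₂₂| * (|v₁| + |c₁₂| * |y| + K₁) := by
    have e1 : d * x = c₂₂ * (v₁ - c₁₂ * y -
        (c₁₁ * (r₁ - x) + c₁₂ * (r₂ - (-(c₂₁ / c₂₂) * x + y)))) := by
      rw [hv₁, hd]; field_simp; ring
    rw [← abs_mul, e1, abs_mul]
    refine mul_le_mul_of_nonneg_left ?_ h22.le
    refine (abs_sub _ _).trans (add_le_add ((abs_sub _ _).trans (by rw [abs_mul]))
      ((abs_add_le _ _).trans ?_))
    rw [abs_mul, abs_mul, hK₁]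
    linarith [mul_le_mul_of_nonneg_left h1 (abs_nonneg c₁₁),
      mul_le_mul_of_nonneg_left h2 (abs_nonneg c₁₂)]
  have h3 : |y| ≤ (|c₂₂|⁻¹ * (1 + K₂) + |c₂₂| / |d| * (1 + |c₁₂| + K₁)) * (|v₂| + 1) := by
    have h4 : |y| ≤ |c₂₂|⁻¹ * (|v₂| + K₂) := by
      rw [inv_mul_eq_div, le_div_iff₀ h22]; linarith
    refine h4.trans ?_
    have h5 : |v₂| + K₂ ≤ (1 + K₂) * (|v₂| + 1) := by
      nlinarith [mul_nonneg hK₂0 (abs_nonneg v₂)]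
    calc |c₂₂|⁻¹ * (|v₂| + K₂) ≤ |c₂₂|⁻¹ * ((1 + K₂) * (|v₂| + 1)) := by gcongr
      _ ≤ |c₂₂|⁻¹ * ((1 + K₂) * (|v₂| + 1)) + |c₂₂| / |d| * (1 + |c₁₂| + K₁) * (|v₂| + 1) :=
        le_add_of_nonneg_right (by positivity)
      _ = _ := by ring
  have h4 : |x| ≤ (|c₂₂|⁻¹ * (1 + K₂) + |c₂₂| / |d| * (1 + |c₁₂| + K₁)) *
      (|v₁| + |y| + 1) := by
    have h4 : |x| ≤ |c₂₂| / |d| * (|v₁| + |c₁₂| * |y| + K₁) := by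
      rw [div_mul_eq_mul_div, le_div_iff₀ hd0]; linarith
    refine h4.trans ?_
    have h5 : |v₁| + |c₁₂| * |y| + K₁ ≤ (1 + |c₁₂| + K₁) * (|v₁| + |y| + 1) := by
      have := abs_nonneg v₁
      have := abs_nonneg y
      have := abs_nonneg c₁₂
      have e : (1 + |c₁₂| + K₁) * (|v₁| + |y| + 1) = |v₁| + |c₁₂| * |y| + K₁ +
        (|y| + 1 + |c₁₂| * |v₁| + |c₁₂| + K₁ * |v₁| + K₁ * |y|) := by ring
      rw [e]
      exact le_add_of_nonneg_right (by positivity)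
    calc |c₂₂| / |d| * (|v₁| + |c₁₂| * |y| + K₁)
        ≤ |c₂₂| / |d| * ((1 + |c₁₂| + K₁) * (|v₁| + |y| + 1)) := by gcongr
      _ ≤ |c₂₂|⁻¹ * (1 + K₂) * (|v₁| + |y| + 1)
          + |c₂₂| / |d| * ((1 + |c₁₂| + K₁) * (|v₁| + |y| + 1)) :=
        le_add_of_nonneg_left (by positivity)
      _ = _ := by ring
  have h5 := hA x y v₁ v₂ h3 h4
  calc M ^ q₁ * |β r₁ r₂| * gauge q₁ q₂ w z = |β r₁ r₂| * (M ^ q₁ * gauge q₁ q₂ w z) := by ring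
    _ ≤ |β r₁ r₂| * (A * (1 + gauge q₁ q₂ v₁ v₂)) := by rw [hgd]; gcongr
    _ = A * (|β r₁ r₂| * (1 + gauge q₁ q₂ v₁ v₂)) := by ring
    _ ≤ A * C := by gcongr
    _ ≤ _ := by linarith

/-- Rescaled lattice coefficients converge to the kernel. -/
lemma IsLatticeKernel.rescaled_tendsto (hβ : IsLatticeKernel q₁ q₂ a c₁₁ c₁₂ c₂₁ c₂₂ β)
    (ha : IsAnisotropicKernel q₁ q₂ a)
    (hq₁ : 0 < q₁) (hq : q₁ < q₂) (hdet : c₁₁ * c₂₂ - c₁₂ * c₂₁ ≠ 0) (h₂₂ : c₂₂ ≠ 0)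
    {ι : Type*} {l : Filter ι} {M : ι → ℝ} (hM : Tendsto M l atTop) {w z : ℝ} (hw : w ≠ 0)
    {r₁ r₂ : ι → ℤ} (h1 : ∀ i, |r₁ i - M i * w| ≤ 2)
    (h2 : ∀ i, |r₂ i - (-(c₂₁ / c₂₂) * (M i * w) + M i ^ (q₁ / q₂) * z)| ≤ 2) :
    Tendsto (fun i => M i ^ q₁ * β (r₁ i) (r₂ i)) l
      (𝓝 (a ((c₁₁ * c₂₂ - c₁₂ * c₂₁) / c₂₂ * w) (c₂₂ * z))) := by
  have hq₂ : 0 < q₂ := hq₁.trans hq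
  have hζ : 0 < q₁ / q₂ := by positivity
  have hζ1 : q₁ / q₂ < 1 := (div_lt_one hq₂).2 hq
  have hMpos : ∀ᶠ i in l, 0 < M i := hM.eventually_gt_atTop 0
  have hM' : Tendsto (fun i => M i ^ (q₁ / q₂)) l atTop := (tendsto_rpow_atTop hζ).comp hM
  -- the rounding errors are negligible on both scales
  have herr : ∀ {e : ι → ℝ} {N : ι → ℝ}, (∀ i, |e i| ≤ 2) → Tendsto N l atTop →
      Tendsto (fun i => e i / N i) l (𝓝 0) := by
    intro e N he hN
    refine squeeze_zero_norm' ?_ (hN.const_div_atTop 2)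
    filter_upwards [hN.eventually_gt_atTop 0] with i hi
    rw [Real.norm_eq_abs, abs_div, abs_of_pos hi]
    exact div_le_div_of_nonneg_right (he i) hi.le
  have e1 := herr h1 hM
  have e2 := herr h2 hM
  have e1' := herr h1 hM'
  have e2' := herr h2 hM'
  have hratio : Tendsto (fun i => M i ^ (q₁ / q₂) / M i) l (𝓝 0) := by
    have : Tendsto (fun i => M i ^ (-(1 - q₁ / q₂))) l (𝓝 0) :=
      (tendsto_rpow_neg_atTop (by linarith)).comp hM
    refine this.congr' (hMpos.mono fun i hi => ?_)
    rw [neg_sub, Real.rpow_sub hi, Real.rpow_one]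
  set v₁ : ι → ℝ := fun i => c₁₁ * (r₁ i : ℝ) + c₁₂ * r₂ i with hv₁
  set v₂ : ι → ℝ := fun i => c₂₁ * (r₁ i : ℝ) + c₂₂ * r₂ i with hv₂
  have t1 : Tendsto (fun i => v₁ i / M i) l (𝓝 ((c₁₁ * c₂₂ - c₁₂ * c₂₁) / c₂₂ * w)) := by
    have : Tendsto (fun i => (c₁₁ * c₂₂ - c₁₂ * c₂₁) / c₂₂ * w
        + c₁₁ * ((r₁ i - M i * w) / M i)
        + c₁₂ * ((r₂ i - (-(c₂₁ / c₂₂) * (M i * w) + M i ^ (q₁ / q₂) * z)) / M i)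
        + c₁₂ * z * (M i ^ (q₁ / q₂) / M i)) l
        (𝓝 ((c₁₁ * c₂₂ - c₁₂ * c₂₁) / c₂₂ * w + c₁₁ * 0 + c₁₂ * 0 + c₁₂ * z * 0)) :=
      ((tendsto_const_nhds.add (e1.const_mul _)).add (e2.const_mul _)).add (hratio.const_mul _)
    simp only [mul_zero, add_zero] at this
    refine this.congr' (hMpos.mono fun i hi => ?_)
    rw [hv₁]
    field_simp
    ring
  have t2 : Tendsto (fun i => v₂ i / M i ^ (q₁ / q₂)) l (𝓝 (c₂₂ * z)) := by
    have : Tendsto (fun i => c₂₂ * z + c₂₁ * ((r₁ i - M i * w) / M i ^ (q₁ / q₂))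
        + c₂₂ * ((r₂ i - (-(c₂₁ / c₂₂) * (M i * w) + M i ^ (q₁ / q₂) * z)) / M i ^ (q₁ / q₂))) l
        (𝓝 (c₂₂ * z + c₂₁ * 0 + c₂₂ * 0)) :=
      (tendsto_const_nhds.add (e1'.const_mul _)).add (e2'.const_mul _)
    simp only [mul_zero, add_zero] at this
    refine this.congr' (hMpos.mono fun i hi => ?_)
    have : 0 < M i ^ (q₁ / q₂) := by positivity
    rw [hv₂]
    field_simp
    ring
  have hne : ((c₁₁ * c₂₂ - c₁₂ * c₂₁) / c₂₂ * w, c₂₂ * z) ≠ (0 : ℝ × ℝ) := by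
    intro h
    have := (Prod.ext_iff.1 h).1
    simp [hdet, h₂₂, hw] at this
  have hback : ∀ i, 0 < M i → M i * (v₁ i / M i) = v₁ i ∧
      M i ^ (q₁ / q₂) * (v₂ i / M i ^ (q₁ / q₂)) = v₂ i := fun i hi =>
    ⟨mul_div_cancel₀ _ hi.ne', mul_div_cancel₀ _ (Real.rpow_pos_of_pos hi _).ne'⟩
  have ta : Tendsto (fun i => M i ^ q₁ * a (v₁ i) (v₂ i)) l
      (𝓝 (a ((c₁₁ * c₂₂ - c₁₂ * c₂₁) / c₂₂ * w) (c₂₂ * z))) := by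
    have := (ha.continuousAt _ hne).tendsto.comp (t1.prodMk_nhds t2)
    refine this.congr' (hMpos.mono fun i hi => ?_)
    have h3 := ha.homog (M i) hi (v₁ i / M i) (v₂ i / M i ^ (q₁ / q₂))
    rw [(hback i hi).1, (hback i hi).2] at h3
    simp only [Function.comp_apply]
    rw [h3, ← mul_assoc, ← Real.rpow_add hi]
    simp
  have tg : Tendsto (fun i => M i ^ q₁ * (gauge q₁ q₂ (v₁ i) (v₂ i))⁻¹) l
      (𝓝 (gauge q₁ q₂ ((c₁₁ * c₂₂ - c₁₂ * c₂₁) / c₂₂ * w) (c₂₂ * z))⁻¹) := by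
    have hpos : 0 < gauge q₁ q₂ ((c₁₁ * c₂₂ - c₁₂ * c₂₁) / c₂₂ * w) (c₂₂ * z) :=
      gauge_pos (Or.inl (by positivity))
    have := (((continuous_gauge hq₁ hq₂).tendsto _).comp (t1.prodMk_nhds t2)).inv₀ hpos.ne'
    refine this.congr' (hMpos.mono fun i hi => ?_)
    have h3 := gauge_dilate (q₁ := q₁) hq₂ hi (v₁ i / M i) (v₂ i / M i ^ (q₁ / q₂))
    rw [(hback i hi).1, (hback i hi).2] at h3
    simp only [Function.comp_apply]
    rw [h3, mul_inv, ← mul_assoc, mul_inv_cancel₀ (Real.rpow_pos_of_pos hi _).ne', one_mul]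
  have hcof : Tendsto (fun i => (r₁ i, r₂ i)) l cofinite := by
    have hr : Tendsto (fun i => ‖((r₁ i, r₂ i) : ℤ × ℤ)‖) l atTop := by
      have h3 : Tendsto (fun i => M i * |w| - 2) l atTop :=
        tendsto_atTop_add_const_right _ _ (hM.atTop_mul_const (abs_pos.2 hw))
      refine tendsto_atTop_mono' _ (hMpos.mono fun i hi => ?_) h3
      have h4 : |M i * w| ≤ |(r₁ i : ℝ)| + |(r₁ i : ℝ) - M i * w| := by
        have : M i * w = r₁ i - (r₁ i - M i * w) := by ring
        conv_lhs => rw [this]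
        exact abs_sub _ _
      rw [abs_mul, abs_of_pos hi] at h4
      have h5 : |(r₁ i : ℝ)| ≤ ‖((r₁ i, r₂ i) : ℤ × ℤ)‖ := by
        rw [Prod.norm_def]
        refine le_trans (le_of_eq ?_) (le_max_left _ _)
        rw [Int.norm_eq_abs]
      linarith [h1 i]
    rw [← cocompact_eq_cofinite, ← Metric.cobounded_eq_cocompact]
    exact tendsto_norm_atTop_iff_cobounded.1 hr
  have tb := (hβ.tendsto.comp hcof).mul tg
  rw [zero_mul] at tb
  have tsum := tb.add ta
  rw [zero_add] at tsum
  refine tsum.congr' ?_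
  have hgne := tg.eventually_ne (inv_ne_zero (gauge_pos (q₁ := q₁) (q₂ := q₂)
    (w := (c₁₁ * c₂₂ - c₁₂ * c₂₁) / c₂₂ * w) (z := c₂₂ * z) (Or.inl (by positivity))).ne')
  filter_upwards [hgne] with i hi
  have hg0 : gauge q₁ q₂ (v₁ i) (v₂ i) ≠ 0 := by
    intro h0
    simp [h0] at hi
  simp only [Function.comp_apply]
  change (β (r₁ i) (r₂ i) - a (v₁ i) (v₂ i)) * gauge q₁ q₂ (v₁ i) (v₂ i) *
    (M i ^ q₁ * (gauge q₁ q₂ (v₁ i) (v₂ i))⁻¹) + M i ^ q₁ * a (v₁ i) (v₂ i) = _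
  field_simp
  ring

end Rescaling

lemma div_rpow_gauge_mem_Icc {q₁ q₂ : ℝ} (hq₁ : 0 < q₁) (w z : ℝ) :
    w / gauge q₁ q₂ w z ^ (1 / q₁) ∈ Set.Icc (-1 : ℝ) 1 := by
  rw [Set.mem_Icc, ← abs_le, abs_div, abs_of_nonneg (Real.rpow_nonneg (gauge_nonneg _ _ _ _) _)]
  refine div_le_one_of_le₀ ?_ (Real.rpow_nonneg (gauge_nonneg _ _ _ _) _)
  calc |w| = (|w| ^ q₁) ^ (1 / q₁) := by
        rw [← Real.rpow_mul (abs_nonneg _), mul_one_div_cancel hq₁.ne', Real.rpow_one]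
    _ ≤ _ := by
        apply Real.rpow_le_rpow (by positivity) _ (by positivity)
        unfold gauge
        linarith [Real.rpow_nonneg (abs_nonneg z) q₂]

/-- The kernel `a_∞` in curried form. -/
noncomputable def kernelAInf (q₁ q₂ : ℝ) (Lpos Lneg : ℝ → ℝ) (w z : ℝ) : ℝ :=
  aInf q₁ q₂ Lpos Lneg ![w, z]

lemma kernelAInf_eq (q₁ q₂ : ℝ) (Lpos Lneg : ℝ → ℝ) (w z : ℝ) :
    kernelAInf q₁ q₂ Lpos Lneg w z = (gauge q₁ q₂ w z)⁻¹ *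
      if 0 ≤ z then Lpos (w / gauge q₁ q₂ w z ^ (1 / q₁))
      else Lneg (w / gauge q₁ q₂ w z ^ (1 / q₁)) := by
  simp [kernelAInf, aInf, angular, rho, gauge]

lemma isAnisotropicKernel_kernelAInf_of_continuous {q₁ q₂ : ℝ} (hq₁ : 0 < q₁) (hq₂ : 0 < q₂)
    {Lpos Lneg : ℝ → ℝ} (hLpos : Continuous Lpos) (hLneg : Continuous Lneg)
    (hL_one : Lpos 1 = Lneg 1) (hL_neg_one : Lpos (-1) = Lneg (-1)) :
    IsAnisotropicKernel q₁ q₂ (kernelAInf q₁ q₂ Lpos Lneg) := by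
  have hg := continuous_gauge hq₁ hq₂
  refine ⟨?_, ?_, ?_, ?_⟩
  · simp only [kernelAInf_eq]
    have hs : Measurable fun p : ℝ × ℝ => p.1 / gauge q₁ q₂ p.1 p.2 ^ (1 / q₁) :=
      measurable_fst.div (hg.measurable.pow_const _)
    exact hg.measurable.inv.mul (Measurable.ite (measurableSet_le measurable_const measurable_snd)
      (hLpos.measurable.comp hs) (hLneg.measurable.comp hs))
  · obtain ⟨C₁, hC₁⟩ := isCompact_Icc.exists_bound_of_continuousOn
      (hLpos.continuousOn (s := Set.Icc (-1 : ℝ) 1))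
    obtain ⟨C₂, hC₂⟩ := isCompact_Icc.exists_bound_of_continuousOn
      (hLneg.continuousOn (s := Set.Icc (-1 : ℝ) 1))
    refine ⟨max C₁ C₂, fun w z => ?_⟩
    have hmem := div_rpow_gauge_mem_Icc (q₂ := q₂) hq₁ w z
    have hb : |if 0 ≤ z then Lpos (w / gauge q₁ q₂ w z ^ (1 / q₁))
        else Lneg (w / gauge q₁ q₂ w z ^ (1 / q₁))| ≤ max C₁ C₂ := by
      split_ifs
      · exact (hC₁ _ hmem).trans (le_max_left _ _)
      · exact (hC₂ _ hmem).trans (le_max_right _ _)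
    rw [kernelAInf_eq, abs_mul, abs_inv, abs_of_nonneg (gauge_nonneg q₁ q₂ w z)]
    rcases (gauge_nonneg q₁ q₂ w z).eq_or_lt with h | h
    · rw [← h, mul_zero]
      exact (abs_nonneg _).trans hb
    · rw [mul_right_comm, inv_mul_cancel₀ h.ne', one_mul]
      exact hb
  · intro c hc w z
    have h1 := gauge_dilate (q₁ := q₁) hq₂ hc w z
    have h2 : 0 < c ^ (q₁ / q₂) := by positivity
    have h3 : c * w / (c ^ q₁ * gauge q₁ q₂ w z) ^ (1 / q₁)
        = w / gauge q₁ q₂ w z ^ (1 / q₁) := by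
      rw [Real.mul_rpow (by positivity) (gauge_nonneg _ _ _ _), ← Real.rpow_mul hc.le,
        mul_one_div_cancel hq₁.ne', Real.rpow_one, mul_div_mul_left _ _ hc.ne']
    rw [kernelAInf_eq, kernelAInf_eq, h1, h3, mul_inv, Real.rpow_neg hc.le, ← mul_assoc]
    congr 1
    simp only [mul_nonneg_iff_of_pos_left h2]
  · rintro ⟨w, z⟩ hp
    have hne : w ≠ 0 ∨ z ≠ 0 := by
      by_contra! h
      exact hp (by simp [h.1, h.2])
    have hpos : 0 < gauge q₁ q₂ w z := gauge_pos hne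
    have hgc : ContinuousAt (fun p : ℝ × ℝ => gauge q₁ q₂ p.1 p.2) (w, z) := hg.continuousAt
    have hs : ContinuousAt (fun p : ℝ × ℝ => p.1 / gauge q₁ q₂ p.1 p.2 ^ (1 / q₁)) (w, z) :=
      continuousAt_fst.div (hgc.rpow_const (Or.inl hpos.ne'))
        (Real.rpow_pos_of_pos hpos _).ne'
    simp only [kernelAInf_eq]
    refine (hgc.inv₀ hpos.ne').mul ?_
    have tp := hLpos.continuousAt.comp hs
    have tn := hLneg.continuousAt.comp hs
    rcases lt_trichotomy z 0 with hz | hz | hz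
    · refine tn.congr ?_
      filter_upwards [(continuous_snd.tendsto (w, z)).eventually_lt_const hz] with p hp'
      simp [not_le.2 hp']
    · subst hz
      -- on the axis `z = 0` the two branches agree since the argument is `±1`
      have hval : w / gauge q₁ q₂ w 0 ^ (1 / q₁) = w / |w| := by
        unfold gauge
        rw [abs_zero, Real.zero_rpow hq₂.ne', add_zero, ← Real.rpow_mul (abs_nonneg _),
          mul_one_div_cancel hq₁.ne', Real.rpow_one]
      have hw : w ≠ 0 := by simpa using hne
      have heq : Lpos (w / gauge q₁ q₂ w 0 ^ (1 / q₁)) = Lneg (w / gauge q₁ q₂ w 0 ^ (1 / q₁)) := by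
        rw [hval]
        rcases lt_or_gt_of_ne hw with h | h
        · rw [abs_of_neg h, div_neg, div_self hw, hL_neg_one]
        · rw [abs_of_pos h, div_self hw, hL_one]
      unfold ContinuousAt at tp tn ⊢
      simp only [Function.comp_apply] at tp tn
      simp only [le_refl, if_true]
      rw [← heq] at tn
      exact Filter.Tendsto.if' tp tn
    · refine tp.congr ?_
      filter_upwards [(continuous_snd.tendsto (w, z)).eventually_const_lt hz] with p hp'
      simp [hp'.le]

/-- Only the values of `L₊` and `L₋` on `[-1, 1]` matter, so that continuity there suffices. -/
lemma isAnisotropicKernel_kernelAInf {q₁ q₂ : ℝ} (hq₁ : 0 < q₁) (hq₂ : 0 < q₂)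
    {Lpos Lneg : ℝ → ℝ} (hLpos : ContinuousOn Lpos (Set.Icc (-1) 1))
    (hLneg : ContinuousOn Lneg (Set.Icc (-1) 1))
    (hL_one : Lpos 1 = Lneg 1) (hL_neg_one : Lpos (-1) = Lneg (-1)) :
    IsAnisotropicKernel q₁ q₂ (kernelAInf q₁ q₂ Lpos Lneg) := by
  have h11 : (-1 : ℝ) ≤ 1 := by norm_num
  have hext : ∀ {L : ℝ → ℝ}, ∀ s ∈ Set.Icc (-1 : ℝ) 1,
      Set.IccExtend h11 ((Set.Icc (-1 : ℝ) 1).domRestrict L) s = L s := fun s hs => by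
    rw [Set.IccExtend_of_mem _ _ hs, Set.domRestrict_apply]
  have h := isAnisotropicKernel_kernelAInf_of_continuous hq₁ hq₂
    (Lpos := Set.IccExtend h11 ((Set.Icc (-1 : ℝ) 1).domRestrict Lpos))
    (Lneg := Set.IccExtend h11 ((Set.Icc (-1 : ℝ) 1).domRestrict Lneg))
    hLpos.domRestrict.Icc_extend' hLneg.domRestrict.Icc_extend'
    (by rw [hext 1 (by norm_num), hext 1 (by norm_num), hL_one])
    (by rw [hext (-1) (by norm_num), hext (-1) (by norm_num), hL_neg_one])
  have heq : kernelAInf q₁ q₂ (Set.IccExtend h11 ((Set.Icc (-1 : ℝ) 1).domRestrict Lpos))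
      (Set.IccExtend h11 ((Set.Icc (-1 : ℝ) 1).domRestrict Lneg)) = kernelAInf q₁ q₂ Lpos Lneg := by
    ext w z
    have hmem := div_rpow_gauge_mem_Icc (q₂ := q₂) hq₁ w z
    rw [kernelAInf_eq, kernelAInf_eq, hext _ hmem, hext _ hmem]
  rwa [heq] at h

lemma IsLatticeKernel.swap {q₁ q₂ : ℝ} {a : ℝ → ℝ → ℝ} {c₁₁ c₁₂ c₂₁ c₂₂ : ℝ} {β : ℤ → ℤ → ℝ}
    (h : IsLatticeKernel q₁ q₂ a c₁₁ c₁₂ c₂₁ c₂₂ β) :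
    IsLatticeKernel q₁ q₂ a c₁₂ c₁₁ c₂₂ c₂₁ fun r₁ r₂ => β r₂ r₁ := by
  obtain ⟨C, hC⟩ := h.bound
  refine ⟨⟨C, fun r₁ r₂ => ?_⟩, ?_⟩
  · have := hC r₂ r₁
    rwa [add_comm (c₁₁ * (r₂ : ℝ)), add_comm (c₂₁ * (r₂ : ℝ))] at this
  · refine (h.tendsto.comp Prod.swap_injective.tendsto_cofinite).congr fun r => ?_
    simp only [Function.comp_apply, Prod.fst_swap, Prod.snd_swap]
    rw [add_comm (c₁₁ * (r.2 : ℝ)), add_comm (c₂₁ * (r.2 : ℝ))]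

lemma eventually_one_le_gauge {q₁ q₂ : ℝ} (hq₁ : 0 < q₁) (hq₂ : 0 < q₂) {c₁₁ c₁₂ c₂₁ c₂₂ : ℝ}
    (hdet : c₁₁ * c₂₂ - c₁₂ * c₂₁ ≠ 0) : ∀ᶠ r : ℤ × ℤ in cofinite,
      1 ≤ gauge q₁ q₂ (c₁₁ * r.1 + c₁₂ * r.2) (c₂₁ * r.1 + c₂₂ * r.2) := by
  rw [eventually_cofinite]
  set d := c₁₁ * c₂₂ - c₁₂ * c₂₁ with hd
  have hd0 : 0 < |d| := abs_pos.2 hdet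
  set N : ℤ := ⌈(|c₁₁| + |c₁₂| + |c₂₁| + |c₂₂|) / |d|⌉ with hN
  refine (Set.finite_Icc ((-N, -N) : ℤ × ℤ) (N, N)).subset fun r hr => ?_
  rw [Set.mem_ofPred_eq, not_le] at hr
  obtain ⟨v₁, hv₁⟩ : ∃ v, v = c₁₁ * (r.1 : ℝ) + c₁₂ * r.2 := ⟨_, rfl⟩
  obtain ⟨v₂, hv₂⟩ : ∃ v, v = c₂₁ * (r.1 : ℝ) + c₂₂ * r.2 := ⟨_, rfl⟩
  rw [← hv₁, ← hv₂] at hr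
  have hlt : ∀ {v q : ℝ}, 0 < q → |v| ^ q < 1 → |v| ≤ 1 := by
    intro v q hq h
    by_contra! h'
    exact absurd (Real.one_le_rpow h'.le hq.le) (not_le.2 h)
  have b1 : |v₁| ≤ 1 := hlt hq₁ (by
    unfold gauge at hr; linarith [Real.rpow_nonneg (abs_nonneg v₂) q₂])
  have b2 : |v₂| ≤ 1 := hlt hq₂ (by
    unfold gauge at hr; linarith [Real.rpow_nonneg (abs_nonneg v₁) q₁])
  have e1 : d * r.1 = c₂₂ * v₁ - c₁₂ * v₂ := by rw [hv₁, hv₂, hd]; ring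
  have e2 : d * r.2 = c₁₁ * v₂ - c₂₁ * v₁ := by rw [hv₁, hv₂, hd]; ring
  have key : ∀ {s : ℤ} {x y : ℝ}, d * s = x * v₁ - y * v₂ →
      |x| + |y| ≤ |c₁₁| + |c₁₂| + |c₂₁| + |c₂₂| → |s| ≤ N := by
    intro s x y h h'
    have h2 : |d| * |(s : ℝ)| ≤ |x| + |y| := by
      rw [← abs_mul, h]
      refine (abs_sub _ _).trans ?_
      rw [abs_mul, abs_mul]
      exact add_le_add (mul_le_of_le_one_right (abs_nonneg _) b1)
        (mul_le_of_le_one_right (abs_nonneg _) b2)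
    have h3 : |(s : ℝ)| ≤ (|c₁₁| + |c₁₂| + |c₂₁| + |c₂₂|) / |d| := by
      rw [le_div_iff₀ hd0]; linarith
    have h4 : (|(s : ℝ)|) ≤ (N : ℝ) := h3.trans (Int.le_ceil _)
    exact_mod_cast h4
  have k1 := key e1 (by linarith [abs_nonneg c₁₁, abs_nonneg c₂₁])
  have k2 := key (x := -c₂₁) (y := -c₁₁) (by rw [e2]; ring) (by
    rw [abs_neg, abs_neg]; linarith [abs_nonneg c₁₂, abs_nonneg c₂₂])
  rw [abs_le] at k1 k2
  exact ⟨⟨k1.1, k2.1⟩, ⟨k1.2, k2.2⟩⟩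

lemma IsLatticeKernel.of_tendsto {q₁ q₂ : ℝ} (hq₁ : 0 < q₁) (hq₂ : 0 < q₂) {a : ℝ → ℝ → ℝ}
    (ha : IsAnisotropicKernel q₁ q₂ a) {c₁₁ c₁₂ c₂₁ c₂₂ : ℝ}
    (hdet : c₁₁ * c₂₂ - c₁₂ * c₂₁ ≠ 0) {β : ℤ → ℤ → ℝ}
    (h : Tendsto (fun r : ℤ × ℤ =>
      (β r.1 r.2 - a (c₁₁ * r.1 + c₁₂ * r.2) (c₂₁ * r.1 + c₂₂ * r.2)) *
      gauge q₁ q₂ (c₁₁ * r.1 + c₁₂ * r.2) (c₂₁ * r.1 + c₂₂ * r.2)) cofinite (𝓝 0)) :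
    IsLatticeKernel q₁ q₂ a c₁₁ c₁₂ c₂₁ c₂₂ β := by
  refine ⟨?_, h⟩
  obtain ⟨Ca, hCa⟩ := ha.bound
  have h1 : ∀ᶠ r : ℤ × ℤ in cofinite, |β r.1 r.2| *
      (1 + gauge q₁ q₂ (c₁₁ * r.1 + c₁₂ * r.2) (c₂₁ * r.1 + c₂₂ * r.2)) ≤ 2 * (Ca + 1) := by
    have h2 := (h.norm.eventually_lt_const (v := ‖(0 : ℝ)‖) (u := (1 : ℝ)) (by simp))
    filter_upwards [eventually_one_le_gauge hq₁ hq₂ hdet, h2] with r hr hr'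
    have h3 := hCa (c₁₁ * r.1 + c₁₂ * r.2) (c₂₁ * r.1 + c₂₂ * r.2)
    generalize c₁₁ * (r.1 : ℝ) + c₁₂ * r.2 = v₁ at *
    generalize c₂₁ * (r.1 : ℝ) + c₂₂ * r.2 = v₂ at *
    rw [Real.norm_eq_abs, abs_mul, abs_of_nonneg (gauge_nonneg _ _ _ _)] at hr'
    generalize gauge q₁ q₂ v₁ v₂ = G at *
    have h4 : |β r.1 r.2| ≤ |β r.1 r.2 - a v₁ v₂| + |a v₁ v₂| := by
      have : β r.1 r.2 = (β r.1 r.2 - a v₁ v₂) + a v₁ v₂ := by ring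
      conv_lhs => rw [this]
      exact abs_add_le _ _
    have h5 : |β r.1 r.2| * G ≤ Ca + 1 := by
      calc |β r.1 r.2| * G ≤ (|β r.1 r.2 - a v₁ v₂| + |a v₁ v₂|) * G := by gcongr
        _ ≤ Ca + 1 := by linarith
    have h6 : |β r.1 r.2| * 1 ≤ |β r.1 r.2| * G := by gcongr
    linarith
  obtain ⟨C, hC⟩ := ((eventually_cofinite.1 h1).image fun r : ℤ × ℤ => |β r.1 r.2| *
      (1 + gauge q₁ q₂ (c₁₁ * r.1 + c₁₂ * r.2) (c₂₁ * r.1 + c₂₂ * r.2))).bddAbove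
  refine ⟨max C (2 * (Ca + 1)), fun r₁ r₂ => ?_⟩
  by_cases hr : |β r₁ r₂| *
      (1 + gauge q₁ q₂ (c₁₁ * r₁ + c₁₂ * r₂) (c₂₁ * r₁ + c₂₂ * r₂)) ≤ 2 * (Ca + 1)
  · exact hr.trans (le_max_right _ _)
  · exact (hC ⟨(r₁, r₂), hr, rfl⟩).trans (le_max_left _ _)

/-- The moving-average coefficients form a lattice kernel. -/
lemma HasCoeffAsymptotics.isLatticeKernel {q₁ q₂ : ℝ} (hq₁ : 0 < q₁) (hq₂ : 0 < q₂)
    {Lpos Lneg : ℝ → ℝ} {B : Matrix (Fin 2) (Fin 2) ℝ} (hB : B.det ≠ 0) {b : (Fin 2 → ℤ) → ℝ}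
    (hb : HasCoeffAsymptotics q₁ q₂ Lpos Lneg B b)
    (ha : IsAnisotropicKernel q₁ q₂ (kernelAInf q₁ q₂ Lpos Lneg)) :
    IsLatticeKernel q₁ q₂ (kernelAInf q₁ q₂ Lpos Lneg) (B 0 0) (B 0 1) (B 1 0) (B 1 1)
      fun r₁ r₂ => b ![r₁, r₂] := by
  rw [Matrix.det_fin_two] at hB
  refine IsLatticeKernel.of_tendsto hq₁ hq₂ ha hB ?_
  have hinj : Function.Injective fun r : ℤ × ℤ => ![r.1, r.2] :=
    (finTwoArrowEquiv ℤ).symm.injective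
  have h1 := hb.comp_tendsto hinj.tendsto_cofinite
  have himg : ∀ r : ℤ × ℤ, latticeImage B ![r.1, r.2]
      = ![B 0 0 * r.1 + B 0 1 * r.2, B 1 0 * r.1 + B 1 1 * r.2] := by
    intro r
    ext i
    fin_cases i <;> simp [latticeImage, Matrix.mulVec, dotProduct, Fin.sum_univ_two]
  have hrho : ∀ w z : ℝ, rho q₁ q₂ ![w, z] = gauge q₁ q₂ w z := by
    intro w z
    simp [rho, gauge]
  simp only [Function.comp_def, himg, hrho] at h1
  have h2 := h1.tendsto_div_nhds_zero
  refine h2.congr fun r => ?_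
  rw [div_inv_eq_mul]
  congr 2

/-! ### Integrals of the inverse gauge over strips -/

lemma lintegral_comp_mul_left (f : ℝ → ℝ≥0∞) {c : ℝ} (hc : 0 < c) :
    ∫⁻ z, f z = ENNReal.ofReal c * ∫⁻ z, f (c * z) := by
  have h1 : ∫⁻ z, f (c * z) = ∫⁻ z, f z ∂(Measure.map (c * ·) volume) :=
    ((Homeomorph.mulLeft₀ c hc.ne').measurableEmbedding.lintegral_map f).symm
  rw [h1, Real.map_volume_mul_left hc.ne', lintegral_smul_measure, smul_eq_mul, ← mul_assoc,
    ← ENNReal.ofReal_mul hc.le, abs_of_pos (inv_pos.2 hc), mul_inv_cancel₀ hc.ne',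
    ENNReal.ofReal_one, one_mul]

/-- The Cauchy–Schwarz inequality for the Lebesgue integral. -/
lemma lintegral_mul_sq_le {α : Type*} [MeasurableSpace α] {μ : Measure α} {f g : α → ℝ≥0∞}
    (hf : AEMeasurable f μ) (hg : AEMeasurable g μ) :
    (∫⁻ a, f a * g a ∂μ) ^ 2 ≤ (∫⁻ a, f a ^ 2 ∂μ) * ∫⁻ a, g a ^ 2 ∂μ := by
  have h := ENNReal.lintegral_mul_le_Lp_mul_Lq μ Real.HolderConjugate.two_two hf hg
  simp only [Pi.mul_apply, ENNReal.rpow_two] at h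
  calc (∫⁻ a, f a * g a ∂μ) ^ 2
      ≤ ((∫⁻ a, f a ^ 2 ∂μ) ^ (1 / 2 : ℝ) * (∫⁻ a, g a ^ 2 ∂μ) ^ (1 / 2 : ℝ)) ^ 2 := by
        gcongr
    _ = _ := by
        rw [mul_pow, ← ENNReal.rpow_natCast, ← ENNReal.rpow_mul, ← ENNReal.rpow_natCast,
          ← ENNReal.rpow_mul]
        simp

/-- The total mass `∫ (1 + |z|^{q₂})⁻¹ dz`. -/
noncomputable def sectionMass (q₂ : ℝ) : ℝ≥0∞ := ∫⁻ z : ℝ, ENNReal.ofReal (1 + |z| ^ q₂)⁻¹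

lemma sectionMass_lt_top {q₂ : ℝ} (hq₂ : 1 < q₂) : sectionMass q₂ < ⊤ := by
  have h := finite_integral_one_add_norm (E := ℝ) (μ := volume) (r := q₂) (by simpa using hq₂)
  have hle : ∀ z : ℝ, ENNReal.ofReal (1 + |z| ^ q₂)⁻¹
      ≤ ENNReal.ofReal (2 ^ q₂) * ENNReal.ofReal ((1 + ‖z‖) ^ (-q₂)) := by
    intro z
    rw [← ENNReal.ofReal_mul (by positivity)]
    apply ENNReal.ofReal_le_ofReal
    rw [Real.rpow_neg (by positivity), ← div_eq_mul_inv, inv_eq_one_div,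
      div_le_div_iff₀ (by positivity) (by positivity), one_mul]
    have := add_rpow_le_two_rpow_mul (zero_le_one) (abs_nonneg z) (by linarith : 0 ≤ q₂)
    simpa using this
  calc sectionMass q₂ ≤ ∫⁻ z : ℝ, ENNReal.ofReal (2 ^ q₂) * ENNReal.ofReal ((1 + ‖z‖) ^ (-q₂)) :=
        lintegral_mono hle
    _ = ENNReal.ofReal (2 ^ q₂) * ∫⁻ z : ℝ, ENNReal.ofReal ((1 + ‖z‖) ^ (-q₂)) :=
        lintegral_const_mul _ (by fun_prop)
    _ < ⊤ := ENNReal.mul_lt_top (by simp) h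

lemma lintegral_inv_gauge {q₁ q₂ : ℝ} (hq₂ : 0 < q₂) {w : ℝ} (hw : w ≠ 0) :
    ∫⁻ z, ENNReal.ofReal (gauge q₁ q₂ w z)⁻¹
      = sectionMass q₂ * ENNReal.ofReal (|w| ^ (-(q₁ - q₁ / q₂))) := by
  have hw' : 0 < |w| := abs_pos.2 hw
  have hc : 0 < |w| ^ (q₁ / q₂) := by positivity
  rw [lintegral_comp_mul_left _ hc]
  have h1 : ∀ z, ENNReal.ofReal (gauge q₁ q₂ w (|w| ^ (q₁ / q₂) * z))⁻¹
      = ENNReal.ofReal (|w| ^ (-q₁)) * ENNReal.ofReal (1 + |z| ^ q₂)⁻¹ := by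
    intro z
    rw [← ENNReal.ofReal_mul (by positivity)]
    congr 1
    unfold gauge
    rw [abs_mul, abs_of_pos hc, Real.mul_rpow hc.le (abs_nonneg _), rpow_div_rpow hq₂ hw',
      Real.rpow_neg hw'.le, ← mul_inv]
    ring_nf
  simp_rw [h1]
  rw [lintegral_const_mul _ (by fun_prop), ← mul_assoc, ← ENNReal.ofReal_mul hc.le,
    ← Real.rpow_add hw', mul_comm, sectionMass]
  congr 3
  ring

/-- The mass that the density `|w|^{-κ}` gives to the interval `|u + w| ≤ L`. -/
noncomputable def stripMass (κ L u : ℝ) : ℝ≥0∞ :=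
  ∫⁻ w, {w : ℝ | |u + w| ≤ L}.indicator (fun w => ENNReal.ofReal (|w| ^ (-κ))) w

lemma measurableSet_strip (L u : ℝ) : MeasurableSet {w : ℝ | |u + w| ≤ L} :=
  measurableSet_le (by fun_prop) measurable_const

lemma lintegral_abs_rpow_lt_top {κ : ℝ} (hκ : κ < 1) (R : ℝ) :
    ∫⁻ w in {w : ℝ | |w| ≤ R}, ENNReal.ofReal (|w| ^ (-κ)) < ⊤ := by
  have hpos : ∫⁻ w in Set.Ioc 0 R, ENNReal.ofReal (|w| ^ (-κ)) < ⊤ := by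
    rcases le_total 0 R with hR | hR
    · have h1 := (intervalIntegrable_iff_integrableOn_Ioc_of_le hR).1
        (intervalIntegral.intervalIntegrable_rpow' (a := 0) (b := R) (by linarith : -1 < -κ))
      have h2 := h1.2
      rw [HasFiniteIntegral] at h2
      refine lt_of_le_of_lt (le_of_eq ?_) h2
      refine setLIntegral_congr_fun measurableSet_Ioc fun w hw => ?_
      rw [abs_of_pos hw.1, Real.enorm_of_nonneg (Real.rpow_nonneg hw.1.le _)]
    · simp [Set.Ioc_eq_empty_of_le hR]
  have hneg : ∫⁻ w in Set.Ico (-R) 0, ENNReal.ofReal (|w| ^ (-κ)) < ⊤ := by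
    refine lt_of_le_of_lt (le_of_eq ?_) hpos
    have := (Measure.measurePreserving_neg (volume : Measure ℝ)).setLIntegral_comp_emb
      (Homeomorph.neg ℝ).measurableEmbedding (fun w => ENNReal.ofReal (|w| ^ (-κ)))
      (Set.Ico (-R) 0)
    simp only [abs_neg] at this
    rw [this]
    congr 2
    simp
  have hsub : {w : ℝ | |w| ≤ R} ⊆ (Set.Ioc 0 R ∪ Set.Ico (-R) 0) ∪ {0} := by
    intro w hw
    rw [Set.mem_ofPred_eq, abs_le] at hw
    rcases lt_trichotomy w 0 with h | h | h
    · exact Or.inl (Or.inr ⟨hw.1, h⟩)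
    · exact Or.inr h
    · exact Or.inl (Or.inl ⟨h, hw.2⟩)
  calc _ ≤ ∫⁻ w in (Set.Ioc 0 R ∪ Set.Ico (-R) 0) ∪ {0}, ENNReal.ofReal (|w| ^ (-κ)) :=
        lintegral_mono_set hsub
    _ ≤ ((∫⁻ w in Set.Ioc 0 R, ENNReal.ofReal (|w| ^ (-κ)))
          + ∫⁻ w in Set.Ico (-R) 0, ENNReal.ofReal (|w| ^ (-κ)))
        + ∫⁻ w in {0}, ENNReal.ofReal (|w| ^ (-κ)) :=
        (lintegral_union_le _ _ _).trans (add_le_add_left (lintegral_union_le _ _ _) _)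
    _ < ⊤ := by
        have : ∫⁻ w in ({0} : Set ℝ), ENNReal.ofReal (|w| ^ (-κ)) = 0 := by simp
        rw [this, add_zero]
        exact ENNReal.add_lt_top.2 ⟨hpos, hneg⟩

lemma exists_stripMass_le {κ : ℝ} (hκ0 : 0 < κ) (hκ : κ < 1) {L : ℝ} (hL : 1 ≤ L) :
    ∃ C : ℝ, 0 ≤ C ∧ ∀ u, stripMass κ L u ≤ ENNReal.ofReal (C * (1 + |u|) ^ (-κ)) := by
  obtain ⟨A, hA⟩ : ∃ A, A = ∫⁻ w in {w : ℝ | |w| ≤ 3 * L}, ENNReal.ofReal (|w| ^ (-κ)) := ⟨_, rfl⟩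
  have hAtop : A ≠ ⊤ := hA ▸ (lintegral_abs_rpow_lt_top hκ _).ne
  refine ⟨A.toReal * (1 + 2 * L) ^ κ + 2 * L * 4 ^ κ, by positivity, fun u => ?_⟩
  rw [stripMass, lintegral_indicator (measurableSet_strip L u)]
  have hu := abs_nonneg u
  rcases le_total |u| (2 * L) with h | h
  · have h1 : ∫⁻ w in {w : ℝ | |u + w| ≤ L}, ENNReal.ofReal (|w| ^ (-κ)) ≤ A := by
      rw [hA]
      refine lintegral_mono_set fun w hw => ?_
      rw [Set.mem_ofPred_eq] at hw ⊢
      have : w = (u + w) - u := by ring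
      rw [this]
      linarith [abs_sub (u + w) u]
    refine h1.trans ?_
    rw [← ENNReal.ofReal_toReal hAtop]
    apply ENNReal.ofReal_le_ofReal
    have h2 : 1 ≤ (1 + 2 * L) ^ κ * (1 + |u|) ^ (-κ) := by
      rw [Real.rpow_neg (by positivity), ← div_eq_mul_inv, one_le_div (by positivity)]
      exact Real.rpow_le_rpow (by positivity) (by linarith) hκ0.le
    calc A.toReal ≤ A.toReal * ((1 + 2 * L) ^ κ * (1 + |u|) ^ (-κ)) :=
          le_mul_of_one_le_right ENNReal.toReal_nonneg h2
      _ ≤ A.toReal * ((1 + 2 * L) ^ κ * (1 + |u|) ^ (-κ)) + 2 * L * 4 ^ κ * (1 + |u|) ^ (-κ) :=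
          le_add_of_nonneg_right (by positivity)
      _ = _ := by rw [ENNReal.toReal_ofReal ENNReal.toReal_nonneg]; ring
  · calc ∫⁻ w in {w : ℝ | |u + w| ≤ L}, ENNReal.ofReal (|w| ^ (-κ))
        ≤ ∫⁻ w in {w : ℝ | |u + w| ≤ L}, ENNReal.ofReal (4 ^ κ * (1 + |u|) ^ (-κ)) := by
          refine setLIntegral_mono measurable_const fun w hw => ?_
          apply ENNReal.ofReal_le_ofReal
          rw [Set.mem_ofPred_eq] at hw
          have h1 : |u| ≤ |u + w| + |w| := by
            have : u = (u + w) - w := by ring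
            conv_lhs => rw [this]
            exact abs_sub _ _
          have h2 : (1 + |u|) / 4 ≤ |w| := by linarith
          calc |w| ^ (-κ) ≤ ((1 + |u|) / 4) ^ (-κ) :=
                Real.rpow_le_rpow_of_nonpos (by positivity) h2 (by linarith)
            _ = 4 ^ κ * (1 + |u|) ^ (-κ) := by
                rw [Real.div_rpow (by positivity) (by norm_num), Real.rpow_neg (by norm_num : (0:ℝ) ≤ 4)]
                field_simp
      _ = ENNReal.ofReal (4 ^ κ * (1 + |u|) ^ (-κ)) * volume {w : ℝ | |u + w| ≤ L} :=
          setLIntegral_const _ _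
      _ = ENNReal.ofReal (4 ^ κ * (1 + |u|) ^ (-κ)) * ENNReal.ofReal (2 * L) := by
          congr 1
          have : {w : ℝ | |u + w| ≤ L} = Set.Icc (-L - u) (L - u) := by
            ext w
            rw [Set.mem_ofPred_eq, abs_le, Set.mem_Icc]
            constructor <;> rintro ⟨h1, h2⟩ <;> constructor <;> linarith
          rw [this, Real.volume_Icc]
          congr 1
          ring
      _ ≤ _ := by
          rw [← ENNReal.ofReal_mul (by positivity)]
          apply ENNReal.ofReal_le_ofReal
          have : 0 ≤ A.toReal * (1 + 2 * L) ^ κ * (1 + |u|) ^ (-κ) := by positivity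
          linarith

lemma stripMass_lt_top {κ : ℝ} (hκ0 : 0 < κ) (hκ : κ < 1) (L u : ℝ) : stripMass κ L u < ⊤ := by
  obtain ⟨C, -, hC⟩ := exists_stripMass_le hκ0 hκ (le_max_right L 1)
  refine lt_of_le_of_lt (lintegral_mono fun w => ?_) ((hC u).trans_lt ENNReal.ofReal_lt_top)
  exact Set.indicator_le_indicator_of_subset
    (fun w hw => le_trans hw (le_max_left L 1)) (fun _ => zero_le) w

/-- The strip masses are square integrable since `1/2 < κ < 1`. -/
lemma lintegral_stripMass_sq_lt_top {κ : ℝ} (hκ0 : 1 / 2 < κ) (hκ : κ < 1) {L : ℝ} (hL : 1 ≤ L) :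
    ∫⁻ u, stripMass κ L u ^ 2 < ⊤ := by
  obtain ⟨C, hC0, hC⟩ := exists_stripMass_le (by linarith) hκ hL
  have h := finite_integral_one_add_norm (E := ℝ) (μ := volume) (r := 2 * κ)
    (by simp; linarith)
  calc ∫⁻ u, stripMass κ L u ^ 2
      ≤ ∫⁻ u : ℝ, ENNReal.ofReal (C ^ 2) * ENNReal.ofReal ((1 + ‖u‖) ^ (-(2 * κ))) := by
        refine lintegral_mono fun u => ?_
        rw [← ENNReal.ofReal_mul (by positivity)]
        refine (pow_le_pow_left₀ zero_le (hC u) 2).trans (le_of_eq ?_)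
        rw [← ENNReal.ofReal_pow (by positivity), mul_pow, ← Real.rpow_natCast,
          ← Real.rpow_natCast ((1 + |u|) ^ (-κ)), ← Real.rpow_mul (by positivity), Real.norm_eq_abs]
        congr 3
        push_cast
        ring
    _ = ENNReal.ofReal (C ^ 2) * ∫⁻ u : ℝ, ENNReal.ofReal ((1 + ‖u‖) ^ (-(2 * κ))) :=
        lintegral_const_mul _ (by fun_prop)
    _ < ⊤ := ENNReal.mul_lt_top (by simp) h

lemma measurable_stripMass (κ L : ℝ) : Measurable (stripMass κ L) := by
  unfold stripMass
  refine Measurable.lintegral_prod_right' (f := fun p : ℝ × ℝ =>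
    {w : ℝ | |p.1 + w| ≤ L}.indicator (fun w => ENNReal.ofReal (|w| ^ (-κ))) p.2) ?_
  have : (fun p : ℝ × ℝ => {w : ℝ | |p.1 + w| ≤ L}.indicator
      (fun w => ENNReal.ofReal (|w| ^ (-κ))) p.2)
      = {p : ℝ × ℝ | |p.1 + p.2| ≤ L}.indicator fun p => ENNReal.ofReal (|p.2| ^ (-κ)) := by
    ext p
    simp only [Set.indicator, Set.mem_ofPred_eq]
  rw [this]
  exact Measurable.indicator (by fun_prop)
    (measurableSet_le (by fun_prop) measurable_const)

lemma measurable_gauge {q₁ q₂ : ℝ} : Measurable fun p : ℝ × ℝ => gauge q₁ q₂ p.1 p.2 := by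
  unfold gauge
  fun_prop

/-- The integral of the inverse gauge over a strip. -/
lemma lintegral_strip {q₁ q₂ : ℝ} (hq₂ : 0 < q₂) (L u : ℝ) :
    ∫⁻ p : ℝ × ℝ, {p : ℝ × ℝ | |u + p.1| ≤ L}.indicator
      (fun p => ENNReal.ofReal (gauge q₁ q₂ p.1 p.2)⁻¹) p
      = sectionMass q₂ * stripMass (q₁ - q₁ / q₂) L u := by
  have hms : MeasurableSet {p : ℝ × ℝ | |u + p.1| ≤ L} :=
    measurableSet_le (by fun_prop) measurable_const
  have hmg : Measurable fun p : ℝ × ℝ => ENNReal.ofReal (gauge q₁ q₂ p.1 p.2)⁻¹ :=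
    (measurable_gauge.inv).ennreal_ofReal
  rw [Measure.volume_eq_prod, lintegral_prod _ (hmg.indicator hms).aemeasurable, stripMass,
    ← lintegral_const_mul _ ((by fun_prop : Measurable fun w : ℝ =>
      ENNReal.ofReal (|w| ^ (-(q₁ - q₁ / q₂)))).indicator (measurableSet_strip L u))]
  refine lintegral_congr_ae ?_
  have h0 : ∀ᵐ w : ℝ, w ≠ 0 := by simp [ae_iff]
  filter_upwards [h0] with w hw
  by_cases h : |u + w| ≤ L
  · have h1 : ∀ z, {p : ℝ × ℝ | |u + p.1| ≤ L}.indicator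
        (fun p => ENNReal.ofReal (gauge q₁ q₂ p.1 p.2)⁻¹) (w, z)
        = ENNReal.ofReal (gauge q₁ q₂ w z)⁻¹ := fun z => Set.indicator_of_mem (by exact h) _
    simp_rw [h1]
    rw [lintegral_inv_gauge hq₂ hw, Set.indicator_of_mem (by exact h)]
  · have h1 : ∀ z, {p : ℝ × ℝ | |u + p.1| ≤ L}.indicator
        (fun p => ENNReal.ofReal (gauge q₁ q₂ p.1 p.2)⁻¹) (w, z) = 0 :=
      fun z => Set.indicator_of_notMem (by exact h) _
    simp_rw [h1]
    rw [Set.indicator_of_notMem (by exact h)]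
    simp

/-! ### Weighted square estimates over strips -/

/-- The inverse gauge restricted to the strip `|u + p₁| ≤ L`. -/
noncomputable def stripWeight (q₁ q₂ L u : ℝ) (p : ℝ × ℝ) : ℝ≥0∞ :=
  {p : ℝ × ℝ | |u + p.1| ≤ L}.indicator (fun p => ENNReal.ofReal (gauge q₁ q₂ p.1 p.2)⁻¹) p

lemma measurable_stripWeight (q₁ q₂ L : ℝ) :
    Measurable fun y : ℝ × ℝ × ℝ => stripWeight q₁ q₂ L y.1 y.2 := by
  have : (fun y : ℝ × ℝ × ℝ => stripWeight q₁ q₂ L y.1 y.2)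
      = {y : ℝ × ℝ × ℝ | |y.1 + y.2.1| ≤ L}.indicator
        fun y => ENNReal.ofReal (gauge q₁ q₂ y.2.1 y.2.2)⁻¹ := by
    ext y
    simp only [stripWeight, Set.indicator, Set.mem_ofPred_eq]
  rw [this]
  exact Measurable.indicator (measurable_gauge.comp measurable_snd).inv.ennreal_ofReal
    (measurableSet_le (by fun_prop) measurable_const)

lemma lintegral_mul_sq_le_weighted {α : Type*} [MeasurableSpace α] {μ : Measure α}
    {w f : α → ℝ≥0∞} (hw : Measurable w) (hf : Measurable f) :
    (∫⁻ a, w a * f a ∂μ) ^ 2 ≤ (∫⁻ a, w a ∂μ) * ∫⁻ a, w a * f a ^ 2 ∂μ := by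
  have h := lintegral_mul_sq_le (μ := μ.withDensity w) (f := fun _ => 1) (g := f)
    aemeasurable_const hf.aemeasurable
  simp only [one_mul, one_pow] at h
  rw [lintegral_withDensity_eq_lintegral_mul _ hw hf,
    lintegral_withDensity_eq_lintegral_mul _ hw measurable_const,
    lintegral_withDensity_eq_lintegral_mul _ hw (hf.pow_const 2)] at h
  simpa using h

section

variable {q₁ q₂ L : ℝ}

lemma lintegral_sq_stripWeight_le (hq₂ : 0 < q₂) {Φ : (ℝ × ℝ) × ℝ × ℝ → ℝ≥0∞}
    (hΦ : Measurable Φ) :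
    ∫⁻ u : ℝ × ℝ, (∫⁻ p, stripWeight q₁ q₂ L u.1 p * Φ (u, p)) ^ 2
      ≤ ∫⁻ y : ℝ × ℝ × ℝ, sectionMass q₂ * stripMass (q₁ - q₁ / q₂) L y.1 *
        stripWeight q₁ q₂ L y.1 y.2 * ∫⁻ v, Φ ((y.1, v), y.2) ^ 2 := by
  have hsw := measurable_stripWeight q₁ q₂ L
  have hJ : Measurable fun u : ℝ => sectionMass q₂ * stripMass (q₁ - q₁ / q₂) L u :=
    (measurable_stripMass _ _).const_mul _
  have hsw1 : ∀ u : ℝ, Measurable (stripWeight q₁ q₂ L u) := fun u =>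
    hsw.comp (measurable_const.prodMk measurable_id)
  have hin : Measurable fun y : ℝ × ℝ × ℝ => ∫⁻ v, Φ ((y.1, v), y.2) ^ 2 := by
    refine Measurable.lintegral_prod_right' (f := fun x : (ℝ × ℝ × ℝ) × ℝ =>
      Φ ((x.1.1, x.2), x.1.2) ^ 2) ?_
    exact (hΦ.comp (by fun_prop)).pow_const 2
  calc ∫⁻ u : ℝ × ℝ, (∫⁻ p, stripWeight q₁ q₂ L u.1 p * Φ (u, p)) ^ 2
      ≤ ∫⁻ u : ℝ × ℝ, sectionMass q₂ * stripMass (q₁ - q₁ / q₂) L u.1 *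
          ∫⁻ p, stripWeight q₁ q₂ L u.1 p * Φ (u, p) ^ 2 := by
        refine lintegral_mono fun u => ?_
        rw [← lintegral_strip hq₂]
        exact lintegral_mul_sq_le_weighted (hsw1 _) (hΦ.comp (by fun_prop))
    _ = ∫⁻ u₁ : ℝ, ∫⁻ u₂ : ℝ, sectionMass q₂ * stripMass (q₁ - q₁ / q₂) L u₁ *
          ∫⁻ p, stripWeight q₁ q₂ L u₁ p * Φ ((u₁, u₂), p) ^ 2 := by
        rw [Measure.volume_eq_prod, lintegral_prod]
        refine ((hJ.comp measurable_fst).mul ?_).aemeasurable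
        refine Measurable.lintegral_prod_right' (f := fun x : (ℝ × ℝ) × ℝ × ℝ =>
          stripWeight q₁ q₂ L x.1.1 x.2 * Φ (x.1, x.2) ^ 2) ?_
        exact (hsw.comp (by fun_prop : Measurable fun x : (ℝ × ℝ) × ℝ × ℝ => (x.1.1, x.2))).mul
          (hΦ.pow_const 2)
    _ = ∫⁻ u₁ : ℝ, ∫⁻ p, sectionMass q₂ * stripMass (q₁ - q₁ / q₂) L u₁ *
          stripWeight q₁ q₂ L u₁ p * ∫⁻ u₂, Φ ((u₁, u₂), p) ^ 2 := by
        refine lintegral_congr fun u₁ => ?_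
        have hm : Measurable fun x : ℝ × ℝ × ℝ =>
            stripWeight q₁ q₂ L u₁ x.2 * Φ ((u₁, x.1), x.2) ^ 2 :=
          ((hsw1 u₁).comp measurable_snd).mul ((hΦ.comp (by fun_prop)).pow_const 2)
        rw [lintegral_const_mul _ hm.lintegral_prod_right', lintegral_lintegral_swap hm.aemeasurable]
        simp_rw [mul_assoc]
        have hm2 : Measurable fun p : ℝ × ℝ =>
            stripWeight q₁ q₂ L u₁ p * ∫⁻ u₂, Φ ((u₁, u₂), p) ^ 2 :=
          (hsw1 u₁).mul (hin.comp (measurable_const.prodMk measurable_id))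
        have e : ∀ p : ℝ × ℝ, ∫⁻ x : ℝ, stripWeight q₁ q₂ L u₁ p * Φ ((u₁, x), p) ^ 2
            = stripWeight q₁ q₂ L u₁ p * ∫⁻ u₂, Φ ((u₁, u₂), p) ^ 2 := fun p =>
          lintegral_const_mul _ ((hΦ.comp (by fun_prop)).pow_const 2)
        simp_rw [e]
        rw [← lintegral_const_mul _ hm2, ← lintegral_const_mul _ (hm2.const_mul _)]
    _ = _ := by
        rw [Measure.volume_eq_prod ℝ (ℝ × ℝ), lintegral_prod]
        exact (((hJ.comp measurable_fst).mul hsw).mul hin).aemeasurable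

lemma lintegral_stripWeight_lt_top (hq₂ : 1 < q₂) (hκ0 : 1 / 2 < q₁ - q₁ / q₂)
    (hκ : q₁ - q₁ / q₂ < 1) (hL : 1 ≤ L) :
    ∫⁻ y : ℝ × ℝ × ℝ, sectionMass q₂ * stripMass (q₁ - q₁ / q₂) L y.1 *
        stripWeight q₁ q₂ L y.1 y.2 < ⊤ := by
  have hsw := measurable_stripWeight q₁ q₂ L
  have hJ : Measurable fun u : ℝ => sectionMass q₂ * stripMass (q₁ - q₁ / q₂) L u :=
    (measurable_stripMass _ _).const_mul _
  have h1 : ∀ u : ℝ, ∫⁻ p, sectionMass q₂ * stripMass (q₁ - q₁ / q₂) L u *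
      stripWeight q₁ q₂ L u p = sectionMass q₂ ^ 2 * stripMass (q₁ - q₁ / q₂) L u ^ 2 := by
    intro u
    have hsw1 : Measurable (stripWeight q₁ q₂ L u) :=
      hsw.comp (measurable_const.prodMk measurable_id)
    rw [lintegral_const_mul _ hsw1,
      show ∫⁻ p, stripWeight q₁ q₂ L u p = _ from lintegral_strip (by linarith) L u]
    ring
  have hJw : Measurable fun y : ℝ × ℝ × ℝ => sectionMass q₂ * stripMass (q₁ - q₁ / q₂) L y.1 *
      stripWeight q₁ q₂ L y.1 y.2 := (hJ.comp measurable_fst).mul hsw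
  rw [Measure.volume_eq_prod, lintegral_prod _ hJw.aemeasurable]
  simp only [h1]
  rw [lintegral_const_mul _ ((measurable_stripMass _ _).pow_const 2)]
  exact ENNReal.mul_lt_top (ENNReal.pow_lt_top (sectionMass_lt_top hq₂))
    (lintegral_stripMass_sq_lt_top hκ0 hκ hL)

/-- A uniform bound for the inner square integrals gives square integrability. -/
lemma lintegral_sq_stripWeight_lt_top (hq₂ : 1 < q₂) (hκ0 : 1 / 2 < q₁ - q₁ / q₂)
    (hκ : q₁ - q₁ / q₂ < 1) (hL : 1 ≤ L) {Φ : (ℝ × ℝ) × ℝ × ℝ → ℝ≥0∞} (hΦ : Measurable Φ)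
    {K : ℝ≥0∞} (hK : K ≠ ⊤) (hbound : ∀ (s : ℝ) p, ∫⁻ v, Φ ((s, v), p) ^ 2 ≤ K) :
    ∫⁻ u : ℝ × ℝ, (∫⁻ p, stripWeight q₁ q₂ L u.1 p * Φ (u, p)) ^ 2 < ⊤ := by
  refine (lintegral_sq_stripWeight_le (by linarith) hΦ).trans_lt ?_
  calc _ ≤ ∫⁻ y : ℝ × ℝ × ℝ, sectionMass q₂ * stripMass (q₁ - q₁ / q₂) L y.1 *
        stripWeight q₁ q₂ L y.1 y.2 * K := lintegral_mono fun y => by gcongr; exact hbound _ _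
    _ = (∫⁻ y : ℝ × ℝ × ℝ, sectionMass q₂ * stripMass (q₁ - q₁ / q₂) L y.1 *
        stripWeight q₁ q₂ L y.1 y.2) * K := lintegral_mul_const' _ _ hK
    _ < ⊤ := ENNReal.mul_lt_top (lintegral_stripWeight_lt_top hq₂ hκ0 hκ hL) hK.lt_top

/-- If the inner square integrals are bounded and tend to zero almost everywhere, then so does the
total. -/
lemma tendsto_lintegral_sq_stripWeight (hq₂ : 1 < q₂) (hκ0 : 1 / 2 < q₁ - q₁ / q₂)
    (hκ : q₁ - q₁ / q₂ < 1) (hL : 1 ≤ L) {ι : Type*} {l : Filter ι} [l.IsCountablyGenerated]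
    {Φ : ι → (ℝ × ℝ) × ℝ × ℝ → ℝ≥0∞} (hΦ : ∀ i, Measurable (Φ i))
    {K : ℝ≥0∞} (hK : K ≠ ⊤) (hbound : ∀ᶠ i in l, ∀ (s : ℝ) p, ∫⁻ v, Φ i ((s, v), p) ^ 2 ≤ K)
    (hlim : ∀ᵐ y : ℝ × ℝ × ℝ, Tendsto (fun i => ∫⁻ v, Φ i ((y.1, v), y.2) ^ 2) l (𝓝 0)) :
    Tendsto (fun i => ∫⁻ u : ℝ × ℝ, (∫⁻ p, stripWeight q₁ q₂ L u.1 p * Φ i (u, p)) ^ 2) l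
      (𝓝 0) := by
  have hsw := measurable_stripWeight q₁ q₂ L
  have hJ : Measurable fun u : ℝ => sectionMass q₂ * stripMass (q₁ - q₁ / q₂) L u :=
    (measurable_stripMass _ _).const_mul _
  refine tendsto_of_tendsto_of_tendsto_of_le_of_le tendsto_const_nhds ?_ (fun _ => zero_le)
    (fun i => lintegral_sq_stripWeight_le (by linarith) (hΦ i))
  have hfin := (lintegral_stripWeight_lt_top hq₂ hκ0 hκ hL)
  rw [← lintegral_zero (μ := (volume : Measure (ℝ × ℝ × ℝ)))]
  refine tendsto_lintegral_filter_of_dominated_convergence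
    (fun y : ℝ × ℝ × ℝ => sectionMass q₂ * stripMass (q₁ - q₁ / q₂) L y.1 *
        stripWeight q₁ q₂ L y.1 y.2 * K) (Eventually.of_forall fun i => ?_) ?_ ?_ ?_
  · refine ((hJ.comp measurable_fst).mul hsw).mul ?_
    refine Measurable.lintegral_prod_right' (f := fun x : (ℝ × ℝ × ℝ) × ℝ =>
      Φ i ((x.1.1, x.2), x.1.2) ^ 2) ?_
    exact ((hΦ i).comp (by fun_prop)).pow_const 2
  · filter_upwards [hbound] with i hi
    exact Eventually.of_forall fun y => by gcongr; exact hi _ _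
  · rw [lintegral_mul_const' _ _ hK]
    exact (ENNReal.mul_lt_top hfin hK.lt_top).ne
  · have hae := ae_lt_top ((hJ.comp measurable_fst).mul hsw) hfin.ne
    filter_upwards [hlim, hae] with y hy hy'
    simpa using ENNReal.Tendsto.const_mul hy (Or.inr hy'.ne)

end

/-! ### Convergence of rescaled lattice sums along a strip -/

/-- The indicator of the lattice interval `(0, m x]`. -/
noncomputable def cellInd (m x : ℝ) (k : ℤ) : ℝ := if 0 < k ∧ k ≤ ⌊m * x⌋ then 1 else 0

/-- The indicator of the interval `(0, x]`. -/
noncomputable def iocInd (x y : ℝ) : ℝ := if 0 < y ∧ y ≤ x then 1 else 0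

lemma cellInd_eq_zero_or_one (m x : ℝ) (k : ℤ) : cellInd m x k = 0 ∨ cellInd m x k = 1 := by
  unfold cellInd; split_ifs <;> simp

lemma iocInd_eq_zero_or_one (x y : ℝ) : iocInd x y = 0 ∨ iocInd x y = 1 := by
  unfold iocInd; split_ifs <;> simp

lemma measurable_iocInd (x : ℝ) : Measurable (iocInd x) := by
  unfold iocInd
  exact Measurable.ite ((measurableSet_lt measurable_const measurable_id).inter
    (measurableSet_le measurable_id measurable_const)) measurable_const measurable_const

lemma cellInd_add_ceil {m : ℝ} (hm : 0 < m) (x : ℝ) (i : ℤ) (u : ℝ) :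
    cellInd m x (i + ⌈m * u⌉) = (Set.Ioc (-(i : ℝ) / m) ((⌊m * x⌋ - i) / m)).indicator 1 u := by
  have h : (0 < i + ⌈m * u⌉ ∧ i + ⌈m * u⌉ ≤ ⌊m * x⌋)
      ↔ u ∈ Set.Ioc (-(i : ℝ) / m) ((⌊m * x⌋ - i) / m) := by
    rw [Set.mem_Ioc, div_lt_iff₀ hm, le_div_iff₀ hm, ← neg_lt_iff_pos_add', Int.lt_ceil,
      ← le_sub_iff_add_le', Int.ceil_le]
    push_cast
    rw [mul_comm u m]
  unfold cellInd
  by_cases h' : u ∈ Set.Ioc (-(i : ℝ) / m) ((⌊m * x⌋ - i) / m)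
  · rw [if_pos (h.2 h'), Set.indicator_of_mem h', Pi.one_apply]
  · rw [if_neg (fun h'' => h' (h.1 h'')), Set.indicator_of_notMem h']

lemma lintegral_enorm_cellInd_le {m x : ℝ} (hm : 0 < m) (i : ℤ) :
    ∫⁻ u : ℝ, ‖cellInd m x (i + ⌈m * u⌉)‖ₑ ≤ ENNReal.ofReal x := by
  have h : ∀ u : ℝ, ‖cellInd m x (i + ⌈m * u⌉)‖ₑ
      = (Set.Ioc (-(i : ℝ) / m) ((⌊m * x⌋ - i) / m)).indicator 1 u := by
    intro u
    rw [cellInd_add_ceil hm, enorm_indicator_eq_indicator_enorm]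
    simp [Set.indicator]
  simp_rw [h]
  rw [lintegral_indicator_one measurableSet_Ioc, Real.volume_Ioc]
  apply ENNReal.ofReal_le_ofReal
  rw [← sub_div, div_le_iff₀ hm]
  linarith [Int.floor_le (m * x)]

lemma lintegral_enorm_iocInd {x : ℝ} (s : ℝ) :
    ∫⁻ u : ℝ, ‖iocInd x (u + s)‖ₑ = ENNReal.ofReal x := by
  rw [lintegral_add_right_eq_self (μ := volume) (fun u => ‖iocInd x u‖ₑ) s]
  have h : ∀ u : ℝ, ‖iocInd x u‖ₑ = (Set.Ioc 0 x).indicator 1 u := by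
    intro u
    unfold iocInd
    by_cases hu : u ∈ Set.Ioc 0 x
    · rw [if_pos (by exact hu), Set.indicator_of_mem hu]; simp
    · rw [if_neg (by exact hu), Set.indicator_of_notMem hu]; simp
  simp_rw [h]
  rw [lintegral_indicator_one measurableSet_Ioc, Real.volume_Ioc, sub_zero]

lemma bounds_of_cellInd_ne_zero {m x : ℝ} (hm : 0 < m) {i : ℤ} {u : ℝ}
    (h : cellInd m x (i + ⌈m * u⌉) ≠ 0) : -((i : ℝ) / m) < u ∧ u ≤ x - (i : ℝ) / m := by
  rw [cellInd_add_ceil hm] at h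
  have h1 := Set.mem_of_indicator_ne_zero h
  rw [Set.mem_Ioc] at h1
  refine ⟨by rw [← neg_div]; exact h1.1, h1.2.trans ?_⟩
  rw [div_le_iff₀ hm, sub_mul, div_mul_cancel₀ _ hm.ne']
  linarith [Int.floor_le (m * x)]

lemma tendsto_div_of_abs_sub_le {m y : ℝ → ℝ} {i : ℝ → ℤ} {s : ℝ} (hm : Tendsto m atTop atTop)
    (hi : ∀ l, |(i l : ℝ) - y l| ≤ 2) (hy : Tendsto (fun l => y l / m l) atTop (𝓝 s)) :
    Tendsto (fun l => (i l : ℝ) / m l) atTop (𝓝 s) := by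
  have h1 : Tendsto (fun l => ((i l : ℝ) - y l) / m l) atTop (𝓝 0) := by
    refine squeeze_zero_norm' ?_ ((tendsto_const_nhds (x := (2 : ℝ))).div_atTop hm)
    filter_upwards [hm.eventually_gt_atTop 0] with l hl
    rw [Real.norm_eq_abs, abs_div, abs_of_pos hl]
    gcongr
    exact hi l
  have := h1.add hy
  rw [zero_add] at this
  refine this.congr fun l => ?_
  rw [← add_div, sub_add_cancel]

lemma tendsto_floor_div {m : ℝ → ℝ} (hm : Tendsto m atTop atTop) (x : ℝ) :
    Tendsto (fun l => (⌊m l * x⌋ : ℝ) / m l) atTop (𝓝 x) := by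
  refine tendsto_div_of_abs_sub_le (y := fun l => m l * x) hm (fun l => ?_) ?_
  · rw [abs_sub_comm, abs_le]
    constructor <;> linarith [Int.floor_le (m l * x), Int.lt_floor_add_one (m l * x)]
  · refine tendsto_const_nhds.congr' ?_
    filter_upwards [hm.eventually_gt_atTop 0] with l hl
    rw [mul_div_cancel_left₀ _ hl.ne']

lemma tendsto_cellInd {m : ℝ → ℝ} {i : ℝ → ℤ} {s x u : ℝ} (hm : Tendsto m atTop atTop)
    (hi : Tendsto (fun l => (i l : ℝ) / m l) atTop (𝓝 s)) (h0 : u + s ≠ 0) (hx : u + s ≠ x) :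
    Tendsto (fun l => cellInd (m l) x (i l + ⌈m l * u⌉)) atTop (𝓝 (iocInd x (u + s))) := by
  have hfl := (tendsto_floor_div hm x).sub hi
  have hi' := hi.neg
  refine tendsto_const_nhds.congr' ?_
  have e1 : ∀ᶠ l in atTop, (-((i l : ℝ) / m l) < u ↔ 0 < u + s) := by
    rcases lt_or_gt_of_ne h0 with h | h
    · filter_upwards [hi'.eventually_const_lt (u := u) (by linarith)] with l hl
      exact ⟨fun h' => absurd h' (not_lt.2 hl.le), fun h' => absurd h' (not_lt.2 h.le)⟩
    · filter_upwards [hi'.eventually_lt_const (u := u) (by linarith)] with l hl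
      exact ⟨fun _ => h, fun _ => hl⟩
  have e2 : ∀ᶠ l in atTop, (u ≤ (⌊m l * x⌋ : ℝ) / m l - (i l : ℝ) / m l ↔ u + s ≤ x) := by
    rcases lt_or_gt_of_ne hx with h | h
    · filter_upwards [hfl.eventually_const_lt (u := u) (by linarith)] with l hl
      exact ⟨fun _ => h.le, fun _ => hl.le⟩
    · filter_upwards [hfl.eventually_lt_const (u := u) (by linarith)] with l hl
      exact ⟨fun h' => absurd h' (not_le.2 hl), fun h' => absurd h' (not_le.2 h)⟩
  filter_upwards [e1, e2, hm.eventually_gt_atTop 0] with l h1 h2 hl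
  rw [cellInd_add_ceil hl]
  unfold iocInd
  by_cases h : 0 < u + s ∧ u + s ≤ x
  · rw [if_pos h, Set.indicator_of_mem, Pi.one_apply]
    rw [Set.mem_Ioc, neg_div, sub_div]
    exact ⟨h1.2 h.1, h2.2 h.2⟩
  · rw [if_neg h, Set.indicator_of_notMem]
    rw [Set.mem_Ioc, neg_div, sub_div]
    exact fun h' => h ⟨h1.1 h'.1, h2.1 h'.2⟩

section Strip

variable {q₁ q₂ : ℝ} {a : ℝ → ℝ → ℝ} {c₁₁ c₁₂ c₂₁ c₂₂ : ℝ} {β : ℤ → ℤ → ℝ}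

/-- The rescaled lattice sum is the integral of rescaled coefficients over the plane, read in the
coordinates adapted to the kernel. -/
lemma rescaled_boxSum_eq_integral (e : ℝ) {m₁ m₂ : ℝ} (hm₁ : 0 < m₁) (x₁ x₂ : ℝ) (s₁ s₂ : ℤ) :
    m₁ ^ (q₁ - q₁ / q₂ - 1) * boxSum β (m₁ * x₁) (m₂ * x₂) s₁ s₂
      = ∫ p : ℝ × ℝ, m₁ ^ q₁ * β ⌈m₁ * p.1⌉ ⌈e * m₁ * p.1 + m₁ ^ (q₁ / q₂) * p.2⌉ *
        (cellInd m₁ x₁ (⌈m₁ * p.1⌉ + s₁) *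
          cellInd m₂ x₂ (⌈e * m₁ * p.1 + m₁ ^ (q₁ / q₂) * p.2⌉ + s₂)) := by
  have hζ : 0 < m₁ ^ (q₁ / q₂) := by positivity
  have hinj : Function.Injective fun t : ℤ × ℤ => (t.1 - s₁, t.2 - s₂) := by
    rintro ⟨a, b⟩ ⟨c, d⟩ h
    simp only [Prod.mk.injEq, sub_left_inj] at h
    exact Prod.ext h.1 h.2
  have h := integral_comp_ceil_prod (e * m₁) hm₁ hζ
    (fun r => m₁ ^ q₁ * β r.1 r.2 * (cellInd m₁ x₁ (r.1 + s₁) * cellInd m₂ x₂ (r.2 + s₂)))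
    ((Finset.Ioc (0 : ℤ) ⌊m₁ * x₁⌋ ×ˢ Finset.Ioc (0 : ℤ) ⌊m₂ * x₂⌋).image
      fun t => (t.1 - s₁, t.2 - s₂)) (by
      rintro ⟨r₁, r₂⟩ hr
      by_contra hne
      apply hr
      have h1 : cellInd m₁ x₁ (r₁ + s₁) ≠ 0 := by
        intro h; simp [h] at hne
      have h2 : cellInd m₂ x₂ (r₂ + s₂) ≠ 0 := by
        intro h; simp [h] at hne
      unfold cellInd at h1 h2
      simp only [ne_eq, ite_eq_right_iff, one_ne_zero, imp_false, not_not] at h1 h2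
      exact Finset.mem_image.2 ⟨(r₁ + s₁, r₂ + s₂), Finset.mem_product.2
        ⟨Finset.mem_Ioc.2 h1, Finset.mem_Ioc.2 h2⟩, by simp⟩)
  rw [h, Finset.sum_image fun _ _ _ _ h => hinj h, boxSum, ← Finset.sum_product',
    Finset.mul_sum, Finset.mul_sum]
  refine Finset.sum_congr rfl fun t ht => ?_
  rw [Finset.mem_product, Finset.mem_Ioc, Finset.mem_Ioc] at ht
  simp only [sub_add_cancel]
  have h1 : cellInd m₁ x₁ t.1 = 1 := if_pos ht.1
  have h2 : cellInd m₂ x₂ t.2 = 1 := if_pos ht.2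
  rw [h1, h2, Real.rpow_sub hm₁, Real.rpow_sub hm₁, Real.rpow_one]
  field_simp

/-- The limit of rescaled lattice sums: the integral of the kernel over a parallelogram. -/
noncomputable def stripKernel (a : ℝ → ℝ → ℝ) (α δ e₁ e₂ x₁ x₂ : ℝ) (u : ℝ × ℝ) : ℝ :=
  ∫ p : ℝ × ℝ, a (α * p.1) (δ * p.2) *
    (iocInd x₁ (u.1 + p.1) * iocInd x₂ (u.2 + (-(e₁ * p.1) + e₂ * p.2)))

lemma IsAnisotropicKernel.exists_abs_comp_mul_gauge_le (ha : IsAnisotropicKernel q₁ q₂ a)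
    {α δ : ℝ} (hα : α ≠ 0) (hδ : δ ≠ 0) :
    ∃ C, 0 < C ∧ ∀ w z, |a (α * w) (δ * z)| * gauge q₁ q₂ w z ≤ C := by
  obtain ⟨C, hC⟩ := ha.bound
  have h1 : 0 < |α| ^ q₁ := Real.rpow_pos_of_pos (abs_pos.2 hα) _
  have h2 : 0 < |δ| ^ q₂ := Real.rpow_pos_of_pos (abs_pos.2 hδ) _
  have hC0 : 0 ≤ C := (mul_nonneg (abs_nonneg _) (gauge_nonneg _ _ _ _)).trans (hC 0 0)
  refine ⟨((|α| ^ q₁)⁻¹ + (|δ| ^ q₂)⁻¹) * (C + 1), by positivity, fun w z => ?_⟩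
  have hg : gauge q₁ q₂ w z
      ≤ ((|α| ^ q₁)⁻¹ + (|δ| ^ q₂)⁻¹) * gauge q₁ q₂ (α * w) (δ * z) := by
    have h3 : (|α| ^ q₁)⁻¹ * |α * w| ^ q₁ = |w| ^ q₁ := by
      rw [abs_mul, Real.mul_rpow (abs_nonneg _) (abs_nonneg _), inv_mul_cancel_left₀ h1.ne']
    have h4 : (|δ| ^ q₂)⁻¹ * |δ * z| ^ q₂ = |z| ^ q₂ := by
      rw [abs_mul, Real.mul_rpow (abs_nonneg _) (abs_nonneg _), inv_mul_cancel_left₀ h2.ne']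
    have h5 : 0 ≤ (|δ| ^ q₂)⁻¹ * |α * w| ^ q₁ := by positivity
    have h6 : 0 ≤ (|α| ^ q₁)⁻¹ * |δ * z| ^ q₂ := by positivity
    unfold gauge
    rw [add_mul, mul_add, mul_add, h3, h4]
    linarith
  calc |a (α * w) (δ * z)| * gauge q₁ q₂ w z
      ≤ |a (α * w) (δ * z)| *
        (((|α| ^ q₁)⁻¹ + (|δ| ^ q₂)⁻¹) * gauge q₁ q₂ (α * w) (δ * z)) := by gcongr
    _ = ((|α| ^ q₁)⁻¹ + (|δ| ^ q₂)⁻¹) *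
        (|a (α * w) (δ * z)| * gauge q₁ q₂ (α * w) (δ * z)) := by ring
    _ ≤ _ := by
        gcongr
        linarith [hC (α * w) (δ * z)]

lemma lintegral_stripWeight_section_lt_top (hq₂ : 1 < q₂) (hκ0 : 0 < q₁ - q₁ / q₂)
    (hκ : q₁ - q₁ / q₂ < 1) (L u : ℝ) : ∫⁻ p, stripWeight q₁ q₂ L u p < ⊤ := by
  rw [show ∫⁻ p, stripWeight q₁ q₂ L u p = _ from lintegral_strip (by linarith) L u]
  exact ENNReal.mul_lt_top (sectionMass_lt_top hq₂) (stripMass_lt_top hκ0 hκ _ _)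

lemma ae_fst_ne_zero : ∀ᵐ p : ℝ × ℝ, p.1 ≠ 0 := by
  have : ∀ᵐ w : ℝ, w ≠ 0 := by simp [ae_iff]
  exact Measure.quasiMeasurePreserving_fst.ae this

/-- A function supported in a strip is the product of the weight and of its product with the
gauge. -/
lemma enorm_eq_stripWeight_mul {L u : ℝ} {p : ℝ × ℝ} (hp : p.1 ≠ 0) {r : ℝ}
    (hr : r ≠ 0 → |u + p.1| ≤ L) :
    ‖r‖ₑ = stripWeight q₁ q₂ L u p * ‖gauge q₁ q₂ p.1 p.2 * r‖ₑ := by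
  by_cases h : r = 0
  · simp [h]
  · have hg : 0 < gauge q₁ q₂ p.1 p.2 := gauge_pos (Or.inl hp)
    rw [stripWeight, Set.indicator_of_mem (by exact hr h), enorm_mul, ← mul_assoc,
      Real.enorm_of_nonneg hg.le, ← ENNReal.ofReal_mul (by positivity), inv_mul_cancel₀ hg.ne',
      ENNReal.ofReal_one, one_mul]

/-- Integrability over the plane of functions supported in a strip and bounded by the inverse
gauge. -/
lemma integrable_of_strip (hq₂ : 1 < q₂) (hκ0 : 0 < q₁ - q₁ / q₂) (hκ : q₁ - q₁ / q₂ < 1)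
    {L u C : ℝ} {f : ℝ × ℝ → ℝ} (hf : AEStronglyMeasurable f)
    (hsupp : ∀ p, f p ≠ 0 → |u + p.1| ≤ L) (hb : ∀ p, |f p| * gauge q₁ q₂ p.1 p.2 ≤ C) :
    Integrable f := by
  refine ⟨hf, ?_⟩
  rw [HasFiniteIntegral]
  calc ∫⁻ p, ‖f p‖ₑ ≤ ∫⁻ p, stripWeight q₁ q₂ L u p * ENNReal.ofReal C := by
        refine lintegral_mono_ae ?_
        filter_upwards [ae_fst_ne_zero] with p hp
        rw [enorm_eq_stripWeight_mul (q₁ := q₁) (q₂ := q₂) hp (hsupp p)]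
        gcongr
        rw [Real.enorm_eq_ofReal_abs, abs_mul, abs_of_nonneg (gauge_nonneg _ _ _ _), mul_comm]
        exact ENNReal.ofReal_le_ofReal (hb p)
    _ = (∫⁻ p, stripWeight q₁ q₂ L u p) * ENNReal.ofReal C :=
        lintegral_mul_const' _ _ ENNReal.ofReal_ne_top
    _ < ⊤ := ENNReal.mul_lt_top (lintegral_stripWeight_section_lt_top hq₂ hκ0 hκ _ _)
        ENNReal.ofReal_lt_top

lemma abs_mul_le_of_zero_or_one {x y : ℝ} (hy : y = 0 ∨ y = 1) : |x * y| ≤ |x| := by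
  rcases hy with h | h <;> simp [h]

lemma measurable_stripKernel_integrand (ha : IsAnisotropicKernel q₁ q₂ a) (α δ e₁ e₂ x₁ x₂ : ℝ) :
    Measurable fun x : (ℝ × ℝ) × ℝ × ℝ => a (α * x.2.1) (δ * x.2.2) *
      (iocInd x₁ (x.1.1 + x.2.1) * iocInd x₂ (x.1.2 + (-(e₁ * x.2.1) + e₂ * x.2.2))) := by
  have h1 : Measurable fun x : (ℝ × ℝ) × ℝ × ℝ => a (α * x.2.1) (δ * x.2.2) :=
    ha.measurable.comp (by fun_prop : Measurable fun x : (ℝ × ℝ) × ℝ × ℝ =>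
      (α * x.2.1, δ * x.2.2))
  exact h1.mul (((measurable_iocInd x₁).comp (by fun_prop)).mul
    ((measurable_iocInd x₂).comp (by fun_prop)))

lemma iocInd_support {x y : ℝ} (h : iocInd x y ≠ 0) : 0 < y ∧ y ≤ x := by
  unfold iocInd at h
  by_contra h'
  exact h (if_neg h')

lemma integrable_stripKernel_integrand (ha : IsAnisotropicKernel q₁ q₂ a) (hq₂ : 1 < q₂)
    (hκ0 : 0 < q₁ - q₁ / q₂) (hκ : q₁ - q₁ / q₂ < 1) {α δ : ℝ} (hα : α ≠ 0) (hδ : δ ≠ 0)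
    (e₁ e₂ x₁ x₂ : ℝ) (u : ℝ × ℝ) :
    Integrable fun p : ℝ × ℝ => a (α * p.1) (δ * p.2) *
      (iocInd x₁ (u.1 + p.1) * iocInd x₂ (u.2 + (-(e₁ * p.1) + e₂ * p.2))) := by
  obtain ⟨C, -, hC⟩ := ha.exists_abs_comp_mul_gauge_le hα hδ
  refine integrable_of_strip (q₁ := q₁) (q₂ := q₂) hq₂ hκ0 hκ (L := x₁) (u := u.1) (C := C)
    ?_ (fun p hp => ?_) fun p => ?_
  · exact ((measurable_stripKernel_integrand ha α δ e₁ e₂ x₁ x₂).comp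
      (measurable_const.prodMk measurable_id : Measurable fun p : ℝ × ℝ => (u, p))).aestronglyMeasurable
  · have h := iocInd_support (left_ne_zero_of_mul (right_ne_zero_of_mul hp))
    rw [abs_of_pos h.1]
    exact h.2
  · refine le_trans ?_ (hC p.1 p.2)
    refine mul_le_mul_of_nonneg_right ?_ (gauge_nonneg _ _ _ _)
    rw [← mul_assoc]
    exact (abs_mul_le_of_zero_or_one (iocInd_eq_zero_or_one _ _)).trans
      (abs_mul_le_of_zero_or_one (iocInd_eq_zero_or_one _ _))

lemma measurable_stripKernel (ha : IsAnisotropicKernel q₁ q₂ a) (α δ e₁ e₂ x₁ x₂ : ℝ) :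
    Measurable (stripKernel a α δ e₁ e₂ x₁ x₂) :=
  (measurable_stripKernel_integrand ha α δ e₁ e₂ x₁ x₂).stronglyMeasurable.integral_prod_right'
    |>.measurable

lemma memLp_two_of_lintegral_sq_lt_top {α : Type*} [MeasurableSpace α] {μ : Measure α} {f : α → ℝ}
    (hf : AEStronglyMeasurable f μ) (h : ∫⁻ u, ‖f u‖ₑ ^ 2 ∂μ < ⊤) : MemLp f 2 μ := by
  refine ⟨hf, ?_⟩
  rw [← eLpNorm_two_sq] at h
  by_contra hcon
  rw [not_lt, top_le_iff] at hcon
  rw [hcon] at h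
  simp at h

/-- The kernels of the limit fields are square integrable. -/
lemma memLp_stripKernel (ha : IsAnisotropicKernel q₁ q₂ a) (hq₂ : 1 < q₂)
    (hκ0 : 1 / 2 < q₁ - q₁ / q₂) (hκ : q₁ - q₁ / q₂ < 1) {α δ : ℝ} (hα : α ≠ 0) (hδ : δ ≠ 0)
    (e₁ e₂ x₁ x₂ : ℝ) :
    MemLp (stripKernel a α δ e₁ e₂ x₁ x₂) 2 := by
  obtain ⟨C, -, hC⟩ := ha.exists_abs_comp_mul_gauge_le hα hδ
  have hsq := lintegral_sq_stripWeight_lt_top (q₁ := q₁) (L := max x₁ 1) hq₂ hκ0 hκ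
    (le_max_right _ _)
    (Φ := fun x => ‖gauge q₁ q₂ x.2.1 x.2.2 * (a (α * x.2.1) (δ * x.2.2) *
      (iocInd x₁ (x.1.1 + x.2.1) * iocInd x₂ (x.1.2 + (-(e₁ * x.2.1) + e₂ * x.2.2))))‖ₑ)
    (((measurable_gauge.comp measurable_snd).mul
      (measurable_stripKernel_integrand ha α δ e₁ e₂ x₁ x₂)).enorm)
    (K := ENNReal.ofReal C ^ 2 * ENNReal.ofReal x₂) (by finiteness) (by
      intro s p
      rw [← lintegral_enorm_iocInd (x := x₂) (-(e₁ * p.1) + e₂ * p.2),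
        ← lintegral_const_mul' _ _ (by finiteness)]
      refine lintegral_mono fun v => ?_
      have hp := hC p.1 p.2
      rcases iocInd_eq_zero_or_one x₂ (v + (-(e₁ * p.1) + e₂ * p.2)) with h | h
      · simp [h]
      · simp only [h, mul_one, enorm_one]
        gcongr
        rw [Real.enorm_eq_ofReal_abs, ← mul_assoc]
        apply ENNReal.ofReal_le_ofReal
        refine (abs_mul_le_of_zero_or_one (iocInd_eq_zero_or_one _ _)).trans ?_
        rwa [abs_mul, abs_of_nonneg (gauge_nonneg _ _ _ _), mul_comm])
  have h2 : ∫⁻ u, ‖stripKernel a α δ e₁ e₂ x₁ x₂ u‖ₑ ^ 2 < ⊤ := by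
    refine lt_of_le_of_lt (lintegral_mono fun u => ?_) hsq
    gcongr
    refine (enorm_integral_le_lintegral_enorm _).trans (lintegral_mono_ae ?_)
    filter_upwards [ae_fst_ne_zero] with p hp
    rw [enorm_eq_stripWeight_mul (q₁ := q₁) (q₂ := q₂) (L := max x₁ 1) (u := u.1) hp]
    intro hne
    have h := iocInd_support (left_ne_zero_of_mul (right_ne_zero_of_mul hne))
    rw [abs_of_pos h.1]
    exact h.2.trans (le_max_left _ _)
  exact memLp_two_of_lintegral_sq_lt_top
    (measurable_stripKernel ha α δ e₁ e₂ x₁ x₂).aestronglyMeasurable h2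

end Strip

section Strip

variable {q₁ q₂ : ℝ} {a : ℝ → ℝ → ℝ} {c₁₁ c₁₂ c₂₁ c₂₂ : ℝ} {β : ℤ → ℤ → ℝ}

lemma abs_ceil_sub_le (y : ℝ) : |(⌈y⌉ : ℝ) - y| ≤ 2 := by
  rw [abs_le]
  constructor <;> linarith [Int.le_ceil y, Int.ceil_lt_add_one y]

lemma measurable_cellInd_add_ceil {α : Type*} [MeasurableSpace α] (m x : ℝ) {i k : α → ℤ}
    (hi : Measurable i) (hk : Measurable k) : Measurable fun y => cellInd m x (i y + k y) :=
  (Measurable.of_discrete (f := fun r : ℤ × ℤ => cellInd m x (r.1 + r.2))).comp (hi.prodMk hk)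

/-- Rescaled sums of the coefficients over growing rectangles converge in mean square to the
integral of the kernel over a parallelogram. The numbers `e₁` and `e₂` record how the oblique
coordinate system adapted to the kernel is seen on the scale of the rectangle. -/
theorem tendsto_rescaled_boxSum (hβ : IsLatticeKernel q₁ q₂ a c₁₁ c₁₂ c₂₁ c₂₂ β)
    (ha : IsAnisotropicKernel q₁ q₂ a) (hq₁ : 0 < q₁) (hq : q₁ < q₂) (hq₂ : 1 < q₂)
    (hκ0 : 1 / 2 < q₁ - q₁ / q₂) (hκ : q₁ - q₁ / q₂ < 1)
    (hdet : c₁₁ * c₂₂ - c₁₂ * c₂₁ ≠ 0) (h₂₂ : c₂₂ ≠ 0) {m₁ m₂ : ℝ → ℝ}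
    (hm₁ : Tendsto m₁ atTop atTop) (hm₂ : Tendsto m₂ atTop atTop) {e₁ e₂ : ℝ}
    (he₁ : Tendsto (fun l => c₂₁ / c₂₂ * (m₁ l / m₂ l)) atTop (𝓝 e₁))
    (he₂ : Tendsto (fun l => m₁ l ^ (q₁ / q₂) / m₂ l) atTop (𝓝 e₂)) {x₁ x₂ : ℝ} :
    Tendsto (fun l => ∫⁻ u : ℝ × ℝ, ‖m₁ l ^ (q₁ - q₁ / q₂ - 1) *
      boxSum β (m₁ l * x₁) (m₂ l * x₂) ⌈m₁ l * u.1⌉ ⌈m₂ l * u.2⌉ -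
      stripKernel a ((c₁₁ * c₂₂ - c₁₂ * c₂₁) / c₂₂) c₂₂ e₁ e₂ x₁ x₂ u‖ₑ ^ 2) atTop (𝓝 0) := by
  have hα : (c₁₁ * c₂₂ - c₁₂ * c₂₁) / c₂₂ ≠ 0 := div_ne_zero hdet h₂₂
  obtain ⟨Ca, hCa0, hCa⟩ := ha.exists_abs_comp_mul_gauge_le hα h₂₂
  obtain ⟨Cb, hCb0, hCb⟩ := hβ.rescaled_bound hq₁ hq hdet h₂₂
  have hconv : ∀ p : ℝ × ℝ, p.1 ≠ 0 → _ := fun p hp =>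
    hβ.rescaled_tendsto ha hq₁ hq hdet h₂₂ hm₁ (w := p.1) (z := p.2) hp
      (r₁ := fun l => ⌈m₁ l * p.1⌉)
      (r₂ := fun l => ⌈-(c₂₁ / c₂₂) * m₁ l * p.1 + m₁ l ^ (q₁ / q₂) * p.2⌉)
      (fun l => abs_ceil_sub_le _) (fun l => by rw [← mul_assoc]; exact abs_ceil_sub_le _)
  generalize (c₁₁ * c₂₂ - c₁₂ * c₂₁) / c₂₂ = α at *
  obtain ⟨i, hi⟩ : ∃ i : ℝ → ℝ × ℝ → ℤ, i = fun l p => ⌈m₁ l * p.1⌉ := ⟨_, rfl⟩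
  obtain ⟨j, hj⟩ : ∃ j : ℝ → ℝ × ℝ → ℤ,
    j = fun l p => ⌈-(c₂₁ / c₂₂) * m₁ l * p.1 + m₁ l ^ (q₁ / q₂) * p.2⌉ := ⟨_, rfl⟩
  have hmi : ∀ l, Measurable (i l) := fun l => by rw [hi]; fun_prop
  have hmj : ∀ l, Measurable (j l) := fun l => by rw [hj]; fun_prop
  obtain ⟨R, hR⟩ : ∃ R : ℝ → ℝ × ℝ → ℝ, R = fun l p => m₁ l ^ q₁ * β (i l p) (j l p) := ⟨_, rfl⟩
  obtain ⟨f, hf⟩ : ∃ f : ℝ → (ℝ × ℝ) × ℝ × ℝ → ℝ, f = fun l x => R l x.2 *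
    (cellInd (m₁ l) x₁ (i l x.2 + ⌈m₁ l * x.1.1⌉) *
      cellInd (m₂ l) x₂ (j l x.2 + ⌈m₂ l * x.1.2⌉)) := ⟨_, rfl⟩
  obtain ⟨g, hg⟩ : ∃ g : (ℝ × ℝ) × ℝ × ℝ → ℝ, g = fun x => a (α * x.2.1) (c₂₂ * x.2.2) *
    (iocInd x₁ (x.1.1 + x.2.1) * iocInd x₂ (x.1.2 + (-(e₁ * x.2.1) + e₂ * x.2.2))) := ⟨_, rfl⟩
  have hmf : ∀ l, Measurable (f l) := by
    intro l
    have h1 : Measurable (R l) := by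
      rw [hR]
      exact ((Measurable.of_discrete (f := fun r : ℤ × ℤ => β r.1 r.2)).comp
        ((hmi l).prodMk (hmj l))).const_mul _
    rw [hf]
    exact (h1.comp measurable_snd).mul
      ((measurable_cellInd_add_ceil _ _ ((hmi l).comp measurable_snd) (by fun_prop)).mul
      (measurable_cellInd_add_ceil _ _ ((hmj l).comp measurable_snd) (by fun_prop)))
  have hmg : Measurable g := by
    rw [hg]; exact measurable_stripKernel_integrand ha α c₂₂ e₁ e₂ x₁ x₂
  -- bounds by the inverse gauge
  have hfb0 : ∀ᶠ l in atTop, ∀ x, |R l x| * gauge q₁ q₂ x.1 x.2 ≤ Cb := by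
    filter_upwards [hm₁.eventually_gt_atTop 0] with l hl p
    have h := hCb (m₁ l) hl p.1 p.2 (i l p) (j l p) (by rw [hi]; exact abs_ceil_sub_le _)
      (by rw [hj, ← mul_assoc]; exact abs_ceil_sub_le _)
    rw [hR]
    simp only
    rwa [abs_mul, abs_of_nonneg (by positivity)]
  have hfb : ∀ᶠ l in atTop, ∀ x, |f l x| * gauge q₁ q₂ x.2.1 x.2.2 ≤ Cb := by
    filter_upwards [hfb0] with l hl x
    refine le_trans (mul_le_mul_of_nonneg_right ?_ (gauge_nonneg _ _ _ _)) (hl x.2)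
    rw [hf]
    simp only
    rw [← mul_assoc]
    exact (abs_mul_le_of_zero_or_one (cellInd_eq_zero_or_one _ _ _)).trans
      (abs_mul_le_of_zero_or_one (cellInd_eq_zero_or_one _ _ _))
  have hgb : ∀ x, |g x| * gauge q₁ q₂ x.2.1 x.2.2 ≤ Ca := by
    intro x
    refine le_trans (mul_le_mul_of_nonneg_right ?_ (gauge_nonneg _ _ _ _)) (hCa x.2.1 x.2.2)
    rw [hg]
    simp only
    rw [← mul_assoc]
    exact (abs_mul_le_of_zero_or_one (iocInd_eq_zero_or_one _ _)).trans
      (abs_mul_le_of_zero_or_one (iocInd_eq_zero_or_one _ _))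
  have hΦb : ∀ᶠ l in atTop, ∀ x, ‖gauge q₁ q₂ x.2.1 x.2.2 * (f l x - g x)‖ₑ
      ≤ ENNReal.ofReal (Cb + Ca) := by
    filter_upwards [hfb] with l hl x
    rw [Real.enorm_eq_ofReal_abs]
    apply ENNReal.ofReal_le_ofReal
    rw [abs_mul, abs_of_nonneg (gauge_nonneg _ _ _ _)]
    calc _ ≤ gauge q₁ q₂ x.2.1 x.2.2 * (|f l x| + |g x|) :=
          mul_le_mul_of_nonneg_left (abs_sub _ _) (gauge_nonneg _ _ _ _)
      _ ≤ Cb + Ca := by linarith [hl x, hgb x]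
  -- supports
  have hL : (1 : ℝ) ≤ |x₁| + 1 := by linarith [abs_nonneg x₁]
  have hfs : ∀ᶠ l in atTop, ∀ x, f l x ≠ 0 → |x.1.1 + x.2.1| ≤ |x₁| + 1 := by
    filter_upwards [hm₁.eventually_ge_atTop 1] with l hl x hx
    have hl0 : 0 < m₁ l := by linarith
    rw [hf] at hx
    have h := bounds_of_cellInd_ne_zero hl0
      (left_ne_zero_of_mul (right_ne_zero_of_mul hx))
    have h1 : x.2.1 ≤ (i l x.2 : ℝ) / m₁ l := by
      rw [le_div_iff₀ hl0, hi, mul_comm]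
      exact Int.le_ceil _
    have h2 : (i l x.2 : ℝ) / m₁ l ≤ x.2.1 + 1 := by
      rw [div_le_iff₀ hl0, hi]
      have := Int.ceil_lt_add_one (m₁ l * x.2.1)
      nlinarith
    rw [abs_le]
    constructor <;> linarith [le_abs_self x₁, abs_nonneg x₁]
  have hgs : ∀ x, g x ≠ 0 → |x.1.1 + x.2.1| ≤ |x₁| + 1 := by
    intro x hx
    rw [hg] at hx
    have h := iocInd_support (left_ne_zero_of_mul (right_ne_zero_of_mul hx))
    rw [abs_of_pos h.1]
    linarith [le_abs_self x₁]
  -- the inner integrals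
  have hinner : ∀ᵐ y : ℝ × ℝ × ℝ, Tendsto (fun l => ∫⁻ v,
      ‖gauge q₁ q₂ y.2.1 y.2.2 * (f l ((y.1, v), y.2) - g ((y.1, v), y.2))‖ₑ ^ 2)
      atTop (𝓝 0) := by
    have hae : ∀ᵐ y : ℝ × ℝ × ℝ, y.2.1 ≠ 0 ∧ y.1 + y.2.1 ≠ 0 ∧ y.1 + y.2.1 ≠ x₁ := by
      have h1 : ∀ᵐ y : ℝ × ℝ × ℝ, y.2.1 ≠ 0 :=
        Measure.quasiMeasurePreserving_snd.ae (p := fun p : ℝ × ℝ => p.1 ≠ 0) ae_fst_ne_zero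
      have h2 : ∀ c : ℝ, ∀ᵐ y : ℝ × ℝ × ℝ, y.1 + y.2.1 ≠ c := by
        intro c
        have hms : MeasurableSet {y : ℝ × ℝ × ℝ | y.1 + y.2.1 ≠ c} :=
          (measurableSet_eq_fun (by fun_prop) measurable_const).compl
        rw [Measure.volume_eq_prod, Measure.ae_prod_iff_ae_ae hms]
        refine Eventually.of_forall fun s => ?_
        have h3 : ∀ᵐ w : ℝ, s + w ≠ c := by
          have : {w : ℝ | ¬ (s + w ≠ c)} = {c - s} := by
            ext w
            simp only [ne_eq, not_not, Set.mem_ofPred_eq, Set.mem_singleton_iff]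
            constructor <;> intro h <;> linarith
          rw [ae_iff, this]
          simp
        exact Measure.quasiMeasurePreserving_fst.ae h3
      filter_upwards [h1, h2 0, h2 x₁] with y a b c using ⟨a, b, c⟩
    filter_upwards [hae] with y hy
    obtain ⟨hy0, hy1, hy2⟩ := hy
    obtain ⟨σ, hσ⟩ : ∃ σ, σ = -(e₁ * y.2.1) + e₂ * y.2.2 := ⟨_, rfl⟩
    have hiσ : Tendsto (fun l => (i l y.2 : ℝ) / m₁ l) atTop (𝓝 y.2.1) := by
      refine tendsto_div_of_abs_sub_le (y := fun l => m₁ l * y.2.1) hm₁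
        (fun l => by rw [hi]; exact abs_ceil_sub_le _) ?_
      refine tendsto_const_nhds.congr' ?_
      filter_upwards [hm₁.eventually_gt_atTop 0] with l hl
      rw [mul_div_cancel_left₀ _ hl.ne']
    have hjσ : Tendsto (fun l => (j l y.2 : ℝ) / m₂ l) atTop (𝓝 σ) := by
      refine tendsto_div_of_abs_sub_le hm₂ (fun l => by rw [hj]; exact abs_ceil_sub_le _) ?_
      rw [hσ]
      refine ((he₁.mul_const y.2.1).neg.add (he₂.mul_const y.2.2)).congr fun l => ?_
      ring
    have hlim := tendsto_lintegral_filter_of_dominated_convergence (l := atTop)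
      (μ := (volume : Measure ℝ))
      (F := fun l v => ‖gauge q₁ q₂ y.2.1 y.2.2 * (f l ((y.1, v), y.2) - g ((y.1, v), y.2))‖ₑ ^ 2)
      (f := fun _ => 0)
      ({v : ℝ | |σ + v| ≤ |x₂| + 1}.indicator fun _ => ENNReal.ofReal (Cb + Ca) ^ 2)
      (Eventually.of_forall fun l => by
        have h1 : Measurable fun v : ℝ => (((y.1, v), y.2) : (ℝ × ℝ) × ℝ × ℝ) := by fun_prop
        exact ((((hmf l).comp h1).sub (hmg.comp h1)).const_mul _).enorm.pow_const 2)
      (by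
        have h1 : ∀ᶠ l in atTop, |(j l y.2 : ℝ) / m₂ l - σ| < 1 := by
          have := (hjσ.sub_const σ).abs
          rw [sub_self, abs_zero] at this
          exact this.eventually_lt_const one_pos
        filter_upwards [hΦb, h1, hm₂.eventually_gt_atTop 0] with l hl h1 hl2
        refine Eventually.of_forall fun v => ?_
        by_cases hv : |σ + v| ≤ |x₂| + 1
        · rw [Set.indicator_of_mem (by exact hv)]
          have := hl ((y.1, v), y.2)
          gcongr
        · have hf0 : f l ((y.1, v), y.2) = 0 := by
            by_contra hne
            rw [hf] at hne
            have h2 := bounds_of_cellInd_ne_zero hl2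
              (right_ne_zero_of_mul (right_ne_zero_of_mul hne))
            simp only at h2
            apply hv
            rw [abs_lt] at h1
            rw [abs_le]
            constructor <;> linarith [le_abs_self x₂, abs_nonneg x₂]
          have hg0 : g ((y.1, v), y.2) = 0 := by
            by_contra hne
            rw [hg] at hne
            have h2 := iocInd_support (right_ne_zero_of_mul (right_ne_zero_of_mul hne))
            simp only [← hσ] at h2
            apply hv
            rw [abs_le]
            constructor <;> linarith [le_abs_self x₂, abs_nonneg x₂]
          rw [hf0, hg0]
          simp)
      (by
        rw [lintegral_indicator (measurableSet_strip _ _), setLIntegral_const]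
        refine (ENNReal.mul_lt_top (by finiteness) ?_).ne
        refine lt_of_le_of_lt (measure_mono (t := Set.Icc (-(|x₂| + 1) - σ) (|x₂| + 1 - σ)) ?_)
          measure_Icc_lt_top
        intro v hv
        rw [Set.mem_ofPred_eq, abs_le] at hv
        exact ⟨by linarith [hv.1], by linarith [hv.2]⟩)
      (by
        have hae : ∀ᵐ v : ℝ, v ≠ -σ ∧ v ≠ x₂ - σ := by
          have h1 : ∀ c : ℝ, ∀ᵐ v : ℝ, v ≠ c := fun c => by simp [ae_iff]
          filter_upwards [h1 (-σ), h1 (x₂ - σ)] with v a b using ⟨a, b⟩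
        filter_upwards [hae] with v hv
        have t1 : Tendsto (fun l => R l y.2) atTop (𝓝 (a (α * y.2.1) (c₂₂ * y.2.2))) := by
          have := hconv y.2 hy0
          rw [hR, hi, hj]
          exact this
        have t2 := tendsto_cellInd (x := x₁) (u := y.1) hm₁ hiσ hy1 hy2
        have t3 := tendsto_cellInd (x := x₂) (u := v) hm₂ hjσ
          (fun h => hv.1 (by linarith)) (fun h => hv.2 (by linarith))
        have t4 : Tendsto (fun l => f l ((y.1, v), y.2)) atTop (𝓝 (g ((y.1, v), y.2))) := by
          rw [hf, hg]
          simp only [← hσ]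
          exact t1.mul (t2.mul t3)
        have t5 := ENNReal.Tendsto.pow (n := 2) ((t4.sub_const (g ((y.1, v), y.2))).const_mul
          (gauge q₁ q₂ y.2.1 y.2.2)).enorm
        simpa using t5)
    simpa using hlim
  have hmain := tendsto_lintegral_sq_stripWeight (q₁ := q₁) hq₂ hκ0 hκ hL (l := atTop)
    (Φ := fun l x => ‖gauge q₁ q₂ x.2.1 x.2.2 * (f l x - g x)‖ₑ)
    (fun l => (((measurable_gauge.comp measurable_snd).mul ((hmf l).sub hmg)).enorm))
    (K := ENNReal.ofReal (Cb + Ca) ^ 2 * (ENNReal.ofReal x₂ + ENNReal.ofReal x₂))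
    (by finiteness) (by
      filter_upwards [hΦb, hm₂.eventually_gt_atTop 0] with l hl hl2 s p
      have hm : Measurable fun v : ℝ => ‖cellInd (m₂ l) x₂ (j l p + ⌈m₂ l * v⌉)‖ₑ :=
        (measurable_cellInd_add_ceil _ _ measurable_const (by fun_prop)).enorm
      calc ∫⁻ v, ‖gauge q₁ q₂ p.1 p.2 * (f l ((s, v), p) - g ((s, v), p))‖ₑ ^ 2
          ≤ ∫⁻ v, ENNReal.ofReal (Cb + Ca) ^ 2 *
            (‖cellInd (m₂ l) x₂ (j l p + ⌈m₂ l * v⌉)‖ₑ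
              + ‖iocInd x₂ (v + (-(e₁ * p.1) + e₂ * p.2))‖ₑ) := by
            refine lintegral_mono fun v => ?_
            have h := hl ((s, v), p)
            have h' : ‖gauge q₁ q₂ p.1 p.2 * (f l ((s, v), p) - g ((s, v), p))‖ₑ ^ 2
                ≤ ENNReal.ofReal (Cb + Ca) ^ 2 := by gcongr
            rcases cellInd_eq_zero_or_one (m₂ l) x₂ (j l p + ⌈m₂ l * v⌉) with hc | hc
            · rcases iocInd_eq_zero_or_one x₂ (v + (-(e₁ * p.1) + e₂ * p.2)) with hd | hd
              · have hf0 : f l ((s, v), p) = 0 := by rw [hf]; simp [hc]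
                have hg0 : g ((s, v), p) = 0 := by rw [hg]; simp [hd]
                rw [hf0, hg0]
                simp
              · rw [hc, hd]
                simpa using h'
            · rw [hc, enorm_one]
              exact h'.trans (le_mul_of_one_le_right zero_le le_self_add)
        _ ≤ _ := by
            rw [lintegral_const_mul' _ _ (by finiteness), lintegral_add_left hm,
              lintegral_enorm_iocInd]
            gcongr
            exact lintegral_enorm_cellInd_le hl2 _) hinner
  refine tendsto_of_tendsto_of_tendsto_of_le_of_le' tendsto_const_nhds hmain
    (Eventually.of_forall fun _ => zero_le) ?_
  filter_upwards [hfb, hfs, hm₁.eventually_gt_atTop 0] with l hfb hfs hl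
  refine lintegral_mono fun u => ?_
  have hm : Measurable fun p : ℝ × ℝ => (u, p) := measurable_const.prodMk measurable_id
  have hif : Integrable fun p => f l (u, p) :=
    integrable_of_strip (q₁ := q₁) (L := |x₁| + 1) (u := u.1) hq₂ (by linarith) hκ ((hmf l).comp hm).aestronglyMeasurable
      (fun p hp => hfs (u, p) hp) fun p => hfb (u, p)
  have hig : Integrable fun p => g (u, p) :=
    integrable_of_strip (q₁ := q₁) (L := |x₁| + 1) (u := u.1) hq₂ (by linarith) hκ (hmg.comp hm).aestronglyMeasurable
      (fun p hp => hgs (u, p) hp) fun p => hgb (u, p)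
  have e1 : m₁ l ^ (q₁ - q₁ / q₂ - 1) *
      boxSum β (m₁ l * x₁) (m₂ l * x₂) ⌈m₁ l * u.1⌉ ⌈m₂ l * u.2⌉ = ∫ p, f l (u, p) := by
    rw [rescaled_boxSum_eq_integral (-(c₂₁ / c₂₂)) hl, hf, hR, hi, hj]
  have e2 : stripKernel a α c₂₂ e₁ e₂ x₁ x₂ u = ∫ p, g (u, p) := by
    rw [hg]; rfl
  rw [e1, e2, ← integral_sub hif hig]
  gcongr
  refine (enorm_integral_le_lintegral_enorm _).trans (lintegral_mono_ae ?_)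
  filter_upwards [ae_fst_ne_zero] with p hp
  refine (enorm_eq_stripWeight_mul (q₁ := q₁) (q₂ := q₂) hp fun hne => ?_).le
  by_cases hf0 : f l (u, p) = 0
  · exact hgs (u, p) fun h => hne (by rw [hf0, h, sub_zero])
  · exact hfs (u, p) hf0

end Strip

/-! ### Integrals of the kernel along horizontal segments -/

lemma rpow_mul_rpow_le_gauge {q₁ q₂ θ : ℝ} (hθ0 : 0 ≤ θ) (hθ1 : θ ≤ 1) (w z : ℝ) :
    |w| ^ (q₁ * θ) * |z| ^ (q₂ * (1 - θ)) ≤ gauge q₁ q₂ w z := by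
  have hw : 0 ≤ |w| ^ q₁ := by positivity
  have hz : 0 ≤ |z| ^ q₂ := by positivity
  have h := Real.geom_mean_le_arith_mean2_weighted hθ0 (sub_nonneg.2 hθ1) hw hz (by ring)
  rw [← Real.rpow_mul (abs_nonneg _), ← Real.rpow_mul (abs_nonneg _)] at h
  refine h.trans ?_
  unfold gauge
  have h1 := mul_le_of_le_one_left hw hθ1
  have h2 := mul_le_of_le_one_left hz (by linarith : 1 - θ ≤ 1)
  linarith

/-- The mass of the inverse gauge on a horizontal segment of length `x`. -/
noncomputable def lineMass (q₁ q₂ x : ℝ) (u : ℝ × ℝ) : ℝ≥0∞ :=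
  ∫⁻ y, ENNReal.ofReal (gauge q₁ q₂ (y - u.1) (-u.2))⁻¹ * ‖iocInd x y‖ₑ

lemma ae_snd_ne_zero : ∀ᵐ p : ℝ × ℝ, p.2 ≠ 0 := by
  have : ∀ᵐ w : ℝ, w ≠ 0 := by simp [ae_iff]
  exact Measure.quasiMeasurePreserving_snd.ae this

lemma lineMass_le {q₁ q₂ θ x : ℝ} (hθ0 : 0 ≤ θ) (hθ1 : θ ≤ 1) {u : ℝ × ℝ} (hu : u.2 ≠ 0) :
    lineMass q₁ q₂ x u
      ≤ stripMass (q₁ * θ) (max x 1) u.1 * ENNReal.ofReal (|u.2| ^ (-(q₂ * (1 - θ)))) := by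
  have h1 : lineMass q₁ q₂ x u
      = ∫⁻ w, ENNReal.ofReal (gauge q₁ q₂ w (-u.2))⁻¹ * ‖iocInd x (w + u.1)‖ₑ := by
    rw [lineMass, ← lintegral_add_right_eq_self (μ := volume) _ u.1]
    simp only [add_sub_cancel_right]
  rw [h1, stripMass, ← lintegral_mul_const' _ _ ENNReal.ofReal_ne_top]
  refine lintegral_mono_ae ?_
  have h0 : ∀ᵐ w : ℝ, w ≠ 0 := by simp [ae_iff]
  filter_upwards [h0] with w hw
  rcases iocInd_eq_zero_or_one x (w + u.1) with h | h
  · simp [h]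
  · have h2 := iocInd_support (x := x) (y := w + u.1) (by rw [h]; exact one_ne_zero)
    rw [Set.indicator_of_mem, h, enorm_one, mul_one, ← ENNReal.ofReal_mul (by positivity)]
    · apply ENNReal.ofReal_le_ofReal
      have hw' := abs_pos.2 hw
      have hu' := abs_pos.2 hu
      rw [Real.rpow_neg hw'.le, Real.rpow_neg hu'.le, ← mul_inv]
      apply inv_anti₀ (by positivity)
      have := rpow_mul_rpow_le_gauge (q₁ := q₁) (q₂ := q₂) hθ0 hθ1 w (-u.2)
      rwa [abs_neg] at this
    · change |u.1 + w| ≤ max x 1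
      rw [add_comm, abs_of_pos h2.1]
      exact h2.2.trans (le_max_left _ _)

lemma lintegral_abs_rpow_tail_lt_top {s : ℝ} (hs : 1 < s) :
    ∫⁻ z : ℝ, {z : ℝ | 1 < |z|}.indicator (fun z => ENNReal.ofReal (|z| ^ (-s))) z < ⊤ := by
  have h := finite_integral_one_add_norm (E := ℝ) (μ := volume) (r := s) (by simpa using hs)
  calc _ ≤ ∫⁻ z : ℝ, ENNReal.ofReal (2 ^ s) * ENNReal.ofReal ((1 + ‖z‖) ^ (-s)) := by
        refine lintegral_mono fun z => ?_
        by_cases hz : 1 < |z|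
        · rw [Set.indicator_of_mem (by exact hz), ← ENNReal.ofReal_mul (by positivity)]
          apply ENNReal.ofReal_le_ofReal
          calc |z| ^ (-s) ≤ ((1 + |z|) / 2) ^ (-s) :=
                Real.rpow_le_rpow_of_nonpos (by positivity) (by linarith) (by linarith)
            _ = _ := by
                rw [Real.div_rpow (by positivity) (by norm_num), Real.rpow_neg (by norm_num : (0:ℝ) ≤ 2),
                  Real.norm_eq_abs]
                field_simp
        · rw [Set.indicator_of_notMem (by exact hz)]
          exact zero_le
    _ = ENNReal.ofReal (2 ^ s) * ∫⁻ z : ℝ, ENNReal.ofReal ((1 + ‖z‖) ^ (-s)) :=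
        lintegral_const_mul _ (by fun_prop)
    _ < ⊤ := ENNReal.mul_lt_top (by simp) h

lemma ofReal_abs_rpow_sq (z s : ℝ) :
    ENNReal.ofReal (|z| ^ (-s)) ^ 2 = ENNReal.ofReal (|z| ^ (-(2 * s))) := by
  rw [← ENNReal.ofReal_pow (by positivity), ← Real.rpow_natCast, ← Real.rpow_mul (abs_nonneg _)]
  congr 2
  push_cast
  ring

/-- The masses of horizontal segments are square integrable: near the axis and far from it two
different interpolations between the coordinates of the gauge are used. -/
lemma lintegral_lineMass_sq_lt_top {q₁ q₂ : ℝ} (hq₁ : 0 < q₁) (hq₂ : 1 < q₂)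
    (hκ0 : 1 / 2 < q₁ - q₁ / q₂) (hQ : 1 / q₁ + 1 / q₂ < 2) (hQt : 1 < 1 / q₁ + 1 / (2 * q₂))
    (x : ℝ) :
    ∫⁻ u, lineMass q₁ q₂ x u ^ 2 < ⊤ := by
  have hq₂0 : 0 < q₂ := by linarith
  have hq₁' : 1 / (2 * q₁) < 1 := by
    rw [div_lt_one (by linarith)]
    have : 0 < q₁ / q₂ := by positivity
    linarith
  have hhalf : 1 / (2 * q₁) = (1 / q₁) / 2 := by field_simp
  have hhalf' : 1 / (2 * q₂) = (1 / q₂) / 2 := by field_simp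
  have h1q : 0 < 1 / q₁ := by positivity
  have h2q : 0 < 1 / q₂ := by positivity
  -- interpolation parameters
  obtain ⟨θ, hθa, hθb⟩ : ∃ θ, max (1 - 1 / (2 * q₂)) (1 / (2 * q₁)) < θ ∧ θ < min (1 / q₁) 1 := by
    apply exists_between
    rw [max_lt_iff, lt_min_iff, lt_min_iff]
    refine ⟨⟨by linarith, by linarith⟩, by linarith, hq₁'⟩
  obtain ⟨τ, hτa, hτb⟩ : ∃ τ, 1 / (2 * q₁) < τ ∧ τ < min (1 / q₁) (1 - 1 / (2 * q₂)) := by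
    apply exists_between
    rw [lt_min_iff]
    refine ⟨by linarith, by linarith⟩
  rw [max_lt_iff] at hθa
  rw [lt_min_iff] at hθb hτb
  have e1 : ∀ {t : ℝ}, 1 / (2 * q₁) < t → t < 1 / q₁ → 1 / 2 < q₁ * t ∧ q₁ * t < 1 := by
    intro t h h'
    rw [div_lt_iff₀ (by linarith)] at h
    rw [lt_div_iff₀ hq₁] at h'
    constructor <;> linarith
  have hθκ := e1 hθa.2 hθb.1
  have hτκ := e1 hτa hτb.1
  have hθ0 : 0 < θ := by linarith [hθa.2]
  have hτ0 : 0 < τ := by linarith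
  have hs1 : 2 * (q₂ * (1 - θ)) < 1 := by
    have : 1 - θ < 1 / (2 * q₂) := by linarith [hθa.1]
    rw [lt_div_iff₀ (by linarith)] at this
    linarith
  have hs2 : 1 < 2 * (q₂ * (1 - τ)) := by
    have : 1 / (2 * q₂) < 1 - τ := by linarith [hτb.2]
    rw [div_lt_iff₀ (by linarith)] at this
    linarith
  have hL : 1 ≤ max x 1 := le_max_right _ _
  have hms : MeasurableSet {z : ℝ | |z| ≤ 1} := measurableSet_le (by fun_prop) measurable_const
  have hms' : MeasurableSet {z : ℝ | 1 < |z|} := measurableSet_lt measurable_const (by fun_prop)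
  have hbound : ∀ᵐ u : ℝ × ℝ, lineMass q₁ q₂ x u ^ 2 ≤
      stripMass (q₁ * θ) (max x 1) u.1 ^ 2 * {z : ℝ | |z| ≤ 1}.indicator
        (fun z => ENNReal.ofReal (|z| ^ (-(2 * (q₂ * (1 - θ)))))) u.2
      + stripMass (q₁ * τ) (max x 1) u.1 ^ 2 * {z : ℝ | 1 < |z|}.indicator
        (fun z => ENNReal.ofReal (|z| ^ (-(2 * (q₂ * (1 - τ)))))) u.2 := by
    filter_upwards [ae_snd_ne_zero] with u hu
    rcases le_or_gt |u.2| 1 with h | h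
    · refine le_trans ?_ le_self_add
      rw [Set.indicator_of_mem (by exact h), ← ofReal_abs_rpow_sq, ← mul_pow]
      gcongr
      exact lineMass_le hθ0.le hθb.2.le hu
    · refine le_trans ?_ le_add_self
      rw [Set.indicator_of_mem (by exact h), ← ofReal_abs_rpow_sq, ← mul_pow]
      gcongr
      exact lineMass_le hτ0.le (by linarith) hu
  have hm1 : AEMeasurable (fun u => stripMass (q₁ * θ) (max x 1) u ^ 2) (volume : Measure ℝ) :=
    ((measurable_stripMass _ _).pow_const 2).aemeasurable
  have hm2 : AEMeasurable (fun u => stripMass (q₁ * τ) (max x 1) u ^ 2) (volume : Measure ℝ) :=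
    ((measurable_stripMass _ _).pow_const 2).aemeasurable
  have hp : ∀ s : ℝ, Measurable fun z : ℝ => ENNReal.ofReal (|z| ^ (-s)) := fun s => by fun_prop
  have hn1 := ((hp (2 * (q₂ * (1 - θ)))).indicator hms)
  have hn2 := ((hp (2 * (q₂ * (1 - τ)))).indicator hms')
  refine (lintegral_mono_ae hbound).trans_lt ?_
  have hadd : Measurable fun u : ℝ × ℝ => stripMass (q₁ * θ) (max x 1) u.1 ^ 2 *
      {z : ℝ | |z| ≤ 1}.indicator
        (fun z => ENNReal.ofReal (|z| ^ (-(2 * (q₂ * (1 - θ)))))) u.2 :=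
    (((measurable_stripMass _ _).pow_const 2).comp measurable_fst).mul (hn1.comp measurable_snd)
  rw [lintegral_add_left hadd,
    Measure.volume_eq_prod, lintegral_prod_mul hm1 hn1.aemeasurable,
    lintegral_prod_mul hm2 hn2.aemeasurable]
  refine ENNReal.add_lt_top.2 ⟨ENNReal.mul_lt_top (lintegral_stripMass_sq_lt_top hθκ.1 hθκ.2 hL) ?_,
    ENNReal.mul_lt_top (lintegral_stripMass_sq_lt_top hτκ.1 hτκ.2 hL)
      (lintegral_abs_rpow_tail_lt_top hs2)⟩
  rw [lintegral_indicator hms]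
  exact lintegral_abs_rpow_lt_top hs1 1

/-- The integral of the kernel along a horizontal segment of length `x`. -/
noncomputable def lineKernel (a : ℝ → ℝ → ℝ) (α δ x : ℝ) (u : ℝ × ℝ) : ℝ :=
  ∫ y, a (α * (y - u.1)) (δ * -u.2) * iocInd x y

lemma ofReal_mul_inv_gauge {q₁ q₂ C w z r χ : ℝ} (hz : z ≠ 0) (h : |r| * gauge q₁ q₂ w z ≤ C) :
    ‖r * χ‖ₑ ≤ ENNReal.ofReal C * (ENNReal.ofReal (gauge q₁ q₂ w z)⁻¹ * ‖χ‖ₑ) := by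
  have hg : 0 < gauge q₁ q₂ w z := gauge_pos (Or.inr hz)
  have hC : 0 ≤ C := le_trans (mul_nonneg (abs_nonneg _) hg.le) h
  rw [enorm_mul, ← mul_assoc, ← ENNReal.ofReal_mul hC, Real.enorm_eq_ofReal_abs]
  gcongr
  rwa [← div_eq_mul_inv, le_div_iff₀ hg]

section Line

variable {q₁ q₂ : ℝ} {a : ℝ → ℝ → ℝ} {c₁₁ c₁₂ c₂₁ c₂₂ : ℝ} {β : ℤ → ℤ → ℝ}

lemma measurable_lineKernel_integrand (ha : IsAnisotropicKernel q₁ q₂ a) (α δ x : ℝ) :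
    Measurable fun y : (ℝ × ℝ) × ℝ => a (α * (y.2 - y.1.1)) (δ * -y.1.2) * iocInd x y.2 :=
  (ha.measurable.comp (by fun_prop : Measurable fun y : (ℝ × ℝ) × ℝ =>
    (α * (y.2 - y.1.1), δ * -y.1.2))).mul ((measurable_iocInd x).comp measurable_snd)

lemma measurable_lineKernel (ha : IsAnisotropicKernel q₁ q₂ a) (α δ x : ℝ) :
    Measurable (lineKernel a α δ x) :=
  (measurable_lineKernel_integrand ha α δ x).stronglyMeasurable.integral_prod_right'
    |>.measurable

lemma lineMass_lt_top {x : ℝ} {u : ℝ × ℝ} (hu : u.2 ≠ 0) : lineMass q₁ q₂ x u < ⊤ := by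
  refine (lineMass_le (θ := 0) le_rfl zero_le_one hu).trans_lt (ENNReal.mul_lt_top ?_ (by simp))
  simp only [stripMass, mul_zero, neg_zero, Real.rpow_zero, ENNReal.ofReal_one]
  rw [lintegral_indicator (measurableSet_strip _ _), setLIntegral_one]
  refine lt_of_le_of_lt (measure_mono (t := Set.Icc (-(max x 1) - u.1) (max x 1 - u.1)) ?_)
    measure_Icc_lt_top
  intro v hv
  rw [Set.mem_ofPred_eq, abs_le] at hv
  exact ⟨by linarith [hv.1], by linarith [hv.2]⟩

lemma integrable_lineKernel_integrand (ha : IsAnisotropicKernel q₁ q₂ a) {α δ : ℝ} (hα : α ≠ 0)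
    (hδ : δ ≠ 0) (x : ℝ) {u : ℝ × ℝ} (hu : u.2 ≠ 0) :
    Integrable fun y => a (α * (y - u.1)) (δ * -u.2) * iocInd x y := by
  obtain ⟨C, -, hC⟩ := ha.exists_abs_comp_mul_gauge_le hα hδ
  refine ⟨((measurable_lineKernel_integrand ha α δ x).comp
    (measurable_const.prodMk measurable_id : Measurable fun y : ℝ => (u, y))).aestronglyMeasurable,
    ?_⟩
  rw [HasFiniteIntegral]
  refine (lintegral_mono fun y => ofReal_mul_inv_gauge (neg_ne_zero.2 hu)
    (hC (y - u.1) (-u.2))).trans_lt ?_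
  rw [lintegral_const_mul' _ _ ENNReal.ofReal_ne_top]
  exact ENNReal.mul_lt_top ENNReal.ofReal_lt_top (lineMass_lt_top hu)

lemma enorm_lineKernel_le {α δ C : ℝ}
    (hC : ∀ w z, |a (α * w) (δ * z)| * gauge q₁ q₂ w z ≤ C) (x : ℝ) {u : ℝ × ℝ} (hu : u.2 ≠ 0) :
    ‖lineKernel a α δ x u‖ₑ ≤ ENNReal.ofReal C * lineMass q₁ q₂ x u := by
  rw [lineMass, ← lintegral_const_mul' _ _ ENNReal.ofReal_ne_top]
  exact (enorm_integral_le_lintegral_enorm _).trans (lintegral_mono fun y =>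
    ofReal_mul_inv_gauge (neg_ne_zero.2 hu) (hC (y - u.1) (-u.2)))

lemma memLp_lineKernel (ha : IsAnisotropicKernel q₁ q₂ a) (hq₁ : 0 < q₁) (hq₂ : 1 < q₂)
    (hκ0 : 1 / 2 < q₁ - q₁ / q₂) (hQ : 1 / q₁ + 1 / q₂ < 2) (hQt : 1 < 1 / q₁ + 1 / (2 * q₂))
    {α δ : ℝ} (hα : α ≠ 0) (hδ : δ ≠ 0) (x : ℝ) :
    MemLp (lineKernel a α δ x) 2 := by
  obtain ⟨C, -, hC⟩ := ha.exists_abs_comp_mul_gauge_le hα hδ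
  refine memLp_two_of_lintegral_sq_lt_top (measurable_lineKernel ha α δ x).aestronglyMeasurable ?_
  calc ∫⁻ u, ‖lineKernel a α δ x u‖ₑ ^ 2
      ≤ ∫⁻ u, ENNReal.ofReal C ^ 2 * lineMass q₁ q₂ x u ^ 2 := by
        refine lintegral_mono_ae ?_
        filter_upwards [ae_snd_ne_zero] with u hu
        rw [← mul_pow]
        gcongr
        exact enorm_lineKernel_le hC x hu
    _ = ENNReal.ofReal C ^ 2 * ∫⁻ u, lineMass q₁ q₂ x u ^ 2 :=
        lintegral_const_mul' _ _ (by finiteness)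
    _ < ⊤ := ENNReal.mul_lt_top (by finiteness)
        (lintegral_lineMass_sq_lt_top hq₁ hq₂ hκ0 hQ hQt x)

end Line

/-! ### Convergence of rescaled lattice sums along horizontal segments -/

/-- Translation is continuous in mean square. -/
lemma tendsto_eLpNorm_translate {G : ℝ × ℝ → ℝ} (hG : MemLp G 2) :
    Tendsto (fun v => eLpNorm (fun u : ℝ × ℝ => G (v + u) - G u) 2) (𝓝 0) (𝓝 0) := by
  have : Fact ((2 : ℝ≥0∞) ≠ ∞) := ⟨by norm_num⟩
  have hc : Continuous fun v : ℝ × ℝ => (DomAddAct.mk v) +ᵥ hG.toLp G := by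
    have : Continuous fun v : ℝ × ℝ => (DomAddAct.mk v, hG.toLp G) := by
      exact (DomAddAct.continuous_mk).prodMk continuous_const
    exact continuous_vadd.comp this
  have h1 := (hc.tendsto 0).edist (tendsto_const_nhds (x := hG.toLp G))
  have h0 : (DomAddAct.mk (0 : ℝ × ℝ)) +ᵥ hG.toLp G = hG.toLp G := by
    simp
  rw [h0, edist_self] at h1
  refine h1.congr fun v => ?_
  rw [DomAddAct.mk_vadd_toLp, Lp.edist_toLp_toLp]
  rfl

/-- Averages of small translates of `F` are close to `G` in mean square if `F` is. -/
lemma eLpNorm_average_translate_sub_le {ι : Type*} {F G : ℝ × ℝ → ℝ}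
    (hF : AEStronglyMeasurable F) (hG : AEStronglyMeasurable G) (s : Finset ι) (v : ι → ℝ × ℝ)
    {c x : ℝ} (hc : 0 ≤ c) (hcx : c * s.card ≤ x) :
    eLpNorm (fun u : ℝ × ℝ => c * ∑ k ∈ s, F (v k + u) - x * G u) 2
      ≤ ENNReal.ofReal x * (eLpNorm (fun u : ℝ × ℝ => F u - G u) 2 +
        ⨆ k ∈ s, eLpNorm (fun u : ℝ × ℝ => G (v k + u) - G u) 2) + ‖c * s.card - x‖ₑ * eLpNorm G 2 := by
  have hmp : ∀ k, MeasurePreserving (fun u : ℝ × ℝ => v k + u) volume volume := fun k =>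
    measurePreserving_add_left volume (v k)
  have hFG : AEStronglyMeasurable (fun u : ℝ × ℝ => F u - G u) := hF.sub hG
  have hdecomp : (fun u : ℝ × ℝ => c * ∑ k ∈ s, F (v k + u) - x * G u)
      = (c • ∑ k ∈ s, ((fun u : ℝ × ℝ => F (v k + u) - G (v k + u)) + fun u : ℝ × ℝ => G (v k + u) - G u))
        + (c * s.card - x) • G := by
    ext u
    simp only [Pi.add_apply, Pi.smul_apply, Finset.sum_apply, smul_eq_mul, sub_add_sub_cancel]
    rw [Finset.sum_sub_distrib, Finset.sum_const, nsmul_eq_mul]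
    ring
  have hGv : ∀ k, AEStronglyMeasurable (fun u : ℝ × ℝ => G (v k + u)) := fun k =>
    hG.comp_measurePreserving (hmp k)
  have hm1 : ∀ k, AEStronglyMeasurable (fun u : ℝ × ℝ => F (v k + u) - G (v k + u)) := fun k =>
    hFG.comp_measurePreserving (hmp k)
  have hm2 : ∀ k, AEStronglyMeasurable (fun u : ℝ × ℝ => G (v k + u) - G u) := fun k =>
    (hGv k).sub hG
  have e1 : ∀ k, eLpNorm (fun u : ℝ × ℝ => F (v k + u) - G (v k + u)) 2 volume
      = eLpNorm (fun u : ℝ × ℝ => F u - G u) 2 volume := fun k =>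
    eLpNorm_comp_measurePreserving (g := fun u : ℝ × ℝ => F u - G u) (f := fun u => v k + u)
      hFG (hmp k)
  obtain ⟨ω, hω⟩ : ∃ ω : ι → ℝ≥0∞, ω = fun k => eLpNorm (fun u : ℝ × ℝ => G (v k + u) - G u) 2 volume :=
    ⟨_, rfl⟩
  have hω' : ∀ k, eLpNorm (fun u : ℝ × ℝ => G (v k + u) - G u) 2 volume = ω k := fun k => by rw [hω]
  have hms : ∀ k ∈ s, AEStronglyMeasurable
      ((fun u : ℝ × ℝ => F (v k + u) - G (v k + u)) + fun u : ℝ × ℝ => G (v k + u) - G u) volume :=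
    fun k _ => (hm1 k).add (hm2 k)
  have hterm : ∀ k ∈ s, eLpNorm
      ((fun u : ℝ × ℝ => F (v k + u) - G (v k + u)) + fun u : ℝ × ℝ => G (v k + u) - G u) 2 volume
      ≤ eLpNorm (fun u : ℝ × ℝ => F u - G u) 2 volume + ⨆ k ∈ s, ω k := by
    intro k hk
    refine (eLpNorm_add_le (hm1 k) (hm2 k) (by norm_num)).trans ?_
    rw [e1, hω']
    exact add_le_add le_rfl (le_iSup₂ (f := fun k (_ : k ∈ s) => ω k) k hk)
  rw [hdecomp]
  refine (eLpNorm_add_le ((Finset.aestronglyMeasurable_sum _ hms).const_smul _)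
    (hG.const_smul _) (by norm_num)).trans ?_
  rw [eLpNorm_const_smul, eLpNorm_const_smul]
  simp only [hω']
  refine add_le_add ?_ le_rfl
  have hsum := (eLpNorm_sum_le hms (by norm_num)).trans (Finset.sum_le_sum hterm)
  rw [Finset.sum_const, nsmul_eq_mul] at hsum
  refine (mul_le_mul_right hsum _).trans ?_
  rw [← mul_assoc]
  refine mul_le_mul_left ?_ _
  rw [Real.enorm_of_nonneg hc, ← ENNReal.ofReal_natCast, ← ENNReal.ofReal_mul hc]
  exact ENNReal.ofReal_le_ofReal hcx

section Line

variable {q₁ q₂ : ℝ} {a : ℝ → ℝ → ℝ} {c₁₁ c₁₂ c₂₁ c₂₂ : ℝ} {β : ℤ → ℤ → ℝ}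

/-- Rescaled sums of coefficients along a row of the lattice, as a step function. -/
noncomputable def rescaledRow (q₁ q₂ x : ℝ) (β : ℤ → ℤ → ℝ) (l : ℝ) (u : ℝ × ℝ) : ℝ :=
  l ^ (q₁ - 1) * ∑ t ∈ Finset.Ioc (0 : ℤ) ⌊l * x⌋, β (t - ⌈l * u.1⌉) (-⌈l ^ (q₁ / q₂) * u.2⌉)

lemma measurable_rescaledRow (q₁ q₂ x : ℝ) (β : ℤ → ℤ → ℝ) (l : ℝ) :
    Measurable (rescaledRow q₁ q₂ x β l) := by
  have h1 : Measurable fun u : ℝ × ℝ => (⌈l * u.1⌉, ⌈l ^ (q₁ / q₂) * u.2⌉) := by fun_prop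
  have h2 : Measurable fun r : ℤ × ℤ =>
      l ^ (q₁ - 1) * ∑ t ∈ Finset.Ioc (0 : ℤ) ⌊l * x⌋, β (t - r.1) (-r.2) := .of_discrete
  exact h2.comp h1

lemma rescaledRow_eq_integral {l : ℝ} (hl : 0 < l) (x : ℝ) (u : ℝ × ℝ) :
    rescaledRow q₁ q₂ x β l u
      = ∫ y, l ^ q₁ * β (⌈l * y⌉ - ⌈l * u.1⌉) (-⌈l ^ (q₁ / q₂) * u.2⌉) *
        cellInd l x (0 + ⌈l * y⌉) := by
  have h := integral_comp_ceil 0 hl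
    (fun t => l ^ q₁ * β (t - ⌈l * u.1⌉) (-⌈l ^ (q₁ / q₂) * u.2⌉) * cellInd l x (0 + t))
    (Finset.Ioc (0 : ℤ) ⌊l * x⌋) (fun r hr => by
      rw [Finset.mem_Ioc] at hr
      rw [zero_add, cellInd, if_neg hr, mul_zero])
  simp only [zero_add] at h ⊢
  rw [h, rescaledRow, Finset.mul_sum, Finset.mul_sum]
  refine Finset.sum_congr rfl fun t ht => ?_
  have h1 : cellInd l x t = 1 := if_pos (Finset.mem_Ioc.1 ht)
  rw [h1, Real.rpow_sub hl, Real.rpow_one]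
  field_simp

lemma enorm_cellInd_le {l x : ℝ} (hl : 0 < l) (y : ℝ) :
    ‖cellInd l x (0 + ⌈l * y⌉)‖ₑ ≤ ‖iocInd x y‖ₑ := by
  by_cases h : cellInd l x (0 + ⌈l * y⌉) = 0
  · rw [h, enorm_zero]
    exact zero_le
  · have h1 := bounds_of_cellInd_ne_zero hl h
    simp only [Int.cast_zero, zero_div, neg_zero, sub_zero] at h1
    have h2 : iocInd x y = 1 := if_pos h1
    rw [h2, (cellInd_eq_zero_or_one l x _).resolve_left h]

lemma abs_ceil_sub_ceil_le (x y : ℝ) : |((⌈x⌉ - ⌈y⌉ : ℤ) : ℝ) - (x - y)| ≤ 2 := by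
  push_cast
  rw [abs_le]
  constructor <;> linarith [Int.le_ceil x, Int.ceil_lt_add_one x, Int.le_ceil y,
    Int.ceil_lt_add_one y]

lemma tendsto_rescaledRow_apply (hβ : IsLatticeKernel q₁ q₂ a c₁₁ c₁₂ 0 c₂₂ β)
    (ha : IsAnisotropicKernel q₁ q₂ a) (hq₁ : 0 < q₁) (hq : q₁ < q₂) (h₁₁ : c₁₁ ≠ 0)
    (h₂₂ : c₂₂ ≠ 0) (x : ℝ) {u : ℝ × ℝ} (hu : u.2 ≠ 0) :
    Tendsto (fun l => rescaledRow q₁ q₂ x β l u) atTop (𝓝 (lineKernel a c₁₁ c₂₂ x u)) := by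
  have hdet : c₁₁ * c₂₂ - c₁₂ * 0 ≠ 0 := by
    rw [mul_zero, sub_zero]; exact mul_ne_zero h₁₁ h₂₂
  obtain ⟨C, hC0, hC⟩ := hβ.rescaled_bound hq₁ hq hdet h₂₂
  have e1 : ∀ l y : ℝ, |((⌈l * y⌉ - ⌈l * u.1⌉ : ℤ) : ℝ) - l * (y - u.1)| ≤ 2 := by
    intro l y
    rw [mul_sub]
    exact abs_ceil_sub_ceil_le _ _
  have e2 : ∀ l w : ℝ, |((-⌈l ^ (q₁ / q₂) * u.2⌉ : ℤ) : ℝ) -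
      (-(0 / c₂₂) * (l * w) + l ^ (q₁ / q₂) * -u.2)| ≤ 2 := by
    intro l w
    have := abs_ceil_sub_ceil_le 0 (l ^ (q₁ / q₂) * u.2)
    simpa using this
  have h1 : ∀ᶠ l in atTop, rescaledRow q₁ q₂ x β l u
      = ∫ y, l ^ q₁ * β (⌈l * y⌉ - ⌈l * u.1⌉) (-⌈l ^ (q₁ / q₂) * u.2⌉) *
        cellInd l x (0 + ⌈l * y⌉) := by
    filter_upwards [eventually_gt_atTop 0] with l hl using rescaledRow_eq_integral hl x u
  refine Tendsto.congr' (h1.mono fun l hl => hl.symm) ?_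
  have hu' : 0 < |u.2| ^ q₂ := Real.rpow_pos_of_pos (abs_pos.2 hu) _
  refine tendsto_integral_filter_of_dominated_convergence
    (fun y => C / |u.2| ^ q₂ * iocInd x y) ?_ ?_ ?_ ?_
  · refine Eventually.of_forall fun l => Measurable.aestronglyMeasurable ?_
    have h2 : Measurable fun t : ℤ => l ^ q₁ * β (t - ⌈l * u.1⌉) (-⌈l ^ (q₁ / q₂) * u.2⌉) *
        cellInd l x (0 + t) := .of_discrete
    exact h2.comp (by fun_prop : Measurable fun y : ℝ => ⌈l * y⌉)
  · filter_upwards [eventually_gt_atTop 0] with l hl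
    refine Eventually.of_forall fun y => ?_
    have h2 := hC l hl (y - u.1) (-u.2) _ _ (e1 l y) (e2 l _)
    have h3 : ‖cellInd l x (0 + ⌈l * y⌉)‖ ≤ iocInd x y := by
      have := enorm_cellInd_le (x := x) hl y
      rw [← ofReal_norm, ← ofReal_norm, ENNReal.ofReal_le_ofReal_iff (norm_nonneg _)] at this
      refine this.trans (le_of_eq ?_)
      rcases iocInd_eq_zero_or_one x y with h | h <;> simp [h]
    rw [norm_mul]
    refine mul_le_mul ?_ h3 (norm_nonneg _) (by positivity)
    rw [Real.norm_eq_abs, abs_mul, abs_of_nonneg (by positivity : 0 ≤ l ^ q₁), le_div_iff₀ hu']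
    refine le_trans ?_ h2
    gcongr
    unfold gauge
    rw [abs_neg]
    linarith [Real.rpow_nonneg (abs_nonneg (y - u.1)) q₁]
  · refine Integrable.const_mul ⟨(measurable_iocInd x).aestronglyMeasurable, ?_⟩ _
    have := lintegral_enorm_iocInd (x := x) 0
    simp only [add_zero] at this
    rw [HasFiniteIntegral, this]
    exact ENNReal.ofReal_lt_top
  · have hae : ∀ᵐ y : ℝ, y ≠ u.1 ∧ y ≠ 0 ∧ y ≠ x := by
      have h1 : ∀ c : ℝ, ∀ᵐ v : ℝ, v ≠ c := fun c => by simp [ae_iff]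
      filter_upwards [h1 u.1, h1 0, h1 x] with v a b c using ⟨a, b, c⟩
    filter_upwards [hae] with y hy
    have t1 := hβ.rescaled_tendsto ha hq₁ hq hdet h₂₂ tendsto_id (w := y - u.1) (z := -u.2)
      (sub_ne_zero.2 hy.1) (r₁ := fun l => ⌈l * y⌉ - ⌈l * u.1⌉)
      (r₂ := fun l => -⌈l ^ (q₁ / q₂) * u.2⌉) (fun l => e1 l y) (fun l => e2 l _)
    have e3 : (c₁₁ * c₂₂ - c₁₂ * 0) / c₂₂ = c₁₁ := by
      rw [mul_zero, sub_zero, mul_div_cancel_right₀ _ h₂₂]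
    rw [e3] at t1
    have t2 := tendsto_cellInd (m := id) (i := fun _ => 0) (s := 0) (x := x) (u := y) tendsto_id
      (by simp) (by simpa using hy.2.1) (by simpa using hy.2.2)
    rw [add_zero] at t2
    exact t1.mul t2

lemma tendsto_rescaledRow (hβ : IsLatticeKernel q₁ q₂ a c₁₁ c₁₂ 0 c₂₂ β)
    (ha : IsAnisotropicKernel q₁ q₂ a) (hq₁ : 0 < q₁) (hq : q₁ < q₂) (hq₂ : 1 < q₂)
    (hκ0 : 1 / 2 < q₁ - q₁ / q₂) (hQ : 1 / q₁ + 1 / q₂ < 2) (hQt : 1 < 1 / q₁ + 1 / (2 * q₂))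
    (h₁₁ : c₁₁ ≠ 0) (h₂₂ : c₂₂ ≠ 0) (x : ℝ) :
    Tendsto (fun l => eLpNorm (fun u => rescaledRow q₁ q₂ x β l u - lineKernel a c₁₁ c₂₂ x u) 2)
      atTop (𝓝 0) := by
  rw [tendsto_eLpNorm_two_iff]
  have hdet : c₁₁ * c₂₂ - c₁₂ * 0 ≠ 0 := by
    rw [mul_zero, sub_zero]; exact mul_ne_zero h₁₁ h₂₂
  obtain ⟨Cb, hCb0, hCb⟩ := hβ.rescaled_bound hq₁ hq hdet h₂₂
  obtain ⟨Ca, hCa0, hCa⟩ := ha.exists_abs_comp_mul_gauge_le h₁₁ h₂₂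
  have hfin := lintegral_lineMass_sq_lt_top hq₁ hq₂ hκ0 hQ hQt x
  rw [← lintegral_zero (μ := (volume : Measure (ℝ × ℝ)))]
  refine tendsto_lintegral_filter_of_dominated_convergence
    (fun u => (ENNReal.ofReal Cb + ENNReal.ofReal Ca) ^ 2 * lineMass q₁ q₂ x u ^ 2)
    (Eventually.of_forall fun l => ((measurable_rescaledRow q₁ q₂ x β l).sub
      (measurable_lineKernel ha c₁₁ c₂₂ x)).enorm.pow_const 2) ?_ ?_ ?_
  · filter_upwards [eventually_gt_atTop 0] with l hl
    filter_upwards [ae_snd_ne_zero] with u hu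
    have hrow : ‖rescaledRow q₁ q₂ x β l u‖ₑ ≤ ENNReal.ofReal Cb * lineMass q₁ q₂ x u := by
      rw [rescaledRow_eq_integral hl, lineMass, ← lintegral_const_mul' _ _ ENNReal.ofReal_ne_top]
      refine (enorm_integral_le_lintegral_enorm _).trans (lintegral_mono fun y => ?_)
      have h2 := hCb l hl (y - u.1) (-u.2) (⌈l * y⌉ - ⌈l * u.1⌉) (-⌈l ^ (q₁ / q₂) * u.2⌉)
        (by rw [mul_sub]; exact abs_ceil_sub_ceil_le _ _) (by
          have := abs_ceil_sub_ceil_le 0 (l ^ (q₁ / q₂) * u.2)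
          simpa using this)
      refine (ofReal_mul_inv_gauge (q₁ := q₁) (q₂ := q₂) (C := Cb) (w := y - u.1)
        (neg_ne_zero.2 hu) ?_).trans ?_
      · rwa [abs_mul, abs_of_nonneg (by positivity : 0 ≤ l ^ q₁)]
      · gcongr
        exact enorm_cellInd_le hl y
    rw [← mul_pow]
    gcongr
    refine enorm_sub_le.trans ?_
    rw [add_mul]
    exact add_le_add hrow (enorm_lineKernel_le hCa x hu)
  · rw [lintegral_const_mul' _ _ (by finiteness)]
    exact (ENNReal.mul_lt_top (by finiteness) hfin).ne
  · filter_upwards [ae_snd_ne_zero] with u hu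
    have := ENNReal.Tendsto.pow (n := 2) ((tendsto_rescaledRow_apply hβ ha hq₁ hq h₁₁ h₂₂ x
      hu).sub_const (lineKernel a c₁₁ c₂₂ x u)).enorm
    simpa using this

lemma rescaled_boxSum_eq_sum_rescaledRow {l γ : ℝ} (hl : 0 < l) (x₁ x₂ : ℝ) (u : ℝ × ℝ) :
    l ^ (q₁ - 1 - γ) * boxSum β (l * x₁) (l ^ γ * x₂) ⌈l * u.1⌉ ⌈l ^ (q₁ / q₂) * u.2⌉
      = (l ^ γ)⁻¹ * ∑ k ∈ Finset.Ioc (0 : ℤ) ⌊l ^ γ * x₂⌋,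
        rescaledRow q₁ q₂ x₁ β l ((0, -(k / l ^ (q₁ / q₂))) + u) := by
  have hζ : 0 < l ^ (q₁ / q₂) := by positivity
  have h1 : ∀ k : ℤ, -⌈l ^ (q₁ / q₂) * (-(k / l ^ (q₁ / q₂)) + u.2)⌉
      = k - ⌈l ^ (q₁ / q₂) * u.2⌉ := by
    intro k
    have : l ^ (q₁ / q₂) * (-(k / l ^ (q₁ / q₂)) + u.2) = l ^ (q₁ / q₂) * u.2 - k := by
      field_simp
      ring
    rw [this, Int.ceil_sub_intCast]
    ring
  simp only [rescaledRow, Prod.fst_add, Prod.snd_add, zero_add, h1]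
  rw [boxSum, Finset.sum_comm, ← Finset.mul_sum, ← mul_assoc, Real.rpow_sub hl (q₁ - 1),
    div_eq_inv_mul]

/-- On rectangles which are short in the second direction, the rows of the lattice are not resolved
in the limit: all of them contribute the same integral along a segment. -/
theorem tendsto_rescaled_boxSum_row (hβ : IsLatticeKernel q₁ q₂ a c₁₁ c₁₂ 0 c₂₂ β)
    (ha : IsAnisotropicKernel q₁ q₂ a) (hq₁ : 0 < q₁) (hq : q₁ < q₂) (hq₂ : 1 < q₂)
    (hκ0 : 1 / 2 < q₁ - q₁ / q₂) (hQ : 1 / q₁ + 1 / q₂ < 2) (hQt : 1 < 1 / q₁ + 1 / (2 * q₂))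
    (h₁₁ : c₁₁ ≠ 0) (h₂₂ : c₂₂ ≠ 0) {γ : ℝ} (hγ0 : 0 < γ) (hγ : γ < q₁ / q₂) (x₁ : ℝ) {x₂ : ℝ}
    (hx₂ : 0 < x₂) :
    Tendsto (fun l : ℝ => ∫⁻ u : ℝ × ℝ, ‖l ^ (q₁ - 1 - γ) *
      boxSum β (l * x₁) (l ^ γ * x₂) ⌈l * u.1⌉ ⌈l ^ (q₁ / q₂) * u.2⌉ -
        x₂ * lineKernel a c₁₁ c₂₂ x₁ u‖ₑ ^ 2) atTop (𝓝 0) := by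
  rw [← tendsto_eLpNorm_two_iff]
  have hrow := tendsto_rescaledRow hβ ha hq₁ hq hq₂ hκ0 hQ hQt h₁₁ h₂₂ x₁
  have hGm := memLp_lineKernel ha hq₁ hq₂ hκ0 hQ hQt h₁₁ h₂₂ x₁
  obtain ⟨G, hG⟩ : ∃ G, G = lineKernel a c₁₁ c₂₂ x₁ := ⟨_, rfl⟩
  obtain ⟨F, hF⟩ : ∃ F, F = rescaledRow q₁ q₂ x₁ β := ⟨_, rfl⟩
  have hFm : ∀ l, AEStronglyMeasurable (F l) := fun l => by
    rw [hF]; exact (measurable_rescaledRow _ _ _ _ _).aestronglyMeasurable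
  simp only [← hG, ← hF] at hrow hGm ⊢
  have hω := tendsto_eLpNorm_translate hGm
  obtain ⟨ω, hωd⟩ : ∃ ω : ℝ × ℝ → ℝ≥0∞, ω = fun v => eLpNorm (fun u => G (v + u) - G u) 2 :=
    ⟨_, rfl⟩
  rw [← hωd] at hω
  obtain ⟨N, hN⟩ : ∃ N : ℝ → ℤ, N = fun l => ⌊l ^ γ * x₂⌋ := ⟨_, rfl⟩
  obtain ⟨v, hv⟩ : ∃ v : ℝ → ℤ → ℝ × ℝ,
      v = fun (l : ℝ) (k : ℤ) => ((0 : ℝ), -((k : ℝ) / l ^ (q₁ / q₂))) := ⟨_, rfl⟩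
  -- the moduli of continuity along the shifts vanish uniformly
  have hsup : Tendsto (fun l => ⨆ k ∈ Finset.Ioc (0 : ℤ) (N l), ω (v l k)) atTop (𝓝 0) := by
    rw [ENNReal.tendsto_nhds_zero]
    intro ε hε
    have h1 := ENNReal.tendsto_nhds_zero.1 hω ε hε
    rw [Metric.eventually_nhds_iff] at h1
    obtain ⟨δ, hδ, h1⟩ := h1
    have h2 : Tendsto (fun l : ℝ => x₂ * l ^ (-(q₁ / q₂ - γ))) atTop (𝓝 0) := by
      simpa using (tendsto_rpow_neg_atTop (sub_pos.2 hγ)).const_mul x₂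
    filter_upwards [h2.eventually_lt_const hδ, eventually_gt_atTop 0] with l hl hl0
    refine iSup₂_le fun k hk => h1 ?_
    rw [Finset.mem_Ioc, hN, Int.le_floor] at hk
    have hk0 : (0 : ℝ) < k := by exact_mod_cast hk.1
    have hζ : 0 < l ^ (q₁ / q₂) := by positivity
    rw [dist_zero_right, hv, Prod.norm_def, norm_zero, max_eq_right (norm_nonneg _), norm_neg,
      Real.norm_eq_abs, abs_of_pos (by positivity)]
    refine lt_of_le_of_lt ?_ hl
    rw [div_le_iff₀ hζ, mul_assoc, ← Real.rpow_add hl0]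
    have : -(q₁ / q₂ - γ) + q₁ / q₂ = γ := by ring
    rw [this, mul_comm]
    exact hk.2
  have hN1 : Tendsto (fun l => (l ^ γ)⁻¹ * (N l : ℝ) - x₂) atTop (𝓝 0) := by
    have := (tendsto_floor_div (tendsto_rpow_atTop hγ0) x₂).sub_const x₂
    rw [sub_self] at this
    refine this.congr fun l => ?_
    rw [hN, div_eq_inv_mul]
  have hbound : Tendsto (fun l => ENNReal.ofReal x₂ * (eLpNorm (fun u => F l u - G u) 2 +
      ⨆ k ∈ Finset.Ioc (0 : ℤ) (N l), ω (v l k)) + ‖(l ^ γ)⁻¹ * (N l : ℝ) - x₂‖ₑ * eLpNorm G 2)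
      atTop (𝓝 0) := by
    have h1 := ENNReal.Tendsto.const_mul (a := ENNReal.ofReal x₂) (hrow.add hsup)
      (Or.inr ENNReal.ofReal_ne_top)
    have hG2 : eLpNorm G 2 volume ≠ ⊤ := hGm.2.ne
    generalize eLpNorm G 2 volume = A at hG2 ⊢
    have h2 := ENNReal.Tendsto.mul_const (b := A) hN1.enorm (Or.inr hG2)
    simpa using h1.add h2
  refine tendsto_of_tendsto_of_tendsto_of_le_of_le' tendsto_const_nhds hbound
    (Eventually.of_forall fun _ => zero_le) ?_
  filter_upwards [eventually_gt_atTop 0] with l hl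
  have hlγ : 0 < l ^ γ := by positivity
  have hN0 : 0 ≤ N l := by
    rw [hN]; exact Int.floor_nonneg.2 (by positivity)
  have hcard : ((Finset.Ioc (0 : ℤ) (N l)).card : ℝ) = N l := by
    rw [Int.card_Ioc, sub_zero]
    exact_mod_cast Int.toNat_of_nonneg hN0
  have key := eLpNorm_average_translate_sub_le (hFm l) hGm.1 (Finset.Ioc (0 : ℤ) (N l)) (v l)
    (c := (l ^ γ)⁻¹) (x := x₂) (by positivity) (by
      rw [hcard, inv_mul_le_iff₀ hlγ, hN]
      exact Int.floor_le _)
  rw [hcard] at key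
  simp only [hωd]
  refine le_trans (le_of_eq ?_) key
  congr 1
  ext u
  rw [rescaled_boxSum_eq_sum_rescaledRow hl, ← hF]
  simp only [hv, hN]

end Line

/-! ### Self-similar kernels with stationary increments -/

lemma map_scale_prod {α δ : ℝ} (hα : α ≠ 0) (hδ : δ ≠ 0) :
    Measure.map (fun p : ℝ × ℝ => (α * p.1, δ * p.2)) volume
      = ENNReal.ofReal |α * δ|⁻¹ • (volume : Measure (ℝ × ℝ)) := by
  have h : (fun p : ℝ × ℝ => (α * p.1, δ * p.2)) = Prod.map (α * ·) (δ * ·) := rfl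
  rw [h, Measure.volume_eq_prod, ← Measure.map_prod_map _ _ (by fun_prop) (by fun_prop),
    Real.map_volume_mul_left hα, Real.map_volume_mul_left hδ, Measure.prod_smul_left,
    Measure.prod_smul_right, smul_smul, ← ENNReal.ofReal_mul (abs_nonneg _), abs_inv, abs_inv,
    abs_mul, mul_inv]

lemma measurableEmbedding_scale_prod {α δ : ℝ} (hα : α ≠ 0) (hδ : δ ≠ 0) :
    MeasurableEmbedding fun p : ℝ × ℝ => (α * p.1, δ * p.2) :=
  ((Homeomorph.mulLeft₀ α hα).prodCongr (Homeomorph.mulLeft₀ δ hδ)).measurableEmbedding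

lemma integral_scale_prod {α δ : ℝ} (hα : α ≠ 0) (hδ : δ ≠ 0) (F : ℝ × ℝ → ℝ) :
    ∫ p : ℝ × ℝ, F (α * p.1, δ * p.2) = |α * δ|⁻¹ * ∫ p, F p := by
  rw [← (measurableEmbedding_scale_prod hα hδ).integral_map F, map_scale_prod hα hδ,
    integral_smul_measure, ENNReal.toReal_ofReal (by positivity), smul_eq_mul]

lemma integrable_scale_prod {α δ : ℝ} (hα : α ≠ 0) (hδ : δ ≠ 0) {F : ℝ × ℝ → ℝ} :
    (Integrable fun p : ℝ × ℝ => F (α * p.1, δ * p.2)) ↔ Integrable F := by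
  have h := (measurableEmbedding_scale_prod hα hδ).integrable_map_iff (μ := volume) (g := F)
  rw [map_scale_prod hα hδ, integrable_smul_measure (by simp [hα, hδ]) ENNReal.ofReal_ne_top] at h
  exact h.symm

lemma memLp_two_scale_prod {α δ : ℝ} (hα : α ≠ 0) (hδ : δ ≠ 0) {F : ℝ × ℝ → ℝ}
    (hF : MemLp F 2) : MemLp (fun p : ℝ × ℝ => F (α * p.1, δ * p.2)) 2 := by
  have h := hF.smul_measure (c := ENNReal.ofReal |α * δ|⁻¹) ENNReal.ofReal_ne_top
  rw [← map_scale_prod hα hδ] at h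
  exact h.comp_of_map (measurableEmbedding_scale_prod hα hδ).measurable.aemeasurable

/-- The covariance of a self-similar field with stationary increments, by polarization. -/
lemma integral_mul_of_selfSimilar {α : Type*} [MeasurableSpace α] {μ : Measure α}
    {K : ℝ → α → ℝ} (hK : ∀ x, MemLp (K x) 2 μ) {h : ℝ} (hh : h ≠ 0)
    (hscale : ∀ x, 0 < x → ∫ u, K x u ^ 2 ∂μ = x ^ h * ∫ u, K 1 u ^ 2 ∂μ)
    (hinc : ∀ x y, 0 < x → x < y → ∫ u, (K y u - K x u) ^ 2 ∂μ = ∫ u, K (y - x) u ^ 2 ∂μ)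
    {x y : ℝ} (hx : 0 < x) (hy : 0 < y) :
    ∫ u, K x u * K y u ∂μ
      = (∫ u, K 1 u ^ 2 ∂μ) * (1 / 2 * (x ^ h + y ^ h - |x - y| ^ h)) := by
  have main : ∀ {x y : ℝ}, 0 < x → x < y → ∫ u, K x u * K y u ∂μ
      = (∫ u, K 1 u ^ 2 ∂μ) * (1 / 2 * (x ^ h + y ^ h - |x - y| ^ h)) := by
    intro x y hx hxy
    have i1 := (hK x).integrable_sq
    have i2 := (hK y).integrable_sq
    have i3 : Integrable (fun u => K x u * K y u) μ := (hK x).integrable_mul (hK y)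
    have e1 := hinc x y hx hxy
    have e2 : ∫ u, (K y u - K x u) ^ 2 ∂μ
        = (∫ u, K y u ^ 2 ∂μ) + (∫ u, K x u ^ 2 ∂μ) - 2 * ∫ u, K x u * K y u ∂μ := by
      have i4 : Integrable (fun u => K y u ^ 2 + K x u ^ 2) μ := i2.add i1
      rw [← integral_add i2 i1, ← integral_const_mul, ← integral_sub i4 (i3.const_mul 2)]
      refine integral_congr_ae (Eventually.of_forall fun u => ?_)
      simp only
      ring
    rw [e2, hscale x hx, hscale y (hx.trans hxy), hscale (y - x) (sub_pos.2 hxy)] at e1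
    rw [abs_sub_comm, abs_of_pos (sub_pos.2 hxy)]
    linarith
  rcases lt_trichotomy x y with hxy | hxy | hxy
  · exact main hx hxy
  · subst hxy
    rw [sub_self, abs_zero, Real.zero_rpow hh, sub_zero]
    simp_rw [← sq]
    rw [hscale x hx]
    ring
  · simp_rw [mul_comm (K x _)]
    rw [main hy hxy, abs_sub_comm]
    ring

lemma iocInd_sub {x y : ℝ} (hx : 0 ≤ x) (hxy : x ≤ y) (w : ℝ) :
    iocInd y w - iocInd x w = iocInd (y - x) (w - x) := by
  unfold iocInd
  by_cases h1 : 0 < w <;> by_cases h2 : w ≤ x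
  · rw [if_pos ⟨h1, h2.trans hxy⟩, if_pos ⟨h1, h2⟩, if_neg (by intro h; linarith [h.1]), sub_self]
  · by_cases h3 : w ≤ y
    · rw [if_pos ⟨h1, h3⟩, if_neg (fun h => h2 h.2), if_pos ⟨by linarith, by linarith⟩, sub_zero]
    · rw [if_neg (fun h => h3 h.2), if_neg (fun h => h2 h.2), if_neg (fun h => h3 (by linarith [h.2])),
        sub_zero]
  · rw [if_neg (fun h => h1 h.1), if_neg (fun h => h1 h.1), if_neg (by intro h; linarith [h.1]),
      sub_zero]
  · exact absurd (hx.trans (not_le.1 h2).le) (fun h => h2 (by linarith [not_lt.1 h1]))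

lemma iocInd_mul {c : ℝ} (hc : 0 < c) (x w : ℝ) : iocInd (c * x) (c * w) = iocInd x w := by
  unfold iocInd
  simp only [mul_pos_iff_of_pos_left hc, mul_le_mul_iff_right₀ hc]

lemma integral_iocInd_mul {x y : ℝ} (hx : 0 < x) (hy : 0 < y) :
    ∫ v, iocInd x v * iocInd y v = 1 / 2 * (x + y - |x - y|) := by
  have h1 : ∀ v, iocInd x v * iocInd y v = (Set.Ioc 0 (min x y)).indicator (fun _ => (1 : ℝ)) v := by
    intro v
    unfold iocInd
    by_cases h : v ∈ Set.Ioc 0 (min x y)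
    · rw [Set.indicator_of_mem h]
      rw [Set.mem_Ioc, le_min_iff] at h
      rw [if_pos ⟨h.1, h.2.1⟩, if_pos ⟨h.1, h.2.2⟩, one_mul]
    · rw [Set.indicator_of_notMem h]
      rw [Set.mem_Ioc, le_min_iff] at h
      by_cases h1 : 0 < v ∧ v ≤ x
      · rw [if_neg (c := 0 < v ∧ v ≤ y) (fun h2 => h ⟨h1.1, h1.2, h2.2⟩), mul_zero]
      · rw [if_neg h1, zero_mul]
  simp_rw [h1]
  rw [integral_indicator measurableSet_Ioc, setIntegral_const, measureReal_def, Real.volume_Ioc,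
    sub_zero, ENNReal.toReal_ofReal (by positivity), smul_eq_mul, mul_one]
  rcases le_total x y with h | h
  · rw [min_eq_left h, abs_of_nonpos (by linarith)]; ring
  · rw [min_eq_right h, abs_of_nonneg (by linarith)]; ring

section SelfSimilar

variable {q₁ q₂ : ℝ} {a : ℝ → ℝ → ℝ}

/-- The integral of the kernel over a vertical strip of width `x`. -/
noncomputable def bandKernel (a : ℝ → ℝ → ℝ) (α δ x v : ℝ) : ℝ :=
  ∫ p : ℝ × ℝ, a (α * p.1) (δ * p.2) * iocInd x (v + p.1)

lemma stripKernel_zero_zero (a : ℝ → ℝ → ℝ) (α δ x₁ x₂ : ℝ) (u : ℝ × ℝ) :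
    stripKernel a α δ 0 0 x₁ x₂ u = bandKernel a α δ x₁ u.1 * iocInd x₂ u.2 := by
  simp only [stripKernel, bandKernel, zero_mul, neg_zero, add_zero, ← mul_assoc]
  rw [integral_mul_const]

lemma integrable_bandKernel_integrand (ha : IsAnisotropicKernel q₁ q₂ a) (hq₂ : 1 < q₂)
    (hκ0 : 0 < q₁ - q₁ / q₂) (hκ : q₁ - q₁ / q₂ < 1) {α δ : ℝ} (hα : α ≠ 0) (hδ : δ ≠ 0)
    (x v : ℝ) : Integrable fun p : ℝ × ℝ => a (α * p.1) (δ * p.2) * iocInd x (v + p.1) := by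
  have h := integrable_stripKernel_integrand ha hq₂ hκ0 hκ hα hδ 0 0 x 1 (v, 1)
  have h1 : iocInd 1 1 = 1 := if_pos (by norm_num)
  simpa [h1] using h

lemma measurable_bandKernel (ha : IsAnisotropicKernel q₁ q₂ a) (α δ x : ℝ) :
    Measurable (bandKernel a α δ x) := by
  have h : bandKernel a α δ x = fun v => stripKernel a α δ 0 0 x 1 (v, 1) := by
    ext v
    have h1 : iocInd 1 1 = 1 := if_pos (by norm_num)
    rw [stripKernel_zero_zero, h1, mul_one]
  rw [h]
  exact (measurable_stripKernel ha α δ 0 0 x 1).comp (by fun_prop)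

lemma memLp_bandKernel (ha : IsAnisotropicKernel q₁ q₂ a) (hq₂ : 1 < q₂)
    (hκ0 : 1 / 2 < q₁ - q₁ / q₂) (hκ : q₁ - q₁ / q₂ < 1) {α δ : ℝ} (hα : α ≠ 0) (hδ : δ ≠ 0)
    (x : ℝ) : MemLp (bandKernel a α δ x) 2 := by
  have hm := measurable_bandKernel ha α δ x
  refine memLp_two_of_lintegral_sq_lt_top hm.aestronglyMeasurable ?_
  have h := (memLp_stripKernel ha hq₂ hκ0 hκ hα hδ 0 0 x 1).2
  have h2 : eLpNorm (stripKernel a α δ 0 0 x 1) 2 volume ^ 2 < ⊤ := ENNReal.pow_lt_top h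
  rw [eLpNorm_two_sq] at h2
  simp only [stripKernel_zero_zero, enorm_mul, mul_pow] at h2
  rw [Measure.volume_eq_prod, lintegral_prod_mul (hm.enorm.pow_const 2).aemeasurable
    ((measurable_iocInd 1).enorm.pow_const 2).aemeasurable] at h2
  have h3 : ∫⁻ v, ‖iocInd 1 v‖ₑ ^ 2 = 1 := by
    have := lintegral_enorm_iocInd (x := 1) 0
    simp only [add_zero, ENNReal.ofReal_one] at this
    rw [← this]
    refine lintegral_congr fun v => ?_
    rcases iocInd_eq_zero_or_one 1 v with h | h <;> simp [h]
  rwa [h3, mul_one] at h2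

lemma bandKernel_scale (ha : IsAnisotropicKernel q₁ q₂ a) (α δ x v : ℝ) {c : ℝ} (hc : 0 < c) :
    bandKernel a α δ (c * x) (c * v) = c ^ (1 - (q₁ - q₁ / q₂)) * bandKernel a α δ x v := by
  have hζ : 0 < c ^ (q₁ / q₂) := by positivity
  have h := integral_scale_prod hc.ne' hζ.ne'
    (fun p : ℝ × ℝ => a (α * p.1) (δ * p.2) * iocInd (c * x) (c * v + p.1))
  simp only [← mul_add, iocInd_mul hc] at h
  have h1 : ∀ p : ℝ × ℝ, a (α * (c * p.1)) (δ * (c ^ (q₁ / q₂) * p.2))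
      = c ^ (-q₁) * a (α * p.1) (δ * p.2) := by
    intro p
    rw [← ha.homog c hc, mul_left_comm, mul_left_comm δ]
  simp only [h1, mul_assoc] at h
  rw [integral_const_mul] at h
  have h2 : c * c ^ (q₁ / q₂) ≠ 0 := by positivity
  have h3 : bandKernel a α δ (c * x) (c * v)
      = c * c ^ (q₁ / q₂) * (c ^ (-q₁) * bandKernel a α δ x v) := by
    unfold bandKernel
    rw [h, abs_of_pos (by positivity), ← mul_assoc, mul_inv_cancel₀ h2, one_mul]
  rw [h3, ← mul_assoc]
  congr 1
  nth_rewrite 1 [← Real.rpow_one c]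
  rw [← Real.rpow_add hc, ← Real.rpow_add hc]
  congr 1
  ring

lemma integral_bandKernel_sq (ha : IsAnisotropicKernel q₁ q₂ a) (α δ : ℝ) {x : ℝ} (hx : 0 < x) :
    ∫ v, bandKernel a α δ x v ^ 2
      = x ^ (3 - 2 * (q₁ - q₁ / q₂)) * ∫ v, bandKernel a α δ 1 v ^ 2 := by
  have h := Measure.integral_comp_mul_left (fun v => bandKernel a α δ x v ^ 2) x
  rw [abs_of_pos (inv_pos.2 hx), smul_eq_mul] at h
  have h1 : ∀ v, bandKernel a α δ x (x * v) ^ 2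
      = (x ^ (1 - (q₁ - q₁ / q₂))) ^ 2 * bandKernel a α δ 1 v ^ 2 := by
    intro v
    have := bandKernel_scale ha α δ 1 v hx
    rw [mul_one] at this
    rw [this, mul_pow]
  simp only [h1] at h
  rw [integral_const_mul] at h
  have h2 : ∫ v, bandKernel a α δ x v ^ 2
      = x * ((x ^ (1 - (q₁ - q₁ / q₂))) ^ 2 * ∫ v, bandKernel a α δ 1 v ^ 2) := by
    rw [h, mul_inv_cancel_left₀ hx.ne']
  rw [h2, ← mul_assoc]
  congr 1
  rw [← Real.rpow_natCast, ← Real.rpow_mul hx.le]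
  nth_rewrite 1 [← Real.rpow_one x]
  rw [← Real.rpow_add hx]
  congr 1
  push_cast
  ring

lemma integral_bandKernel_sub_sq (ha : IsAnisotropicKernel q₁ q₂ a) (hq₂ : 1 < q₂)
    (hκ0 : 0 < q₁ - q₁ / q₂) (hκ : q₁ - q₁ / q₂ < 1) {α δ : ℝ} (hα : α ≠ 0) (hδ : δ ≠ 0)
    {x y : ℝ} (hx : 0 < x) (hxy : x < y) :
    ∫ v, (bandKernel a α δ y v - bandKernel a α δ x v) ^ 2
      = ∫ v, bandKernel a α δ (y - x) v ^ 2 := by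
  have h1 : ∀ v, bandKernel a α δ y v - bandKernel a α δ x v = bandKernel a α δ (y - x) (v - x) := by
    intro v
    unfold bandKernel
    rw [← integral_sub (integrable_bandKernel_integrand ha hq₂ hκ0 hκ hα hδ y v)
      (integrable_bandKernel_integrand ha hq₂ hκ0 hκ hα hδ x v)]
    refine integral_congr_ae (Eventually.of_forall fun p => ?_)
    simp only
    rw [← mul_sub, iocInd_sub hx.le hxy.le, add_sub_right_comm]
  simp_rw [h1]
  exact integral_sub_right_eq_self (fun v => bandKernel a α δ (y - x) v ^ 2) x

/-- Covariance of the kernels of the limit fields in the unbalanced regime: a fractional Brownian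
motion in the first and a Brownian motion in the second coordinate. -/
lemma integral_stripKernel_mul (ha : IsAnisotropicKernel q₁ q₂ a) (hq₂ : 1 < q₂)
    (hκ0 : 1 / 2 < q₁ - q₁ / q₂) (hκ : q₁ - q₁ / q₂ < 1) {α δ : ℝ} (hα : α ≠ 0) (hδ : δ ≠ 0)
    {x₁ x₂ y₁ y₂ : ℝ} (hx₁ : 0 < x₁) (hx₂ : 0 < x₂) (hy₁ : 0 < y₁) (hy₂ : 0 < y₂) :
    ∫ u, stripKernel a α δ 0 0 x₁ x₂ u * stripKernel a α δ 0 0 y₁ y₂ u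
      = (∫ v, bandKernel a α δ 1 v ^ 2) * (1 / 4 *
        ((x₁ ^ (3 - 2 * (q₁ - q₁ / q₂)) + y₁ ^ (3 - 2 * (q₁ - q₁ / q₂))
          - |x₁ - y₁| ^ (3 - 2 * (q₁ - q₁ / q₂))) * (x₂ + y₂ - |x₂ - y₂|))) := by
  simp only [stripKernel_zero_zero, mul_mul_mul_comm]
  rw [Measure.volume_eq_prod, integral_prod_mul (fun v => bandKernel a α δ x₁ v *
    bandKernel a α δ y₁ v) (fun v => iocInd x₂ v * iocInd y₂ v), integral_iocInd_mul hx₂ hy₂,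
    integral_mul_of_selfSimilar (memLp_bandKernel ha hq₂ hκ0 hκ hα hδ)
      (h := 3 - 2 * (q₁ - q₁ / q₂)) (by linarith)
      (fun x hx => integral_bandKernel_sq ha α δ hx)
      (fun x y hx hxy => integral_bandKernel_sub_sq ha hq₂ (by linarith) hκ hα hδ hx hxy) hx₁ hy₁]
  ring

lemma lineKernel_scale (ha : IsAnisotropicKernel q₁ q₂ a) (α δ x : ℝ) (u : ℝ × ℝ) {c : ℝ}
    (hc : 0 < c) :
    lineKernel a α δ (c * x) (c * u.1, c ^ (q₁ / q₂) * u.2)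
      = c ^ (1 - q₁) * lineKernel a α δ x u := by
  have h := Measure.integral_comp_mul_left
    (fun y => a (α * (y - c * u.1)) (δ * -(c ^ (q₁ / q₂) * u.2)) * iocInd (c * x) y) c
  rw [abs_of_pos (inv_pos.2 hc), smul_eq_mul] at h
  have h1 : ∀ y, a (α * (c * y - c * u.1)) (δ * -(c ^ (q₁ / q₂) * u.2)) * iocInd (c * x) (c * y)
      = c ^ (-q₁) * (a (α * (y - u.1)) (δ * -u.2) * iocInd x y) := by
    intro y
    rw [iocInd_mul hc, ← mul_assoc, ← ha.homog c hc]
    congr 2 <;> ring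
  simp only [h1] at h
  rw [integral_const_mul] at h
  have h2 : lineKernel a α δ (c * x) (c * u.1, c ^ (q₁ / q₂) * u.2)
      = c * (c ^ (-q₁) * lineKernel a α δ x u) := by
    unfold lineKernel
    rw [h, mul_inv_cancel_left₀ hc.ne']
  rw [h2, ← mul_assoc]
  congr 1
  nth_rewrite 1 [← Real.rpow_one c]
  rw [← Real.rpow_add hc]
  congr 1

lemma integral_lineKernel_sq (ha : IsAnisotropicKernel q₁ q₂ a) (α δ : ℝ) {x : ℝ} (hx : 0 < x) :
    ∫ u, lineKernel a α δ x u ^ 2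
      = x ^ (3 - 2 * q₁ + q₁ / q₂) * ∫ u, lineKernel a α δ 1 u ^ 2 := by
  have hζ : 0 < x ^ (q₁ / q₂) := by positivity
  have h := integral_scale_prod hx.ne' hζ.ne' (fun u => lineKernel a α δ x u ^ 2)
  have h1 : ∀ u : ℝ × ℝ, lineKernel a α δ x (x * u.1, x ^ (q₁ / q₂) * u.2) ^ 2
      = (x ^ (1 - q₁)) ^ 2 * lineKernel a α δ 1 u ^ 2 := by
    intro u
    have := lineKernel_scale ha α δ 1 u hx
    rw [mul_one] at this
    rw [this, mul_pow]
  simp only [h1] at h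
  rw [integral_const_mul, abs_of_pos (by positivity)] at h
  have h0 : x * x ^ (q₁ / q₂) ≠ 0 := by positivity
  have h2 : ∫ u, lineKernel a α δ x u ^ 2
      = x * x ^ (q₁ / q₂) * ((x ^ (1 - q₁)) ^ 2 * ∫ u, lineKernel a α δ 1 u ^ 2) := by
    rw [h, ← mul_assoc, mul_inv_cancel₀ h0, one_mul]
  rw [h2, ← mul_assoc]
  congr 1
  rw [← Real.rpow_natCast, ← Real.rpow_mul hx.le]
  nth_rewrite 1 [← Real.rpow_one x]
  rw [← Real.rpow_add hx, ← Real.rpow_add hx]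
  congr 1
  push_cast
  ring

lemma integral_lineKernel_sub_sq (ha : IsAnisotropicKernel q₁ q₂ a) {α δ : ℝ} (hα : α ≠ 0)
    (hδ : δ ≠ 0) {x y : ℝ} (hx : 0 < x) (hxy : x < y) :
    ∫ u, (lineKernel a α δ y u - lineKernel a α δ x u) ^ 2
      = ∫ u, lineKernel a α δ (y - x) u ^ 2 := by
  have h1 : ∀ᵐ u : ℝ × ℝ, (lineKernel a α δ y u - lineKernel a α δ x u) ^ 2
      = lineKernel a α δ (y - x) (u - (x, 0)) ^ 2 := by
    filter_upwards [ae_snd_ne_zero] with u hu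
    congr 1
    unfold lineKernel
    rw [← integral_sub (integrable_lineKernel_integrand ha hα hδ y hu)
      (integrable_lineKernel_integrand ha hα hδ x hu), ← integral_add_right_eq_self _ x]
    refine integral_congr_ae (Eventually.of_forall fun t => ?_)
    simp only [Prod.fst_sub, Prod.snd_sub, sub_zero]
    rw [← mul_sub, iocInd_sub hx.le hxy.le, add_sub_cancel_right]
    congr 3
    ring
  rw [integral_congr_ae h1]
  exact integral_sub_right_eq_self (fun u => lineKernel a α δ (y - x) u ^ 2) (x, (0 : ℝ))

/-- Covariance of the kernels of the limit field on short rectangles: a fractional Brownian motion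
in the first coordinate and a linear function in the second. -/
lemma integral_lineKernel_mul (ha : IsAnisotropicKernel q₁ q₂ a) (hq₁ : 0 < q₁) (hq₂ : 1 < q₂)
    (hκ0 : 1 / 2 < q₁ - q₁ / q₂) (hQ : 1 / q₁ + 1 / q₂ < 2) (hQt : 1 < 1 / q₁ + 1 / (2 * q₂))
    {α δ : ℝ} (hα : α ≠ 0) (hδ : δ ≠ 0) (hH : 3 - 2 * q₁ + q₁ / q₂ ≠ 0)
    {x₁ y₁ : ℝ} (x₂ y₂ : ℝ) (hx₁ : 0 < x₁) (hy₁ : 0 < y₁) :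
    ∫ u, (x₂ * lineKernel a α δ x₁ u) * (y₂ * lineKernel a α δ y₁ u)
      = (∫ u, lineKernel a α δ 1 u ^ 2) * (1 / 4 *
        ((x₁ ^ (3 - 2 * q₁ + q₁ / q₂) + y₁ ^ (3 - 2 * q₁ + q₁ / q₂)
          - |x₁ - y₁| ^ (3 - 2 * q₁ + q₁ / q₂)) * (x₂ ^ 2 + y₂ ^ 2 - |x₂ - y₂| ^ 2))) := by
  simp only [mul_mul_mul_comm]
  rw [integral_const_mul, integral_mul_of_selfSimilar
    (memLp_lineKernel ha hq₁ hq₂ hκ0 hQ hQt hα hδ) hH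
    (fun x hx => integral_lineKernel_sq ha α δ hx)
    (fun x y hx hxy => integral_lineKernel_sub_sq ha hα hδ hx hxy) hx₁ hy₁, sq_abs]
  ring

end SelfSimilar

/-! ### The kernels of the limit fields -/

lemma integral_fin_two (F : (Fin 2 → ℝ) → ℝ) : ∫ u, F u = ∫ p : ℝ × ℝ, F ![p.1, p.2] := by
  rw [← (volume_preserving_finTwoArrow ℝ).symm.integral_comp
    (MeasurableEquiv.finTwoArrow (α := ℝ)).symm.measurableEmbedding]
  rfl

lemma integrable_fin_two {F : (Fin 2 → ℝ) → ℝ} :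
    Integrable F ↔ Integrable fun p : ℝ × ℝ => F ![p.1, p.2] :=
  ((volume_preserving_finTwoArrow ℝ).symm.integrable_comp_emb
    (MeasurableEquiv.finTwoArrow (α := ℝ)).symm.measurableEmbedding).symm

lemma memLp_two_fin_two {h : ℝ × ℝ → ℝ} (hh : MemLp h 2) :
    MemLp (fun u : Fin 2 → ℝ => h (u 0, u 1)) 2 :=
  hh.comp_measurePreserving (volume_preserving_finTwoArrow ℝ)

lemma ae_fin_two {p : ℝ × ℝ → Prop} (h : ∀ᵐ u, p u) : ∀ᵐ u : Fin 2 → ℝ, p (u 0, u 1) :=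
  (volume_preserving_finTwoArrow ℝ).quasiMeasurePreserving.ae h

lemma integral_mul_fin_two (h h' : ℝ × ℝ → ℝ) :
    ∫ u : Fin 2 → ℝ, h (u 0, u 1) * h' (u 0, u 1) = ∫ p, h p * h' p := by
  rw [integral_fin_two]
  rfl

lemma measurableSet_rect (x : Quadrant) : MeasurableSet (rect x) :=
  MeasurableSet.univ_pi fun _ => measurableSet_Ioc

lemma mem_rect (x : Quadrant) (u : Fin 2 → ℝ) :
    u ∈ rect x ↔ (0 < u 0 ∧ u 0 ≤ x.1 0) ∧ (0 < u 1 ∧ u 1 ≤ x.1 1) := by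
  simp [rect, Fin.forall_fin_two]

lemma indicator_rect (x : Quadrant) (S : Set (Fin 2 → ℝ)) (A : (Fin 2 → ℝ) → ℝ) (t w : Fin 2 → ℝ)
    (h : t ∈ S ↔ w ∈ rect x) :
    S.indicator A t = A t * (iocInd (x.1 0) (w 0) * iocInd (x.1 1) (w 1)) := by
  rw [mem_rect] at h
  unfold iocInd
  by_cases h0 : 0 < w 0 ∧ w 0 ≤ x.1 0
  · by_cases h1 : 0 < w 1 ∧ w 1 ≤ x.1 1
    · rw [Set.indicator_of_mem (h.2 ⟨h0, h1⟩), if_pos h0, if_pos h1, mul_one, mul_one]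
    · rw [Set.indicator_of_notMem (fun h' => h1 (h.1 h').2), if_neg h1, mul_zero, mul_zero]
  · rw [Set.indicator_of_notMem (fun h' => h0 (h.1 h').1), if_neg h0, zero_mul, mul_zero]

section KernelV

variable {B D : Matrix (Fin 2) (Fin 2) ℝ} {A : (Fin 2 → ℝ) → ℝ}

lemma mulVec_of_second_column_eq_zero (h0 : D 0 1 = 0) (h1 : D 1 1 = 0) (p : ℝ × ℝ)
    (u : Fin 2 → ℝ) :
    (D *ᵥ ![p.1, p.2] + u) 0 = u 0 + D 0 0 * p.1 ∧ (D *ᵥ ![p.1, p.2] + u) 1 = u 1 + D 1 0 * p.1 := by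
  constructor <;> simp [h0, h1, add_comm]

lemma measurableSet_mulVec_add_mem_rect (D : Matrix (Fin 2) (Fin 2) ℝ) (x : Quadrant)
    (u : Fin 2 → ℝ) : MeasurableSet {t : Fin 2 → ℝ | D *ᵥ t + u ∈ rect x} := by
  have : Continuous fun t : Fin 2 → ℝ => D *ᵥ t + u := by fun_prop
  exact this.measurable (measurableSet_rect x)

lemma indicator_kernelV (h0 : D 0 1 = 0) (h1 : D 1 1 = 0) (x : Quadrant) (u : Fin 2 → ℝ)
    (p : ℝ × ℝ) :
    {t : Fin 2 → ℝ | D *ᵥ t + u ∈ rect x}.indicator A ![p.1, p.2] = A ![p.1, p.2] *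
      (iocInd (x.1 0) (u 0 + D 0 0 * p.1) * iocInd (x.1 1) (u 1 + D 1 0 * p.1)) := by
  obtain ⟨e0, e1⟩ := mulVec_of_second_column_eq_zero h0 h1 p u
  exact (indicator_rect x {t : Fin 2 → ℝ | D *ᵥ t + u ∈ rect x} A ![p.1, p.2]
    (D *ᵥ ![p.1, p.2] + u) Iff.rfl).trans (by rw [e0, e1])

lemma kernelV_eq_integral (h0 : D 0 1 = 0) (h1 : D 1 1 = 0) {α δ : ℝ} (hα : α ≠ 0) (hδ : δ ≠ 0)
    (hdet : |α * δ| = |B.det|) (x : Quadrant) (u : Fin 2 → ℝ) :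
    kernelV B A D x u = ∫ p : ℝ × ℝ, A ![α * p.1, δ * p.2] *
      (iocInd (x.1 0) (u 0 + D 0 0 * (α * p.1)) * iocInd (x.1 1) (u 1 + D 1 0 * (α * p.1))) := by
  rw [kernelV, ← integral_indicator (measurableSet_mulVec_add_mem_rect D x u), integral_fin_two]
  simp_rw [indicator_kernelV h0 h1]
  rw [← hdet]
  exact (integral_scale_prod hα hδ fun p : ℝ × ℝ => A ![p.1, p.2] *
    (iocInd (x.1 0) (u 0 + D 0 0 * p.1) * iocInd (x.1 1) (u 1 + D 1 0 * p.1))).symm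

lemma integrableOn_kernelV_iff (h0 : D 0 1 = 0) (h1 : D 1 1 = 0) {α δ : ℝ} (hα : α ≠ 0)
    (hδ : δ ≠ 0) (x : Quadrant) (u : Fin 2 → ℝ) :
    IntegrableOn A {t : Fin 2 → ℝ | D *ᵥ t + u ∈ rect x} ↔
      Integrable fun p : ℝ × ℝ => A ![α * p.1, δ * p.2] *
      (iocInd (x.1 0) (u 0 + D 0 0 * (α * p.1)) * iocInd (x.1 1) (u 1 + D 1 0 * (α * p.1))) := by
  rw [← integrable_indicator_iff (measurableSet_mulVec_add_mem_rect D x u), integrable_fin_two]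
  simp_rw [indicator_kernelV h0 h1]
  exact (integrable_scale_prod hα hδ (F := fun p : ℝ × ℝ => A ![p.1, p.2] *
    (iocInd (x.1 0) (u 0 + D 0 0 * p.1) * iocInd (x.1 1) (u 1 + D 1 0 * p.1)))).symm

variable {q₁ q₂ : ℝ} (ha : IsAnisotropicKernel q₁ q₂ fun w z => A ![w, z]) (hq₂ : 1 < q₂)
  (hκ0 : 1 / 2 < q₁ - q₁ / q₂) (hκ : q₁ - q₁ / q₂ < 1) {α δ : ℝ} (hα : α ≠ 0) (hδ : δ ≠ 0)
  (h0 : D 0 1 = 0) (h1 : D 1 1 = 0)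
include hα hδ h0 h1

lemma kernelV_eq_stripKernel (hdet : |α * δ| = |B.det|) {e : ℝ} (hd₁ : D 0 0 * α = 1)
    (hd₂ : D 1 0 * α = -e) (x : Quadrant) (u : Fin 2 → ℝ) :
    kernelV B A D x u
      = stripKernel (fun w z => A ![w, z]) α δ e 0 (x.1 0) (x.1 1) (u 0, u 1) := by
  rw [kernelV_eq_integral h0 h1 hα hδ hdet, stripKernel]
  simp only [← mul_assoc, hd₁, hd₂, one_mul, zero_mul, add_zero, neg_mul]

lemma kernelV_eq_stripKernel_swap (hdet : |α * δ| = |B.det|) (hd₁ : D 0 0 = 0)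
    (hd₂ : D 1 0 * α = 1) (x : Quadrant) (u : Fin 2 → ℝ) :
    kernelV B A D x u
      = stripKernel (fun w z => A ![w, z]) α δ 0 0 (x.1 1) (x.1 0) (u 1, u 0) := by
  rw [kernelV_eq_integral h0 h1 hα hδ hdet, stripKernel]
  simp only [← mul_assoc, hd₁, hd₂, one_mul, zero_mul, add_zero, neg_zero]
  refine integral_congr_ae (Eventually.of_forall fun p => ?_)
  simp only
  ring

include ha hq₂ hκ0 hκ

lemma vWellDefined_of_stripKernel (hdet : |α * δ| = |B.det|) {e : ℝ} (hd₁ : D 0 0 * α = 1)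
    (hd₂ : D 1 0 * α = -e) : VWellDefined B A D := by
  refine fun x => ⟨Eventually.of_forall fun u => ?_, ?_⟩
  · rw [integrableOn_kernelV_iff h0 h1 hα hδ]
    have h := integrable_stripKernel_integrand ha hq₂ (by linarith) hκ hα hδ e 0 (x.1 0) (x.1 1)
      (u 0, u 1)
    simpa only [← mul_assoc, hd₁, hd₂, one_mul, zero_mul, add_zero, neg_mul] using h
  · have h := memLp_two_fin_two
      (memLp_stripKernel ha hq₂ hκ0 hκ hα hδ e 0 (x.1 0) (x.1 1))
    rwa [← funext (kernelV_eq_stripKernel hα hδ h0 h1 hdet hd₁ hd₂ x)] at h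

lemma vWellDefined_of_stripKernel_swap (hdet : |α * δ| = |B.det|) (hd₁ : D 0 0 = 0)
    (hd₂ : D 1 0 * α = 1) : VWellDefined B A D := by
  refine fun x => ⟨Eventually.of_forall fun u => ?_, ?_⟩
  · rw [integrableOn_kernelV_iff h0 h1 hα hδ]
    have h := integrable_stripKernel_integrand ha hq₂ (by linarith) hκ hα hδ 0 0 (x.1 1) (x.1 0)
      (u 1, u 0)
    simp only [zero_mul, add_zero, neg_zero] at h
    simp only [← mul_assoc, hd₁, hd₂, one_mul, zero_mul, add_zero]
    refine h.congr (Eventually.of_forall fun p => ?_)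
    simp only
    ring
  · have h := memLp_two_fin_two ((memLp_stripKernel ha hq₂ hκ0 hκ hα hδ 0 0 (x.1 1)
      (x.1 0)).comp_measurePreserving (Measure.measurePreserving_swap (μ := (volume : Measure ℝ))
        (ν := (volume : Measure ℝ))))
    rw [funext (kernelV_eq_stripKernel_swap hα hδ h0 h1 hdet hd₁ hd₂ x)]
    exact h

end KernelV

section KernelTilde

variable {B : Matrix (Fin 2) (Fin 2) ℝ} {A : (Fin 2 → ℝ) → ℝ}

lemma indicator_kernelTilde (d d' : ℝ) (x : Quadrant) (u : Fin 2 → ℝ) (p : ℝ × ℝ) :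
    (rect x).indicator (fun t => A (!![d, 0; 0, d'] *ᵥ t - u)) ![p.1, p.2]
      = A ![d * p.1 - u 0, d' * p.2 - u 1] * (iocInd (x.1 0) p.1 * iocInd (x.1 1) p.2) := by
  rw [indicator_rect x _ _ _ ![p.1, p.2] Iff.rfl]
  have : !![d, 0; 0, d'] *ᵥ ![p.1, p.2] - u = ![d * p.1 - u 0, d' * p.2 - u 1] := by
    ext i
    fin_cases i <;> simp [mul_comm]
  rw [this]
  rfl

lemma kernelTilde_eq_integral (d d' : ℝ) (x : Quadrant) (u : Fin 2 → ℝ) :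
    kernelTilde B A !![d, 0; 0, d'] x u = |B.det| ^ (-(1 / 2) : ℝ) *
      ∫ p : ℝ × ℝ, A ![d * p.1 - u 0, d' * p.2 - u 1] *
        (iocInd (x.1 0) p.1 * iocInd (x.1 1) p.2) := by
  rw [kernelTilde, ← integral_indicator (measurableSet_rect x), integral_fin_two]
  simp_rw [indicator_kernelTilde]

lemma integrableOn_kernelTilde_iff (d d' : ℝ) (x : Quadrant) (u : Fin 2 → ℝ) :
    IntegrableOn (fun t => A (!![d, 0; 0, d'] *ᵥ t - u)) (rect x) ↔
      Integrable fun p : ℝ × ℝ => A ![d * p.1 - u 0, d' * p.2 - u 1] *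
        (iocInd (x.1 0) p.1 * iocInd (x.1 1) p.2) := by
  rw [← integrable_indicator_iff (measurableSet_rect x), integrable_fin_two]
  simp_rw [indicator_kernelTilde]

lemma integral_iocInd {x : ℝ} (hx : 0 < x) : ∫ y, iocInd x y = x := by
  have h := integral_iocInd_mul hx hx
  have h1 : ∀ y, iocInd x y * iocInd x y = iocInd x y := fun y => by
    rcases iocInd_eq_zero_or_one x y with h | h <;> simp [h]
  simp_rw [h1] at h
  rw [h, sub_self, abs_zero]
  ring

lemma integrable_iocInd (x : ℝ) : Integrable (iocInd x) := by
  refine ⟨(measurable_iocInd x).aestronglyMeasurable, ?_⟩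
  have := lintegral_enorm_iocInd (x := x) 0
  simp only [add_zero] at this
  rw [HasFiniteIntegral, this]
  exact ENNReal.ofReal_lt_top

/-- For a diagonal matrix `D` the kernel of `Ṽ_D` is, after rescaling each coordinate of `u`, a
multiple of the strip kernel. -/
lemma kernelTilde_eq_stripKernel {d d' : ℝ} (hd : d ≠ 0) (hd' : d' ≠ 0) (x : Quadrant)
    (u : Fin 2 → ℝ) :
    kernelTilde B A !![d, 0; 0, d'] x u = |B.det| ^ (-(1 / 2) : ℝ) *
      stripKernel (fun w z => A ![w, z]) d d' 0 1 (x.1 0) (x.1 1) (d⁻¹ * u 0, d'⁻¹ * u 1) := by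
  rw [kernelTilde_eq_integral]
  congr 1
  unfold stripKernel
  refine Eq.trans ?_ (integral_sub_right_eq_self _ ((d⁻¹ * u 0, d'⁻¹ * u 1) : ℝ × ℝ))
  refine integral_congr_ae (Eventually.of_forall fun p => ?_)
  simp only [Prod.fst_sub, Prod.snd_sub, zero_mul, neg_zero, zero_add, one_mul, add_sub_cancel,
    mul_sub, sub_self, mul_inv_cancel_left₀ hd, mul_inv_cancel_left₀ hd']

/-- When `D₁₁` is the only nonzero entry, the integrand of `Ṽ_D` does not depend on `t₂`, so the
kernel reduces to the line kernel. -/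
lemma kernelTilde_eq_lineKernel {d δ : ℝ} (hd : d ≠ 0) (hδ : δ ≠ 0) (x : Quadrant)
    (u : Fin 2 → ℝ) :
    kernelTilde B A !![d, 0; 0, 0] x u = |B.det| ^ (-(1 / 2) : ℝ) *
      (x.1 1 * lineKernel (fun w z => A ![w, z]) d δ (x.1 0) (d⁻¹ * u 0, δ⁻¹ * u 1)) := by
  rw [kernelTilde_eq_integral, lineKernel]
  simp only [zero_mul, zero_sub, ← mul_assoc]
  rw [Measure.volume_eq_prod, integral_prod_mul (fun y => A ![d * y - u 0, -u 1] *
    iocInd (x.1 0) y) (iocInd (x.1 1)), integral_iocInd (x.2 1)]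
  simp only [mul_sub, mul_neg, mul_inv_cancel_left₀ hd, mul_inv_cancel_left₀ hδ]
  ring

lemma integral_mul_of_scale {d δ : ℝ} (hd : d ≠ 0) (hδ : δ ≠ 0) (hdet : |d * δ| = |B.det|)
    (h h' : ℝ × ℝ → ℝ) :
    ∫ u : Fin 2 → ℝ, (|B.det| ^ (-(1 / 2) : ℝ) * h (d⁻¹ * u 0, δ⁻¹ * u 1)) *
      (|B.det| ^ (-(1 / 2) : ℝ) * h' (d⁻¹ * u 0, δ⁻¹ * u 1)) = ∫ p, h p * h' p := by
  have hpos : 0 < |d * δ| := abs_pos.2 (mul_ne_zero hd hδ)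
  rw [← hdet]
  rw [integral_fin_two]
  simp only [mul_mul_mul_comm, Matrix.cons_val_zero, Matrix.cons_val_one]
  rw [integral_const_mul, integral_scale_prod (inv_ne_zero hd) (inv_ne_zero hδ)
    (fun p => h p * h' p), ← Real.rpow_add hpos, ← mul_inv, abs_inv, inv_inv, ← mul_assoc]
  norm_num
  rw [Real.rpow_neg_one, inv_mul_cancel₀, one_mul]
  rw [← abs_mul]
  exact hpos.ne'

variable {q₁ q₂ : ℝ} (ha : IsAnisotropicKernel q₁ q₂ fun w z => A ![w, z])
include ha

lemma tildeWellDefined_diagonal (hq₂ : 1 < q₂) (hκ0 : 1 / 2 < q₁ - q₁ / q₂)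
    (hκ : q₁ - q₁ / q₂ < 1) {d d' : ℝ} (hd : d ≠ 0) (hd' : d' ≠ 0) :
    TildeWellDefined B A !![d, 0; 0, d'] := by
  refine fun x => ⟨Eventually.of_forall fun u => ?_, ?_⟩
  · rw [integrableOn_kernelTilde_iff]
    have h := (integrable_stripKernel_integrand ha hq₂ (by linarith) hκ hd hd' 0 1 (x.1 0) (x.1 1)
      (d⁻¹ * u 0, d'⁻¹ * u 1)).comp_sub_right ((d⁻¹ * u 0, d'⁻¹ * u 1) : ℝ × ℝ)
    simpa only [Prod.fst_sub, Prod.snd_sub, zero_mul, neg_zero, zero_add, one_mul, add_sub_cancel,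
      mul_sub, sub_self, mul_inv_cancel_left₀ hd, mul_inv_cancel_left₀ hd'] using h
  · rw [funext (kernelTilde_eq_stripKernel hd hd' x)]
    exact (memLp_two_fin_two (memLp_two_scale_prod (inv_ne_zero hd) (inv_ne_zero hd')
      (memLp_stripKernel ha hq₂ hκ0 hκ hd hd' 0 1 (x.1 0) (x.1 1)))).const_mul _

lemma tildeWellDefined_degenerate (hq₁ : 0 < q₁) (hq₂ : 1 < q₂) (hκ0 : 1 / 2 < q₁ - q₁ / q₂)
    (hQ : 1 / q₁ + 1 / q₂ < 2) (hQt : 1 < 1 / q₁ + 1 / (2 * q₂)) {d δ : ℝ} (hd : d ≠ 0)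
    (hδ : δ ≠ 0) : TildeWellDefined B A !![d, 0; 0, 0] := by
  refine fun x => ⟨?_, ?_⟩
  · filter_upwards [ae_fin_two ae_snd_ne_zero] with u hu
    rw [integrableOn_kernelTilde_iff]
    have h := (integrable_lineKernel_integrand ha hd hδ (x.1 0) (u := (d⁻¹ * u 0, δ⁻¹ * u 1))
      (mul_ne_zero (inv_ne_zero hδ) hu)).mul_prod (integrable_iocInd (x.1 1))
    simp only [zero_mul, zero_sub, mul_sub, mul_neg, mul_inv_cancel_left₀ hd,
      mul_inv_cancel_left₀ hδ, mul_assoc] at h ⊢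
    exact h
  · rw [funext (kernelTilde_eq_lineKernel hd hδ x)]
    have h := (memLp_two_fin_two (memLp_two_scale_prod (inv_ne_zero hd) (inv_ne_zero hδ)
      (memLp_lineKernel ha hq₁ hq₂ hκ0 hQ hQt hd hδ (x.1 0))))
    exact (h.const_mul (x.1 1)).const_mul _

end KernelTilde

/-! ### Scaling limits and limit fields -/

section Limits

variable {Ω Ω' : Type*} [MeasurableSpace Ω] [MeasurableSpace Ω']
  {P : Measure Ω} [IsProbabilityMeasure P] {P' : Measure Ω'} [IsProbabilityMeasure P']
  {b : (Fin 2 → ℤ) → ℝ} {ε X : (Fin 2 → ℤ) → Ω → ℝ}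
  {W : Lp ℝ 2 (volume : Measure (Fin 2 → ℝ)) → Ω' → ℝ}
  {q₁ q₂ : ℝ} {a : ℝ → ℝ → ℝ} {c₁₁ c₁₂ c₂₁ c₂₂ : ℝ}

lemma hasScalingLimit_of_tendsto_boxSum (hε : IsInnovationField ε P) (hX : IsLinearField b ε X P)
    (hW : IsWhiteNoise W P') {γ H : ℝ} {n₁ n₂ ρ : ℝ → ℝ} (h₁ : Tendsto n₁ atTop atTop)
    (h₂ : Tendsto n₂ atTop atTop)
    (hρ : ∀ᶠ l in atTop, √(n₁ l * n₂ l) * (l ^ H)⁻¹ = ρ l)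
    {k : Quadrant → (Fin 2 → ℝ) → ℝ} (hk : ∀ x, MemLp (k x) 2 volume)
    {h : Quadrant → ℝ × ℝ → ℝ} (hh : ∀ x, MemLp (h x) 2 volume)
    (hgram : ∀ x y, ∫ u, k x u * k y u = ∫ u, h x u * h y u)
    (hconv : ∀ x : Quadrant, Tendsto (fun l => ∫⁻ u : ℝ × ℝ, ‖ρ l *
        boxSum (fun r₁ r₂ => b ![r₁, r₂]) (l * x.1 0) (l ^ γ * x.1 1) ⌈n₁ l * u.1⌉ ⌈n₂ l * u.2⌉
        - h x u‖ₑ ^ 2) atTop (𝓝 0)) :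
    HasScalingLimit X P γ H (fun x => stochIntegral W (k x)) P' := by
  refine hasScalingLimit_of_tendsto hε hX hW (h₁.eventually_gt_atTop 0)
    (h₂.eventually_gt_atTop 0) (h₁.atTop_mul_atTop₀ h₂) hk hh hgram fun x => ?_
  refine (hconv x).congr' ?_
  filter_upwards [hρ] with l hl
  simp only [stepFun, ← mul_assoc, hl]

/-- The scaling limit along rectangles whose sides both grow at least as fast as the natural scale
of the kernel. -/
lemma hasScalingLimit_stripKernel (hε : IsInnovationField ε P) (hX : IsLinearField b ε X P)
    (hW : IsWhiteNoise W P') (ha : IsAnisotropicKernel q₁ q₂ a)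
    (hβ : IsLatticeKernel q₁ q₂ a c₁₁ c₁₂ c₂₁ c₂₂ fun r₁ r₂ => b ![r₁, r₂])
    (hq₁ : 0 < q₁) (hq : q₁ < q₂) (hq₂ : 1 < q₂) (hκ0 : 1 / 2 < q₁ - q₁ / q₂)
    (hκ : q₁ - q₁ / q₂ < 1) (hdet : c₁₁ * c₂₂ - c₁₂ * c₂₁ ≠ 0) (h₂₂ : c₂₂ ≠ 0) {γ H e₁ e₂ : ℝ}
    (hγ : 0 < γ) (hH : H = 3 / 2 - (q₁ - q₁ / q₂) + γ / 2)
    (he₁ : Tendsto (fun l : ℝ => c₂₁ / c₂₂ * (l / l ^ γ)) atTop (𝓝 e₁))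
    (he₂ : Tendsto (fun l : ℝ => l ^ (q₁ / q₂) / l ^ γ) atTop (𝓝 e₂))
    {k : Quadrant → (Fin 2 → ℝ) → ℝ} (hk : ∀ x, MemLp (k x) 2 volume)
    (hgram : ∀ x y : Quadrant, ∫ u, k x u * k y u = ∫ u,
      stripKernel a ((c₁₁ * c₂₂ - c₁₂ * c₂₁) / c₂₂) c₂₂ e₁ e₂ (x.1 0) (x.1 1) u *
      stripKernel a ((c₁₁ * c₂₂ - c₁₂ * c₂₁) / c₂₂) c₂₂ e₁ e₂ (y.1 0) (y.1 1) u) :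
    HasScalingLimit X P γ H (fun x => stochIntegral W (k x)) P' := by
  have hα : (c₁₁ * c₂₂ - c₁₂ * c₂₁) / c₂₂ ≠ 0 := div_ne_zero hdet h₂₂
  refine hasScalingLimit_of_tendsto_boxSum hε hX hW (n₁ := fun l => l) (n₂ := fun l => l ^ γ)
    (ρ := fun l => l ^ (q₁ - q₁ / q₂ - 1)) tendsto_id (tendsto_rpow_atTop hγ) ?_ hk
    (fun x => memLp_stripKernel ha hq₂ hκ0 hκ hα h₂₂ e₁ e₂ (x.1 0) (x.1 1)) hgram fun x => ?_
  · filter_upwards [eventually_gt_atTop 0] with l hl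
    rw [Real.sqrt_eq_rpow, ← Real.rpow_one_add' hl.le (by linarith), ← Real.rpow_mul hl.le,
      ← Real.rpow_neg hl.le, ← Real.rpow_add hl, hH]
    congr 1
    ring
  · exact tendsto_rescaled_boxSum hβ ha hq₁ hq hq₂ hκ0 hκ hdet h₂₂ tendsto_id
      (tendsto_rpow_atTop hγ) he₁ he₂

lemma tendsto_rpow_div_rpow_zero {ζ γ : ℝ} (h : ζ < γ) :
    Tendsto (fun l : ℝ => l ^ ζ / l ^ γ) atTop (𝓝 0) := by
  refine (tendsto_rpow_neg_atTop (sub_pos.2 h)).congr' ?_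
  filter_upwards [eventually_gt_atTop 0] with l hl
  rw [neg_sub, Real.rpow_sub hl]

lemma tendsto_mul_id_div_rpow (c : ℝ) {γ : ℝ} (h : 1 < γ) :
    Tendsto (fun l : ℝ => c * (l / l ^ γ)) atTop (𝓝 0) := by
  have := (tendsto_rpow_div_rpow_zero h).const_mul c
  simpa only [Real.rpow_one, mul_zero] using this

lemma boxSum_swap (β : ℤ → ℤ → ℝ) (M₁ M₂ : ℝ) (s₁ s₂ : ℤ) :
    boxSum (fun r₁ r₂ => β r₂ r₁) M₁ M₂ s₁ s₂ = boxSum β M₂ M₁ s₂ s₁ :=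
  Finset.sum_comm

/-- The scaling limit along rectangles whose longer side points in the second direction, when the
dependence direction is not a coordinate direction. -/
lemma hasScalingLimit_stripKernel_swap (hε : IsInnovationField ε P) (hX : IsLinearField b ε X P)
    (hW : IsWhiteNoise W P') (ha : IsAnisotropicKernel q₁ q₂ a)
    (hβ : IsLatticeKernel q₁ q₂ a c₁₁ c₁₂ c₂₁ c₂₂ fun r₁ r₂ => b ![r₂, r₁])
    (hq₁ : 0 < q₁) (hq : q₁ < q₂) (hq₂ : 1 < q₂) (hκ0 : 1 / 2 < q₁ - q₁ / q₂)
    (hκ : q₁ - q₁ / q₂ < 1) (hdet : c₁₁ * c₂₂ - c₁₂ * c₂₁ ≠ 0) (h₂₂ : c₂₂ ≠ 0) {γ H : ℝ}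
    (hγ : 0 < γ) (hγ1 : γ < 1) (hH : H = 1 / 2 + γ * (3 / 2 - (q₁ - q₁ / q₂)))
    {k : Quadrant → (Fin 2 → ℝ) → ℝ} (hk : ∀ x, MemLp (k x) 2 volume)
    (hgram : ∀ x y : Quadrant, ∫ u, k x u * k y u = ∫ u : ℝ × ℝ,
      stripKernel a ((c₁₁ * c₂₂ - c₁₂ * c₂₁) / c₂₂) c₂₂ 0 0 (x.1 1) (x.1 0) u.swap *
      stripKernel a ((c₁₁ * c₂₂ - c₁₂ * c₂₁) / c₂₂) c₂₂ 0 0 (y.1 1) (y.1 0) u.swap) :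
    HasScalingLimit X P γ H (fun x => stochIntegral W (k x)) P' := by
  have hα : (c₁₁ * c₂₂ - c₁₂ * c₂₁) / c₂₂ ≠ 0 := div_ne_zero hdet h₂₂
  have hswap : MeasurePreserving (Prod.swap : ℝ × ℝ → ℝ × ℝ) volume volume :=
    Measure.measurePreserving_swap (μ := (volume : Measure ℝ)) (ν := (volume : Measure ℝ))
  have hζ : q₁ / q₂ < 1 := (div_lt_one (by linarith)).2 hq
  refine hasScalingLimit_of_tendsto_boxSum hε hX hW (n₁ := fun l => l) (n₂ := fun l => l ^ γ)
    (ρ := fun l => (l ^ γ) ^ (q₁ - q₁ / q₂ - 1)) tendsto_id (tendsto_rpow_atTop hγ) ?_ hk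
    (fun x => (memLp_stripKernel ha hq₂ hκ0 hκ hα h₂₂ 0 0 (x.1 1)
      (x.1 0)).comp_measurePreserving hswap) hgram fun x => ?_
  · filter_upwards [eventually_gt_atTop 0] with l hl
    rw [Real.sqrt_eq_rpow, ← Real.rpow_one_add' hl.le (by linarith), ← Real.rpow_mul hl.le,
      ← Real.rpow_neg hl.le, ← Real.rpow_add hl, ← Real.rpow_mul hl.le, hH]
    congr 1
    ring
  · have he₁ : Tendsto (fun l : ℝ => c₂₁ / c₂₂ * (l ^ γ / l)) atTop (𝓝 0) := by
      have := (tendsto_rpow_neg_atTop (sub_pos.2 hγ1)).const_mul (c₂₁ / c₂₂)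
      rw [mul_zero] at this
      refine this.congr' ?_
      filter_upwards [eventually_gt_atTop 0] with l hl
      rw [neg_sub, Real.rpow_sub hl, Real.rpow_one]
    have he₂ : Tendsto (fun l : ℝ => (l ^ γ) ^ (q₁ / q₂) / l) atTop (𝓝 0) := by
      have h1 : γ * (q₁ / q₂) < 1 := by
        have := mul_lt_mul_of_pos_left hζ hγ
        linarith
      refine (tendsto_rpow_neg_atTop (sub_pos.2 h1)).congr' ?_
      filter_upwards [eventually_gt_atTop 0] with l hl
      rw [neg_sub, Real.rpow_sub hl, Real.rpow_one, ← Real.rpow_mul hl.le]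
    have h := tendsto_rescaled_boxSum hβ ha hq₁ hq hq₂ hκ0 hκ hdet h₂₂ (tendsto_rpow_atTop hγ)
      tendsto_id he₁ he₂ (x₁ := x.1 1) (x₂ := x.1 0)
    refine h.congr fun l => ?_
    rw [← hswap.lintegral_comp_emb MeasurableEquiv.prodComm.measurableEmbedding]
    refine lintegral_congr fun u => ?_
    rw [boxSum_swap (fun r₁ r₂ => b ![r₁, r₂])]
    rfl

/-- The scaling limit along rectangles which are short in the second direction. -/
lemma hasScalingLimit_lineKernel (hε : IsInnovationField ε P) (hX : IsLinearField b ε X P)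
    (hW : IsWhiteNoise W P') (ha : IsAnisotropicKernel q₁ q₂ a)
    (hβ : IsLatticeKernel q₁ q₂ a c₁₁ c₁₂ 0 c₂₂ fun r₁ r₂ => b ![r₁, r₂])
    (hq₁ : 0 < q₁) (hq : q₁ < q₂) (hq₂ : 1 < q₂) (hκ0 : 1 / 2 < q₁ - q₁ / q₂)
    (hQ : 1 / q₁ + 1 / q₂ < 2) (hQt : 1 < 1 / q₁ + 1 / (2 * q₂)) (h₁₁ : c₁₁ ≠ 0)
    (h₂₂ : c₂₂ ≠ 0) {γ H : ℝ} (hγ0 : 0 < γ) (hγ : γ < q₁ / q₂)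
    (hH : H = 3 / 2 - q₁ + q₁ / q₂ / 2 + γ)
    {k : Quadrant → (Fin 2 → ℝ) → ℝ} (hk : ∀ x, MemLp (k x) 2 volume)
    (hgram : ∀ x y : Quadrant, ∫ u, k x u * k y u = ∫ u,
      (x.1 1 * lineKernel a c₁₁ c₂₂ (x.1 0) u) * (y.1 1 * lineKernel a c₁₁ c₂₂ (y.1 0) u)) :
    HasScalingLimit X P γ H (fun x => stochIntegral W (k x)) P' := by
  have hζ : 0 < q₁ / q₂ := hγ0.trans hγ
  refine hasScalingLimit_of_tendsto_boxSum hε hX hW (n₁ := fun l => l)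
    (n₂ := fun l => l ^ (q₁ / q₂)) (ρ := fun l => l ^ (q₁ - 1 - γ)) tendsto_id
    (tendsto_rpow_atTop hζ) ?_ hk
    (fun x => (memLp_lineKernel ha hq₁ hq₂ hκ0 hQ hQt h₁₁ h₂₂ (x.1 0)).const_mul (x.1 1))
    hgram fun x => tendsto_rescaled_boxSum_row hβ ha hq₁ hq hq₂ hκ0 hQ hQt h₁₁ h₂₂ hγ0 hγ (x.1 0)
      (x.2 1)
  filter_upwards [eventually_gt_atTop 0] with l hl
  rw [Real.sqrt_eq_rpow, ← Real.rpow_one_add' hl.le (by linarith), ← Real.rpow_mul hl.le,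
    ← Real.rpow_neg hl.le, ← Real.rpow_add hl, hH]
  congr 1
  ring

end Limits

section Sheets

variable {Ω' : Type*} [MeasurableSpace Ω'] {P' : Measure Ω'}
  {W : Lp ℝ 2 (volume : Measure (Fin 2 → ℝ)) → Ω' → ℝ} {q₁ q₂ : ℝ} {a : ℝ → ℝ → ℝ}

lemma isFractionalBrownianSheet_stripKernel (hW : IsWhiteNoise W P')
    (ha : IsAnisotropicKernel q₁ q₂ a) (hq₂ : 1 < q₂) (hκ0 : 1 / 2 < q₁ - q₁ / q₂)
    (hκ : q₁ - q₁ / q₂ < 1) {α δ : ℝ} (hα : α ≠ 0) (hδ : δ ≠ 0) {H : ℝ}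
    (hH : H = 3 / 2 - (q₁ - q₁ / q₂))
    {k : Quadrant → (Fin 2 → ℝ) → ℝ} (hk : ∀ x, MemLp (k x) 2 volume)
    (hgram : ∀ x y : Quadrant, ∫ u, k x u * k y u = ∫ u,
      stripKernel a α δ 0 0 (x.1 0) (x.1 1) u * stripKernel a α δ 0 0 (y.1 0) (y.1 1) u) :
    IsFractionalBrownianSheet (sigmaOne (fun x => stochIntegral W (k x)) P') H (1 / 2)
      (fun x => stochIntegral W (k x)) P' := by
  refine isFractionalBrownianSheet_of_kernel hW hk (c := ∫ v, bandKernel a α δ 1 v ^ 2)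
    (by rw [hH]; linarith) (by norm_num) fun x y => ?_
  rw [hgram, integral_stripKernel_mul ha hq₂ hκ0 hκ hα hδ (x.2 0) (x.2 1) (y.2 0) (y.2 1)]
  have e1 : 2 * H = 3 - 2 * (q₁ - q₁ / q₂) := by rw [hH]; ring
  have e2 : (2 : ℝ) * (1 / 2) = 1 := by norm_num
  simp only [e1, e2, Real.rpow_one]

lemma isFractionalBrownianSheet_stripKernel_swap (hW : IsWhiteNoise W P')
    (ha : IsAnisotropicKernel q₁ q₂ a) (hq₂ : 1 < q₂) (hκ0 : 1 / 2 < q₁ - q₁ / q₂)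
    (hκ : q₁ - q₁ / q₂ < 1) {α δ : ℝ} (hα : α ≠ 0) (hδ : δ ≠ 0) {H : ℝ}
    (hH : H = 3 / 2 - (q₁ - q₁ / q₂))
    {k : Quadrant → (Fin 2 → ℝ) → ℝ} (hk : ∀ x, MemLp (k x) 2 volume)
    (hgram : ∀ x y : Quadrant, ∫ u, k x u * k y u = ∫ u : ℝ × ℝ,
      stripKernel a α δ 0 0 (x.1 1) (x.1 0) u.swap *
      stripKernel a α δ 0 0 (y.1 1) (y.1 0) u.swap) :
    IsFractionalBrownianSheet (sigmaOne (fun x => stochIntegral W (k x)) P') (1 / 2) H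
      (fun x => stochIntegral W (k x)) P' := by
  have hswap : MeasurePreserving (Prod.swap : ℝ × ℝ → ℝ × ℝ) volume volume :=
    Measure.measurePreserving_swap (μ := (volume : Measure ℝ)) (ν := (volume : Measure ℝ))
  refine isFractionalBrownianSheet_of_kernel hW hk (c := ∫ v, bandKernel a α δ 1 v ^ 2)
    (by norm_num) (by rw [hH]; linarith) fun x y => ?_
  rw [hgram, hswap.integral_comp MeasurableEquiv.prodComm.measurableEmbedding
      (fun u => stripKernel a α δ 0 0 (x.1 1) (x.1 0) u * stripKernel a α δ 0 0 (y.1 1) (y.1 0) u),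
    integral_stripKernel_mul ha hq₂ hκ0 hκ hα hδ (x.2 1) (x.2 0) (y.2 1) (y.2 0)]
  have e1 : 2 * H = 3 - 2 * (q₁ - q₁ / q₂) := by rw [hH]; ring
  have e2 : (2 : ℝ) * (1 / 2) = 1 := by norm_num
  simp only [e1, e2, Real.rpow_one]
  ring

lemma isFractionalBrownianSheet_lineKernel (hW : IsWhiteNoise W P')
    (ha : IsAnisotropicKernel q₁ q₂ a) (hq₁ : 0 < q₁) (hq₂ : 1 < q₂)
    (hκ0 : 1 / 2 < q₁ - q₁ / q₂) (hQ : 1 / q₁ + 1 / q₂ < 2) (hQt : 1 < 1 / q₁ + 1 / (2 * q₂))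
    {α δ : ℝ} (hα : α ≠ 0) (hδ : δ ≠ 0) {H : ℝ} (hH : H = 3 / 2 - q₁ + q₁ / q₂ / 2) (hH0 : H ≠ 0)
    {k : Quadrant → (Fin 2 → ℝ) → ℝ} (hk : ∀ x, MemLp (k x) 2 volume)
    (hgram : ∀ x y : Quadrant, ∫ u, k x u * k y u = ∫ u,
      (x.1 1 * lineKernel a α δ (x.1 0) u) * (y.1 1 * lineKernel a α δ (y.1 0) u)) :
    IsFractionalBrownianSheet (sigmaOne (fun x => stochIntegral W (k x)) P') H 1
      (fun x => stochIntegral W (k x)) P' := by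
  have e1 : 2 * H = 3 - 2 * q₁ + q₁ / q₂ := by rw [hH]; ring
  refine isFractionalBrownianSheet_of_kernel hW hk (c := ∫ v, lineKernel a α δ 1 v ^ 2)
    hH0 one_ne_zero fun x y => ?_
  rw [hgram, integral_lineKernel_mul ha hq₁ hq₂ hκ0 hQ hQt hα hδ
    (by rw [← e1]; exact mul_ne_zero two_ne_zero hH0) _ _ (x.2 0) (y.2 0)]
  simp only [e1, mul_one, Real.rpow_two]

end Sheets

end PlanarScaling

/-! ### The scaling transition -/

open PlanarScaling in
theorem theorem2
    {Ω Ω' : Type*} [MeasurableSpace Ω] [MeasurableSpace Ω']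
    (P : Measure Ω) [IsProbabilityMeasure P] (P' : Measure Ω') [IsProbabilityMeasure P']
    (q₁ q₂ : ℝ) (hq₁ : 0 < q₁) (hq₂ : 0 < q₂)
    (hQ₁ : 1 < expQ q₁ q₂) (hQ₂ : expQ q₁ q₂ < 2)
    (Lpos Lneg : ℝ → ℝ)
    (hLpos : ContinuousOn Lpos (Set.Icc (-1) 1)) (hLneg : ContinuousOn Lneg (Set.Icc (-1) 1))
    (hL_one : Lpos 1 = Lneg 1) (hL_neg_one : Lpos (-1) = Lneg (-1))
    (B : Matrix (Fin 2) (Fin 2) ℝ) (hB : B.det ≠ 0)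
    (b : (Fin 2 → ℤ) → ℝ) (hb : HasCoeffAsymptotics q₁ q₂ Lpos Lneg B b)
    (ε : (Fin 2 → ℤ) → Ω → ℝ) (hε : IsInnovationField ε P)
    (X : (Fin 2 → ℤ) → Ω → ℝ) (hX : IsLinearField b ε X P)
    (W : Lp ℝ 2 (volume : Measure (Fin 2 → ℝ)) → Ω' → ℝ) (hW : IsWhiteNoise W P')
    (hq : q₁ < q₂)
    (hQt₁ : expQtilde q₁ q₂ q₁ < 1) (hQt₂ : 1 < expQtilde q₁ q₂ q₂) :
    let a := aInf q₁ q₂ Lpos Lneg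
    let H₁ := hurst q₁ q₂ q₁
    let Ht₁ := hurstTilde q₁ q₂ q₁
    let V11 := fieldV W B a (mat11 B)
    let V21 := fieldV W B a (mat21 B)
    let V01 := fieldV W B a (mat01 B)
    let Vt11 := fieldTilde W B a (matTilde11 B)
    let Vt00 := fieldTilde W B a (matTilde00 B)
    -- incongruous scaling
    (B 1 0 * B 1 1 ≠ 0 →
      (VWellDefined B a (mat11 B) ∧ VWellDefined B a (mat21 B) ∧ VWellDefined B a (mat01 B)) ∧
      IsFractionalBrownianSheet (sigmaOne V11 P') H₁ (1 / 2) V11 P' ∧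
      IsFractionalBrownianSheet (sigmaOne V21 P') (1 / 2) H₁ V21 P' ∧
      (∀ γ : ℝ, 0 < γ →
        (1 < γ → HasScalingLimit X P γ (H₁ + γ / 2) V11 P') ∧
        (γ < 1 → HasScalingLimit X P γ (1 / 2 + γ * H₁) V21 P') ∧
        (γ = 1 → HasScalingLimit X P γ (H₁ + 1 / 2) V01 P')) ∧
      (sigmaOne V11 P' ≠ 0 ∨ sigmaOne V21 P' ≠ 0 →
        ∀ c : ℝ, 0 < c → ¬ EqFdd V11 (fun x ω => c * V21 x ω) P')) ∧
    -- congruous scaling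
    (B 1 0 = 0 →
      (VWellDefined B a (mat11 B) ∧ TildeWellDefined B a (matTilde11 B) ∧
        TildeWellDefined B a (matTilde00 B)) ∧
      IsFractionalBrownianSheet (sigmaOne V11 P') H₁ (1 / 2) V11 P' ∧
      IsFractionalBrownianSheet (sigmaOne Vt11 P') Ht₁ 1 Vt11 P' ∧
      (∀ γ : ℝ, 0 < γ →
        (q₁ / q₂ < γ → HasScalingLimit X P γ (H₁ + γ / 2) V11 P') ∧
        (γ < q₁ / q₂ → HasScalingLimit X P γ (Ht₁ + γ) Vt11 P') ∧
        (γ = q₁ / q₂ → HasScalingLimit X P γ (H₁ + γ / 2) Vt00 P')) ∧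
      (sigmaOne V11 P' ≠ 0 ∨ sigmaOne Vt11 P' ≠ 0 →
        ∀ c : ℝ, 0 < c → ¬ EqFdd V11 (fun x ω => c * Vt11 x ω) P')) := by
  intro a H₁ Ht₁ V11 V21 V01 Vt11 Vt00
  -- arithmetic of the exponents
  have hinv : expQ q₁ q₂ = 1 / q₁ + 1 / q₂ := rfl
  have hhalf : ∀ q : ℝ, 1 / (2 * q) = 1 / q / 2 := fun q => by rw [mul_comm, div_mul_eq_div_div]
  rw [expQtilde, hinv, hhalf] at hQt₁ hQt₂
  rw [hinv] at hQ₁ hQ₂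
  have h1q : 0 < 1 / q₁ := by positivity
  have h2q : 0 < 1 / q₂ := by positivity
  have hq₂1 : 1 < q₂ := by
    have : 1 / q₂ < 1 := by linarith
    rwa [div_lt_one hq₂] at this
  have hqq : q₁ / q₂ = q₁ * (1 / q₂) := by ring
  have hq1q : q₁ * (1 / q₁) = 1 := by rw [mul_one_div, div_self hq₁.ne']
  have hκ0 : 1 / 2 < q₁ - q₁ / q₂ := by
    have : q₁ * (1 / q₁ / 2 + 1 / q₂) < q₁ * 1 := mul_lt_mul_of_pos_left (by linarith) hq₁
    rw [hqq]
    linarith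
  have hκ : q₁ - q₁ / q₂ < 1 := by
    have : q₁ * 1 < q₁ * (1 / q₁ + 1 / q₂) := mul_lt_mul_of_pos_left (by linarith) hq₁
    rw [hqq]
    linarith
  have hζ0 : 0 < q₁ / q₂ := by positivity
  have hζ1 : q₁ / q₂ < 1 := (div_lt_one hq₂).2 hq
  have hQt : 1 < 1 / q₁ + 1 / (2 * q₂) := by rw [hhalf]; linarith
  have hH₁ : H₁ = 3 / 2 - (q₁ - q₁ / q₂) := by
    change 1 / 2 + q₁ * (1 / q₁ + 1 / q₂ - 1) = _
    rw [hqq]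
    linarith
  have hHt₁ : Ht₁ = 3 / 2 - q₁ + q₁ / q₂ / 2 := by
    change 1 - q₁ / 2 * (2 - (1 / q₁ + 1 / q₂)) = _
    rw [hqq]
    linarith
  have hH₁0 : H₁ ≠ 0 := by rw [hH₁]; linarith
  have hHt₁0 : Ht₁ ≠ 0 := by rw [hHt₁]; linarith
  -- the kernel and the coefficients in curried form
  have ha : IsAnisotropicKernel q₁ q₂ fun w z => a ![w, z] :=
    isAnisotropicKernel_kernelAInf hq₁ hq₂ hLpos hLneg hL_one hL_neg_one
  have hβ : IsLatticeKernel q₁ q₂ (fun w z => a ![w, z]) (B 0 0) (B 0 1) (B 1 0) (B 1 1)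
      fun r₁ r₂ => b ![r₁, r₂] := hb.isLatticeKernel hq₁ hq₂ hB ha
  have hdet2 : B.det = B 0 0 * B 1 1 - B 0 1 * B 1 0 := Matrix.det_fin_two B
  have hdet : B 0 0 * B 1 1 - B 0 1 * B 1 0 ≠ 0 := hdet2 ▸ hB
  have hα : ∀ {c : ℝ}, c ≠ 0 → (B 0 0 * B 1 1 - B 0 1 * B 1 0) / c ≠ 0 := fun hc =>
    div_ne_zero hdet hc
  have hprod : ∀ {c : ℝ}, c ≠ 0 → |(B 0 0 * B 1 1 - B 0 1 * B 1 0) / c * c| = |B.det| := by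
    intro c hc
    rw [div_mul_cancel₀ _ hc, hdet2]
  have hrow : ∀ {c : ℝ}, c ≠ 0 → B.det⁻¹ * c * ((B 0 0 * B 1 1 - B 0 1 * B 1 0) / c) = 1 := by
    intro c hc
    rw [← hdet2]
    field_simp
  -- the field `V11` is available as soon as `B 1 1 ≠ 0`
  have hV11 : B 1 1 ≠ 0 → VWellDefined B a (mat11 B) ∧
      (∀ x y : Quadrant, ∫ u, kernelV B a (mat11 B) x u * kernelV B a (mat11 B) y u = ∫ u,
        stripKernel (fun w z => a ![w, z]) ((B 0 0 * B 1 1 - B 0 1 * B 1 0) / B 1 1) (B 1 1) 0 0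
          (x.1 0) (x.1 1) u *
        stripKernel (fun w z => a ![w, z]) ((B 0 0 * B 1 1 - B 0 1 * B 1 0) / B 1 1) (B 1 1) 0 0
          (y.1 0) (y.1 1) u) ∧
      IsFractionalBrownianSheet (sigmaOne V11 P') H₁ (1 / 2) V11 P' := by
    intro h
    have d1 : mat11 B 0 0 * ((B 0 0 * B 1 1 - B 0 1 * B 1 0) / B 1 1) = 1 := by
      simpa [mat11] using hrow h
    have d2 : mat11 B 1 0 * ((B 0 0 * B 1 1 - B 0 1 * B 1 0) / B 1 1) = -0 := by simp [mat11]
    have hwd := vWellDefined_of_stripKernel ha hq₂1 hκ0 hκ (hα h) h (D := mat11 B)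
      (by simp [mat11]) (by simp [mat11]) (hprod h) d1 d2
    have hgram : ∀ x y : Quadrant, _ = _ := fun x y => by
      have := integral_mul_fin_two
        (stripKernel (fun w z => a ![w, z]) ((B 0 0 * B 1 1 - B 0 1 * B 1 0) / B 1 1) (B 1 1) 0 0
          (x.1 0) (x.1 1))
        (stripKernel (fun w z => a ![w, z]) ((B 0 0 * B 1 1 - B 0 1 * B 1 0) / B 1 1) (B 1 1) 0 0
          (y.1 0) (y.1 1))
      simp only [← kernelV_eq_stripKernel (D := mat11 B) (B := B) (hα h) h (by simp [mat11])
        (by simp [mat11]) (hprod h) d1 d2] at this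
      exact this
    exact ⟨hwd, hgram, isFractionalBrownianSheet_stripKernel hW ha hq₂1 hκ0 hκ (hα h) h hH₁
      (fun x => (hwd x).2) hgram⟩
  constructor
  · intro hne
    have h₂₁ : B 1 0 ≠ 0 := left_ne_zero_of_mul hne
    have h₂₂ : B 1 1 ≠ 0 := right_ne_zero_of_mul hne
    obtain ⟨wd11, gram11, fbs11⟩ := hV11 h₂₂
    -- the field `V21`: the same strip kernel with exchanged coordinates
    have hdet' : B 0 1 * B 1 0 - B 0 0 * B 1 1 ≠ 0 := by
      rw [← neg_sub]
      exact neg_ne_zero.2 hdet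
    have hα' : (B 0 1 * B 1 0 - B 0 0 * B 1 1) / B 1 0 ≠ 0 := div_ne_zero hdet' h₂₁
    have hprod' : |(B 0 1 * B 1 0 - B 0 0 * B 1 1) / B 1 0 * B 1 0| = |B.det| := by
      rw [div_mul_cancel₀ _ h₂₁, hdet2, abs_sub_comm]
    have d3 : mat21 B 0 0 = 0 := by simp [mat21]
    have d4 : mat21 B 1 0 * ((B 0 1 * B 1 0 - B 0 0 * B 1 1) / B 1 0) = 1 := by
      rw [← neg_sub, ← hdet2, show mat21 B 1 0 = B.det⁻¹ * -B 1 0 by simp [mat21]]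
      field_simp
    have wd21 := vWellDefined_of_stripKernel_swap ha hq₂1 hκ0 hκ hα' h₂₁ (D := mat21 B)
      (by simp [mat21]) (by simp [mat21]) hprod' d3 d4
    have gram21 : ∀ x y : Quadrant,
        ∫ u, kernelV B a (mat21 B) x u * kernelV B a (mat21 B) y u = ∫ u : ℝ × ℝ,
          stripKernel (fun w z => a ![w, z]) ((B 0 1 * B 1 0 - B 0 0 * B 1 1) / B 1 0) (B 1 0) 0 0
            (x.1 1) (x.1 0) u.swap *
          stripKernel (fun w z => a ![w, z]) ((B 0 1 * B 1 0 - B 0 0 * B 1 1) / B 1 0) (B 1 0) 0 0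
            (y.1 1) (y.1 0) u.swap := by
      intro x y
      rw [← integral_mul_fin_two (fun u => stripKernel (fun w z => a ![w, z])
          ((B 0 1 * B 1 0 - B 0 0 * B 1 1) / B 1 0) (B 1 0) 0 0 (x.1 1) (x.1 0) u.swap)
        (fun u => stripKernel (fun w z => a ![w, z])
          ((B 0 1 * B 1 0 - B 0 0 * B 1 1) / B 1 0) (B 1 0) 0 0 (y.1 1) (y.1 0) u.swap)]
      simp only [Prod.swap_prod_mk, ← kernelV_eq_stripKernel_swap (D := mat21 B) (B := B) hα' h₂₁
        (by simp [mat21]) (by simp [mat21]) hprod' d3 d4]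
    have fbs21 : IsFractionalBrownianSheet (sigmaOne V21 P') (1 / 2) H₁ V21 P' :=
      isFractionalBrownianSheet_stripKernel_swap hW ha hq₂1 hκ0 hκ hα' h₂₁ hH₁
        (fun x => (wd21 x).2) gram21
    -- the field `V01`: a genuinely oblique strip kernel
    have d5 : mat01 B 0 0 * ((B 0 0 * B 1 1 - B 0 1 * B 1 0) / B 1 1) = 1 := by
      simpa [mat01] using hrow h₂₂
    have d6 : mat01 B 1 0 * ((B 0 0 * B 1 1 - B 0 1 * B 1 0) / B 1 1) = -(B 1 0 / B 1 1) := by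
      rw [← hdet2, show mat01 B 1 0 = B.det⁻¹ * -B 1 0 by simp [mat01]]
      field_simp
    have wd01 := vWellDefined_of_stripKernel ha hq₂1 hκ0 hκ (hα h₂₂) h₂₂ (D := mat01 B)
      (by simp [mat01]) (by simp [mat01]) (hprod h₂₂) d5 d6
    have gram01 : ∀ x y : Quadrant,
        ∫ u, kernelV B a (mat01 B) x u * kernelV B a (mat01 B) y u = ∫ u,
          stripKernel (fun w z => a ![w, z]) ((B 0 0 * B 1 1 - B 0 1 * B 1 0) / B 1 1) (B 1 1)
            (B 1 0 / B 1 1) 0 (x.1 0) (x.1 1) u *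
          stripKernel (fun w z => a ![w, z]) ((B 0 0 * B 1 1 - B 0 1 * B 1 0) / B 1 1) (B 1 1)
            (B 1 0 / B 1 1) 0 (y.1 0) (y.1 1) u := by
      intro x y
      rw [← integral_mul_fin_two]
      simp only [← kernelV_eq_stripKernel (D := mat01 B) (B := B) (hα h₂₂) h₂₂ (by simp [mat01])
        (by simp [mat01]) (hprod h₂₂) d5 d6]
    refine ⟨⟨wd11, wd21, wd01⟩, fbs11, fbs21, fun γ hγ => ⟨fun hγ1 => ?_, fun hγ1 => ?_,
      fun hγ1 => ?_⟩, fun hσ c hc => ?_⟩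
    · exact hasScalingLimit_stripKernel hε hX hW ha hβ hq₁ hq hq₂1 hκ0 hκ hdet h₂₂ hγ
        (by rw [hH₁]) (tendsto_mul_id_div_rpow _ hγ1)
        (tendsto_rpow_div_rpow_zero (hζ1.trans hγ1)) (fun x => (wd11 x).2) gram11
    · exact hasScalingLimit_stripKernel_swap hε hX hW ha hβ.swap hq₁ hq hq₂1 hκ0 hκ hdet' h₂₁ hγ
        hγ1 (by rw [hH₁]) (fun x => (wd21 x).2) gram21
    · subst hγ1
      refine hasScalingLimit_stripKernel hε hX hW ha hβ hq₁ hq hq₂1 hκ0 hκ hdet h₂₂ hγ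
        (by rw [hH₁]) ?_ (tendsto_rpow_div_rpow_zero hζ1) (fun x => (wd01 x).2) gram01
      refine tendsto_const_nhds.congr' ?_
      filter_upwards [eventually_gt_atTop 0] with l hl
      rw [Real.rpow_one, div_self hl.ne', mul_one]
    · refine not_eqFdd_of_isFractionalBrownianSheet hH₁0 (by norm_num) (by norm_num) hH₁0 fbs11
        fbs21 ⟨![2, 1], by simp [Fin.forall_fin_two]⟩ ?_ hσ hc
      -- along `(2, 1)` the variances grow with the exponents `2 H₁ > 1` and `1`
      have h1 : (2 : ℝ) ^ (1 : ℝ) < 2 ^ (2 * H₁) :=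
        Real.rpow_lt_rpow_of_exponent_lt (by norm_num) (by rw [hH₁]; linarith)
      simpa using h1.ne'
  · intro h₂₁
    have hd : B.det = B 0 0 * B 1 1 := by rw [hdet2, h₂₁, mul_zero, sub_zero]
    have h₁₁ : B 0 0 ≠ 0 := left_ne_zero_of_mul (hd ▸ hB)
    have h₂₂ : B 1 1 ≠ 0 := right_ne_zero_of_mul (hd ▸ hB)
    have hαd : (B 0 0 * B 1 1 - B 0 1 * B 1 0) / B 1 1 = B 0 0 := by
      rw [h₂₁, mul_zero, sub_zero, mul_div_cancel_right₀ _ h₂₂]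
    have hdd : |B 0 0 * B 1 1| = |B.det| := by rw [hd]
    obtain ⟨wd11, gram11, fbs11⟩ := hV11 h₂₂
    have wdt11 : TildeWellDefined B a (matTilde11 B) :=
      tildeWellDefined_degenerate ha hq₁ hq₂1 hκ0 hQ₂ hQt h₁₁ h₂₂
    have wdt00 : TildeWellDefined B a (matTilde00 B) :=
      tildeWellDefined_diagonal ha hq₂1 hκ0 hκ h₁₁ h₂₂
    have gramt11 : ∀ x y : Quadrant,
        ∫ u, kernelTilde B a (matTilde11 B) x u * kernelTilde B a (matTilde11 B) y u = ∫ u,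
          (x.1 1 * lineKernel (fun w z => a ![w, z]) (B 0 0) (B 1 1) (x.1 0) u) *
          (y.1 1 * lineKernel (fun w z => a ![w, z]) (B 0 0) (B 1 1) (y.1 0) u) := by
      intro x y
      rw [← integral_mul_of_scale (B := B) h₁₁ h₂₂ hdd]
      simp only [matTilde11, kernelTilde_eq_lineKernel h₁₁ h₂₂]
    have gramt00 : ∀ x y : Quadrant,
        ∫ u, kernelTilde B a (matTilde00 B) x u * kernelTilde B a (matTilde00 B) y u = ∫ u,
          stripKernel (fun w z => a ![w, z]) ((B 0 0 * B 1 1 - B 0 1 * B 1 0) / B 1 1) (B 1 1) 0 1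
            (x.1 0) (x.1 1) u *
          stripKernel (fun w z => a ![w, z]) ((B 0 0 * B 1 1 - B 0 1 * B 1 0) / B 1 1) (B 1 1) 0 1
            (y.1 0) (y.1 1) u := by
      intro x y
      rw [hαd, ← integral_mul_of_scale (B := B) h₁₁ h₂₂ hdd]
      simp only [matTilde00, kernelTilde_eq_stripKernel h₁₁ h₂₂]
    have fbst11 : IsFractionalBrownianSheet (sigmaOne Vt11 P') Ht₁ 1 Vt11 P' :=
      isFractionalBrownianSheet_lineKernel hW ha hq₁ hq₂1 hκ0 hQ₂ hQt h₁₁ h₂₂ hHt₁ hHt₁0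
        (fun x => (wdt11 x).2) gramt11
    have he₁ : ∀ γ : ℝ, Tendsto (fun l : ℝ => B 1 0 / B 1 1 * (l / l ^ γ)) atTop (𝓝 0) := by
      intro γ
      simp only [h₂₁, zero_div, zero_mul]
      exact tendsto_const_nhds
    refine ⟨⟨wd11, wdt11, wdt00⟩, fbs11, fbst11, fun γ hγ => ⟨fun hγ1 => ?_, fun hγ1 => ?_,
      fun hγ1 => ?_⟩, fun hσ c hc => ?_⟩
    · exact hasScalingLimit_stripKernel hε hX hW ha hβ hq₁ hq hq₂1 hκ0 hκ hdet h₂₂ hγ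
        (by rw [hH₁]) (he₁ γ) (tendsto_rpow_div_rpow_zero hγ1) (fun x => (wd11 x).2) gram11
    · rw [h₂₁] at hβ
      exact hasScalingLimit_lineKernel hε hX hW ha hβ hq₁ hq hq₂1 hκ0 hQ₂ hQt h₁₁ h₂₂ hγ hγ1
        (by rw [hHt₁]) (fun x => (wdt11 x).2) gramt11
    · refine hasScalingLimit_stripKernel hε hX hW ha hβ hq₁ hq hq₂1 hκ0 hκ hdet h₂₂ hγ
        (by rw [hH₁]) (he₁ γ) ?_ (fun x => (wdt00 x).2) gramt00
      refine tendsto_const_nhds.congr' ?_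
      filter_upwards [eventually_gt_atTop 0] with l hl
      rw [hγ1, div_self (Real.rpow_pos_of_pos hl _).ne']
    · refine not_eqFdd_of_isFractionalBrownianSheet hH₁0 (by norm_num) hHt₁0 one_ne_zero fbs11
        fbst11 ⟨![1, 2], by simp [Fin.forall_fin_two]⟩ ?_ hσ hc
      -- along `(1, 2)` the variances grow with the exponents `1` and `2`
      norm_num
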